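/- \textbf{Setting.} Let $X\subset\mathbb R$ be a nonempty finite union of bounded nondegenerate intervals, $\mathrm{Leb}_X$ normalized Lebesgue measure on $X$. Let $X_1,X_2,\dots\subseteq X$ be pairwise disjoint intervals covering $X$ up to a Lebesgue null set, $R:X\to\mathbb N$ constant on each $X_i$ with $\gcd\{R|_{X_i}\}=1$ and $\mathrm{Leb}_X(R>n)\approx n^{-k-\beta}$, where $k\in\mathbb N$, $k\ge1$, $\beta\in[0,1)$, $k+\beta>1$. Let $f:X\to X$ (the return map $F^R$ to the base of the polynomial Young tower with return time $R$) be differentiable and injective on each $X_i$, with $f(X_i)$ a union of some of the $X_j$ (up to points lying in no $X_j$), $\inf_i\mathrm{Leb}(f X_i)>0$, $\inf_i\inf_{X_i}|Df|>\theta^{-1}$ for a $\theta\in(0,1)$, with the iterated partitions separating points, and such that either $\big||Df(x)|/|Df(y)|-1\big|\le C|f(x)-f(y)|$ for all $x,y$ in a common $X_i$, or the same holds with $|f(x)-f(y)|^\alpha$, $\alpha\in(0,1)$, and $D(f^n)$ is monotone on every element of $\mathcal Z_{n-1}=\bigvee_{j=0}^{n-1}f^{-j}\{X_i\}$, $n\ge1$.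 Let $\mu_X$ be an $f$-invariant probability measure on $X$ whose density with respect to $\mathrm{Leb}_X$ is bounded above and bounded away from $0$. Let $s(x,y)$ be the least $n\ge0$ such that $f^nx,f^ny$ do not lie in a common $X_i$, $d_\theta(x,y)=\theta^{s(x,y)}$ ($=0$ if $x=y$), and $\operatorname{diam}_\theta$ the corresponding diameter. Fix $z_0\in X$ none of whose iterates $f^nz_0$, $n\ge0$, lies in the closure of the set of endpoints of the $X_i$. A hole is an interval $H\subseteq X$ with $z_0\in H$ and $\mu_X(H)>0$. Let $B$ be the Banach space of complex functions of bounded variation on $X$ with norm $\|\phi\|=\int|\phi|\,d\mathrm{Leb}_X+\bigvee_X\phi$, $T\phi(x)=\sum_{f(y)=x}\phi(y)/|Df(y)|$ (sum over $y\in\bigcup_iX_i$), $R(z)\phi=T(z^R\phi)$, $\mathring R(z)\phi=T(z^R\,\mathbb 1_{H^c}\!\circ\! f\,\phi)$ for $|z|\le1$, and $\mathring T=\mathring R(1)$. For $\delta>0$ put $$P(1)=\frac1{2\pi i}\int_{|z-1|=\delta}(z-T)^{-1}dz,\qquad \mathring P(1)=\frac1{2\pi i}\int_{|z-1|=\delta}(z-\mathring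 T)^{-1}dz .$$ For a function $\psi\notin B$ with $\mathring T\psi\in B$, $\mathring P(1)\psi$ is understood as $\frac1{2\pi i}\int_{|z-1|=\delta}z^{-1}(z-\mathring T)^{-1}(\mathring T\psi)\,dz$, which equals $\mathring P(1)\psi$ for $\psi\in B$; likewise for $P(1)$. \textbf{Statement.} The operators $R(z),\mathring R(z)$, $|z|\le1$, are bounded on $B$, and $\mu_X$ has a density $h\in B$ with values in a compact subset of $(0,\infty)$; moreover $T(\mathbb 1_{\{R\ge b\}}h),\mathring T(\mathbb 1_{\{R\ge b\}}h)\in B$ for all $b$. There is $\bar\theta\in(0,1)$ such that the uniform Lasota--Yorke inequalities hold: there are $C,\epsilon>0$ with $$\|\mathring R(z)^n\phi\|\le C|z|^n\bar\theta^n\|\phi\|+C|z|^n\int|\phi|\,d\mathrm{Leb}_X,\qquad \|R(z)^n\phi\|\le C|z|^n\bar\theta^n\|\phi\|+C|z|^n\int|\phi|\,d\mathrm{Leb}_X$$ for all $|z|\le1$, $n\ge1$, $\phi\in B$ and all holes with $\mu_X(H)\le\epsilon$; and there are $\delta\in(0,1)$ with $\bar\theta<(1-\delta)^2$ and $\sigma(T)\cap\{|z-1|\le\delta\}=\{1\}$.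 For every such $\delta$ there are $\sigma>0$ and $C>0$ such that the circle $|z-1|=\delta$ lies in the resolvent sets of $T$ and of $\mathring T$ for every hole with $\mu_X(H)\in(0,\sigma)$, and the following hold. (1) For every $N\ge1$ there is $a_N>0$ (depending on $N$, but not on $H$) such that for every hole with $\mu_X(H)\in(0,\sigma)$ and $\operatorname{diam}_\theta H\le\theta^N$, all integers $a>a_N$ and all $b\ge1$, $$\Big|\int_{\{R>a\}}[\mathring P(1)-P(1)](\mathbb 1_{\{R\ge b\}}h)\,d\mathrm{Leb}_X\Big|\le C\,E_N(a,b,H),$$ where $$E_N(a,b,H)=\frac{\mu_X(R>a)}{(1-\delta)^{N+1}}\big[\bar\theta^N+\mu_X(H)\big]\mu_X(R\ge b)+\mu_X(R>a)\frac{\bar\theta^N}{(1-\delta)^{2N+1}}\mu_X(R\ge b)+\frac{\mu_X(R>a)}{(1-\delta)^{2N+3}}\mu_X(H)\mu_X(R\ge b).$$ (2) For every $N\ge1$, every hole with $\mu_X(H)\in(0,\sigma)$, and all integers $a\ge0$, $b\ge1$, $$\Big|\int_{\{R>a\}}[\mathring P(1)-P(1)](\mathbb 1_{\{R\ge b\}}h)\,d\mathrm{Leb}_X\Big|\le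 C\Big(\frac{1}{(1-\delta)^{N+3}}\mu_X(R>a)^{\frac{2k}{2k+\beta}}\mu_X(H)^{\frac{\beta}{2k+\beta}}\mu_X(R\ge b)+E_N(a,b,H)\Big).$$ The constant $C$ does not depend on $N,a,b,H$. -/

import Mathlib

open MeasureTheory Set

/-- Normalized Lebesgue measure of `X ⊆ ℝ`, as a measure on the subtype `X`. -/
noncomputable def normalizedLebesgue (X : Set ℝ) : Measure X :=
  (volume X)⁻¹ • Measure.comap ((↑) : X → ℝ) volume

/-- The base of a polynomial Young tower over a finite union `X` of bounded intervals: the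
countable partition `P` of `X` into intervals (up to a Lebesgue null set), the return time `R`,
and the Gibbs-Markov return map `f = F^R` with derivative `df` on the partition elements. These
data determine the tower `{(x, n) : n < R x}` and its dynamics. Values of `f`, `df`, `R` off the
partition elements play no role. -/
structure YoungBase where
  X : Set ℝ
  X_nonempty : X.Nonempty
  X_isBounded : Bornology.IsBounded X
  X_intervals : ∃ (m : ℕ) (I : Fin m → Set ℝ),
    (∀ j, (I j).OrdConnected ∧ (interior (I j)).Nonempty) ∧ X = ⋃ j, I j
  /-- the partition -/
  P : ℕ → Set ℝ
  P_subset : ∀ i, P i ⊆ X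
  P_ordConnected : ∀ i, (P i).OrdConnected
  P_disjoint : ∀ i j, i ≠ j → Disjoint (P i) (P j)
  P_cover : volume (X \ ⋃ i, P i) = 0
  /-- the return time: constant on partition elements, aperiodic, with polynomial tail -/
  R : ℝ → ℕ
  R_pos : ∀ i, ∀ x ∈ P i, 1 ≤ R x
  R_const : ∀ i, ∀ x ∈ P i, ∀ y ∈ P i, R x = R y
  R_aperiodic : ∀ d : ℕ, (∀ i, ∀ x ∈ P i, d ∣ R x) → d = 1
  k : ℕ
  β : ℝ
  one_le_k : 1 ≤ k
  β_mem : β ∈ Ico (0 : ℝ) 1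
  one_lt_k_add_β : 1 < (k : ℝ) + β
  R_tail : ∃ C : ℝ, 1 ≤ C ∧ ∀ n : ℕ, 1 ≤ n →
    C⁻¹ * (n : ℝ) ^ (-((k : ℝ) + β)) ≤ (normalizedLebesgue X).real {x : X | n < R x} ∧
    (normalizedLebesgue X).real {x : X | n < R x} ≤ C * (n : ℝ) ^ (-((k : ℝ) + β))
  /-- the return map: each partition element is mapped bijectively onto a union of partition
  elements (up to points that lie in no partition element) -/
  f : ℝ → ℝ
  f_mapsTo : MapsTo f X X
  f_injOn : ∀ i, InjOn f (P i)
  f_markov : ∀ i j, P j ⊆ f '' P i ∨ Disjoint (P j) (f '' P i)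
  big_images : ∃ c : ℝ, 0 < c ∧ ∀ i, ENNReal.ofReal c ≤ volume (f '' P i)
  df : ℝ → ℝ
  hasDeriv : ∀ i, ∀ x ∈ P i, HasDerivWithinAt f (df x) (P i) x
  θ : ℝ
  θ_mem : θ ∈ Ioo (0 : ℝ) 1
  expansion : ∃ κ : ℝ, θ⁻¹ < κ ∧ ∀ i, ∀ x ∈ P i, κ ≤ |df x|
  separation : ∀ x y : ℝ, (∀ n, f^[n] x ∈ ⋃ i, P i) → (∀ n, f^[n] y ∈ ⋃ i, P i) → x ≠ y →
    ∃ n i j, i ≠ j ∧ f^[n] x ∈ P i ∧ f^[n] y ∈ P j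
  /-- Lipschitz distortion; or Hölder distortion together with monotonicity of `D(f^n)` on each
  element of the `n`-th refinement of the partition -/
  distortion :
    (∃ C : ℝ, 0 < C ∧ ∀ i, ∀ x ∈ P i, ∀ y ∈ P i, |(|df x| / |df y|) - 1| ≤ C * |f x - f y|) ∨
    ((∃ α ∈ Ioo (0 : ℝ) 1, ∃ C : ℝ, 0 < C ∧ ∀ i, ∀ x ∈ P i, ∀ y ∈ P i,
        |(|df x| / |df y|) - 1| ≤ C * |f x - f y| ^ α) ∧
      ∀ n : ℕ, 1 ≤ n → ∀ w : ℕ → ℕ,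
        MonotoneOn (fun x => ∏ j ∈ Finset.range n, df (f^[j] x))
          {x | ∀ j < n, f^[j] x ∈ P (w j)} ∨
        AntitoneOn (fun x => ∏ j ∈ Finset.range n, df (f^[j] x))
          {x | ∀ j < n, f^[j] x ∈ P (w j)})

namespace YoungBase

variable (D : YoungBase)

/-- Normalized Lebesgue measure on the base. -/
noncomputable def leb : Measure D.X := normalizedLebesgue D.X

/-- The return map as a self-map of the base. -/
def fX : D.X → D.X := D.f_mapsTo.restrict D.f D.X D.X

/-- `μ` is an invariant (SRB) probability measure on the base whose density with respect to
normalized Lebesgue measure is bounded above and bounded away from zero. -/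
def IsSRB (μ : Measure D.X) : Prop :=
  IsProbabilityMeasure μ ∧ (∀ s, MeasurableSet s → μ (D.fX ⁻¹' s) = μ s) ∧
  ∃ K : NNReal, 1 ≤ K ∧ K⁻¹ • D.leb ≤ μ ∧ μ ≤ K • D.leb

/-- The singularities of the return map (endpoints of partition elements), their accumulation
points, and all preimages of these. -/
def singular : Set ℝ := {x | ∃ n : ℕ, D.f^[n] x ∈ closure (⋃ i, frontier (D.P i))}

/-- A hole centred at `z₀`: a subinterval of the base containing `z₀`. -/
def IsHole (z₀ : ℝ) (H : Set ℝ) : Prop := z₀ ∈ H ∧ H ⊆ D.X ∧ H.OrdConnected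

/-- Measure of a subset of the line intersected with the base. -/
noncomputable def meas (μ : Measure D.X) (H : Set ℝ) : ℝ := μ.real {x : D.X | (x : ℝ) ∈ H}

/-- Separation time: the first `n` at which the `n`-th iterates do not lie in a common partition
element. -/
noncomputable def sepTime (x y : ℝ) : ℕ :=
  sInf {n : ℕ | ¬ ∃ i, D.f^[n] x ∈ D.P i ∧ D.f^[n] y ∈ D.P i}

open Classical in
/-- The metric `d_θ(x, y) = θ ^ s(x, y)` (zero for `x = y`, where the separation time is `∞`). -/
noncomputable def dθ (x y : ℝ) : ℝ := if x = y then 0 else D.θ ^ D.sepTime x y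

/-- Diameter with respect to `d_θ`. -/
noncomputable def diamθ (H : Set ℝ) : ℝ := sSup {r | ∃ x ∈ H, ∃ y ∈ H, r = D.dθ x y}

end YoungBase

/-! ### The Banach space of functions of bounded variation on the base -/

section Variation

variable {α : Type*} [LinearOrder α]

theorem eVariationOn_add_le (φ ψ : α → ℂ) (s : Set α) :
    eVariationOn (φ + ψ) s ≤ eVariationOn φ s + eVariationOn ψ s := by
  refine iSup_le fun p => ?_
  calc ∑ i ∈ Finset.range p.1, edist ((φ + ψ) (p.2.1 (i + 1))) ((φ + ψ) (p.2.1 i))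
      ≤ ∑ i ∈ Finset.range p.1, (edist (φ (p.2.1 (i + 1))) (φ (p.2.1 i)) +
          edist (ψ (p.2.1 (i + 1))) (ψ (p.2.1 i))) :=
        Finset.sum_le_sum fun i _ => edist_add_add_le _ _ _ _
    _ = _ := Finset.sum_add_distrib
    _ ≤ _ := add_le_add (eVariationOn.sum_le p.2.2.1 p.2.2.2)
        (eVariationOn.sum_le p.2.2.1 p.2.2.2)

theorem eVariationOn_smul (c : ℂ) (φ : α → ℂ) (s : Set α) :
    eVariationOn (c • φ) s = ‖c‖ₑ * eVariationOn φ s := by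
  simp only [eVariationOn, Pi.smul_apply, ENNReal.mul_iSup, Finset.mul_sum]
  refine iSup_congr fun p => Finset.sum_congr rfl fun i _ => ?_
  simp only [edist_eq_enorm_sub, ← smul_sub, enorm_smul]

end Variation

namespace YoungBase

variable (D : YoungBase)

theorem measurableSet_X : MeasurableSet D.X := by
  obtain ⟨m, I, hI, hX⟩ := D.X_intervals
  rw [hX]
  exact MeasurableSet.iUnion fun j => (hI j).1.measurableSet

theorem volume_X_ne_zero : volume D.X ≠ 0 := by
  obtain ⟨m, I, hI, hX⟩ := D.X_intervals
  obtain ⟨x, hx⟩ := D.X_nonempty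
  rw [hX, mem_iUnion] at hx
  obtain ⟨j, -⟩ := hx
  have h1 : 0 < volume (interior (I j)) := isOpen_interior.measure_pos volume (hI j).2
  refine (h1.trans_le (measure_mono ?_)).ne'
  rw [hX]
  exact interior_subset.trans (subset_iUnion I j)

theorem volume_X_ne_top : volume D.X ≠ ⊤ := D.X_isBounded.measure_lt_top.ne

instance : IsProbabilityMeasure D.leb := by
  constructor
  have h : Measure.comap ((↑) : D.X → ℝ) volume univ = volume D.X := by
    rw [(MeasurableEmbedding.subtype_coe D.measurableSet_X).comap_apply]
    simp
  simp only [leb, normalizedLebesgue, Measure.smul_apply, h, smul_eq_mul]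
  exact ENNReal.inv_mul_cancel D.volume_X_ne_zero D.volume_X_ne_top

/-- Complex functions of bounded variation on the base, as a subspace of all functions. (Such
functions are automatically integrable.) -/
noncomputable def bv : Submodule ℂ (D.X → ℂ) where
  carrier := {φ | BoundedVariationOn φ univ ∧ Integrable φ D.leb}
  zero_mem' := by
    refine ⟨?_, integrable_zero _ _ _⟩
    have : eVariationOn (0 : D.X → ℂ) univ = 0 :=
      eVariationOn.constant_on (by rintro _ ⟨a, -, rfl⟩ _ ⟨b, -, rfl⟩; rfl)
    simp [BoundedVariationOn, this]
  add_mem' := by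
    rintro φ ψ ⟨h1, h2⟩ ⟨h3, h4⟩
    exact ⟨ne_top_of_le_ne_top (ENNReal.add_ne_top.2 ⟨h1, h3⟩) (eVariationOn_add_le φ ψ univ),
      h2.add h4⟩
  smul_mem' := by
    rintro c φ ⟨h1, h2⟩
    refine ⟨?_, h2.smul c⟩
    rw [BoundedVariationOn, eVariationOn_smul]
    exact ENNReal.mul_ne_top enorm_ne_top h1

/-- The space `B` of functions of bounded variation on the base. -/
def BV : Type := D.bv

noncomputable instance : AddCommGroup D.BV := inferInstanceAs (AddCommGroup D.bv)
noncomputable instance : Module ℂ D.BV := inferInstanceAs (Module ℂ D.bv)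
instance : CoeFun D.BV (fun _ => D.X → ℂ) := ⟨fun φ => φ.1⟩

/-- `‖φ‖ = ∫ |φ| dLeb + Var φ`. -/
noncomputable instance : Norm D.BV :=
  ⟨fun φ => ∫ x, ‖φ x‖ ∂D.leb + (eVariationOn φ univ).toReal⟩

theorem norm_def (φ : D.BV) :
    ‖φ‖ = ∫ x, ‖φ x‖ ∂D.leb + (eVariationOn φ univ).toReal := rfl

theorem norm_apply_le (φ : D.BV) (x : D.X) : ‖φ x‖ ≤ ‖φ‖ := by
  have hv : ∀ y, ‖φ x‖ ≤ ‖φ y‖ + (eVariationOn φ univ).toReal := fun y => by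
    have h := φ.2.1.dist_le (mem_univ x) (mem_univ y)
    rw [dist_eq_norm] at h
    have := norm_le_norm_add_norm_sub' (φ x) (φ y)
    linarith
  have h := integral_mono (μ := D.leb) (integrable_const ‖φ x‖)
    (φ.2.2.norm.add (integrable_const (eVariationOn φ univ).toReal)) hv
  rw [integral_const, integral_add' φ.2.2.norm (integrable_const _), integral_const] at h
  simpa [norm_def] using h

theorem core : NormedSpace.Core ℂ D.BV where
  norm_nonneg φ := add_nonneg (integral_nonneg fun _ => norm_nonneg _) ENNReal.toReal_nonneg
  norm_smul c φ := by
    have h1 : eVariationOn (c • φ : D.BV) univ = ‖c‖ₑ * eVariationOn φ univ :=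
      eVariationOn_smul c φ univ
    have h2 : ∀ x, (c • φ : D.BV) x = c * φ x := fun x => rfl
    simp only [norm_def, h1, h2, norm_mul, integral_const_mul, ENNReal.toReal_mul, toReal_enorm,
      mul_add]
  norm_triangle φ ψ := by
    have h1 : eVariationOn (φ + ψ : D.BV) univ ≤ eVariationOn φ univ + eVariationOn ψ univ :=
      eVariationOn_add_le φ ψ univ
    have h2 : ∫ x, ‖(φ + ψ : D.BV) x‖ ∂D.leb ≤ ∫ x, ‖φ x‖ ∂D.leb + ∫ x, ‖ψ x‖ ∂D.leb := by
      rw [← integral_add φ.2.2.norm ψ.2.2.norm]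
      exact integral_mono (φ.2.2.add ψ.2.2).norm (φ.2.2.norm.add ψ.2.2.norm)
        fun x => norm_add_le (φ x) (ψ x)
    have h3 := ENNReal.toReal_mono (ENNReal.add_ne_top.2 ⟨φ.2.1, ψ.2.1⟩) h1
    rw [ENNReal.toReal_add φ.2.1 ψ.2.1] at h3
    simp only [norm_def]
    linarith
  norm_eq_zero_iff φ := by
    constructor
    · intro h
      refine Subtype.ext (funext fun x => ?_)
      have := D.norm_apply_le φ x
      rw [h] at this
      exact norm_le_zero_iff.1 this
    · rintro rfl
      have h1 : eVariationOn (0 : D.BV) univ = 0 :=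
        eVariationOn.constant_on (by rintro _ ⟨a, -, rfl⟩ _ ⟨b, -, rfl⟩; rfl)
      have h2 : ∀ x, (0 : D.BV) x = 0 := fun x => rfl
      simp [norm_def, h1, h2]

noncomputable instance : NormedAddCommGroup D.BV := NormedAddCommGroup.ofCore D.core
noncomputable instance : NormedSpace ℂ D.BV := NormedSpace.ofCore D.core

instance : CompleteSpace D.BV := by
  refine Metric.complete_of_cauchySeq_tendsto fun u hu => ?_
  have hsub : ∀ n m x, ‖u n x - u m x‖ ≤ ‖u n - u m‖ := fun n m x =>
    D.norm_apply_le (u n - u m) x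
  have hpt : ∀ x, CauchySeq fun n => u n x := fun x => by
    rw [Metric.cauchySeq_iff] at hu ⊢
    intro ε hε
    obtain ⟨N, hN⟩ := hu ε hε
    refine ⟨N, fun m hm n hn => ?_⟩
    rw [dist_eq_norm]
    refine (hsub m n x).trans_lt ?_
    rw [← dist_eq_norm]
    exact hN m hm n hn
  choose φ hφ using fun x => cauchySeq_tendsto_of_complete (hpt x)
  have hmeas : AEStronglyMeasurable φ D.leb :=
    aestronglyMeasurable_of_tendsto_ae Filter.atTop (fun n => (u n).2.2.1)
      (Filter.Eventually.of_forall hφ)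
  have hvar : ∀ n m, eVariationOn (u n - u m : D.BV) univ ≤ ENNReal.ofReal ‖u n - u m‖ :=
    fun n m => by
      rw [← ENNReal.ofReal_toReal (u n - u m).2.1]
      refine ENNReal.ofReal_le_ofReal ?_
      rw [norm_def]
      exact le_add_of_nonneg_left (integral_nonneg fun _ => norm_nonneg _)
  have key : ∀ ε : ℝ, 0 < ε → ∃ N, ∀ n, N ≤ n →
      (∀ x, ‖u n x - φ x‖ ≤ ε) ∧ eVariationOn ((u n : D.X → ℂ) - φ) univ ≤ ENNReal.ofReal ε := by
    intro ε hε
    obtain ⟨N, hN⟩ := Metric.cauchySeq_iff.1 hu ε hε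
    have hN' : ∀ n, N ≤ n → ∀ m, N ≤ m → ‖u n - u m‖ ≤ ε := fun n hn m hm => by
      rw [← dist_eq_norm]; exact (hN n hn m hm).le
    refine ⟨N, fun n hn => ⟨fun x => ?_, ?_⟩⟩
    · refine le_of_tendsto ((tendsto_const_nhds.sub (hφ x)).norm) ?_
      filter_upwards [Filter.eventually_ge_atTop N] with m hm
      exact (hsub n m x).trans (hN' n hn m hm)
    · by_contra hlt
      push Not at hlt
      have hev := eVariationOn.lowerSemicontinuous_aux (p := Filter.atTop)
        (F := fun m => ((u n - u m : D.BV) : D.X → ℂ)) (f := (u n : D.X → ℂ) - φ) (s := univ)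
        (fun x _ => tendsto_const_nhds.sub (hφ x)) hlt
      obtain ⟨m, hm1, hm2⟩ := (hev.and (Filter.eventually_ge_atTop N)).exists
      exact absurd hm1 (not_lt.2 ((hvar n m).trans
        (ENNReal.ofReal_le_ofReal (hN' n hn m hm2))))
  have hdiff : ∀ n, (∃ ε : ℝ, (∀ x, ‖u n x - φ x‖ ≤ ε) ∧
      eVariationOn ((u n : D.X → ℂ) - φ) univ ≤ ENNReal.ofReal ε) →
      ((u n : D.X → ℂ) - φ) ∈ D.bv := by
    rintro n ⟨ε, h1, h2⟩
    exact ⟨ne_top_of_le_ne_top ENNReal.ofReal_ne_top h2,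
      Integrable.of_bound ((u n).2.2.1.sub hmeas) ε (Filter.Eventually.of_forall h1)⟩
  obtain ⟨N₁, hN₁⟩ := key 1 one_pos
  have hmem : φ ∈ D.bv := by
    have h := D.bv.sub_mem (u N₁).2 (hdiff N₁ ⟨1, hN₁ N₁ le_rfl⟩)
    simpa using h
  let φB : D.BV := ⟨φ, hmem⟩
  refine ⟨φB, Metric.tendsto_atTop.2 fun ε hε => ?_⟩
  obtain ⟨N, hN⟩ := key (ε / 3) (by positivity)
  refine ⟨N, fun n hn => ?_⟩
  obtain ⟨h1, h2⟩ := hN n hn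
  have hi : ∫ x, ‖(u n - φB : D.BV) x‖ ∂D.leb ≤ ε / 3 := by
    have := integral_mono (μ := D.leb) (u n - φB : D.BV).2.2.norm
      (integrable_const (ε / 3)) h1
    simpa using this
  have hv : (eVariationOn (u n - φB : D.BV) univ).toReal ≤ ε / 3 :=
    ENNReal.toReal_le_of_le_ofReal (by positivity) h2
  rw [dist_eq_norm, norm_def]
  linarith

/-! ### Transfer operators and spectral projections -/

/-- The points of the partition elements that are mapped to `x`. -/
def fibre (x : D.X) : Type := {y : D.X // (y : ℝ) ∈ ⋃ i, D.P i ∧ D.fX y = x}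

/-- The transfer operator of the return map, on arbitrary functions:
`(T ψ)(x) = ∑_{f y = x} ψ y / |f' y|`. -/
noncomputable def T (ψ : D.X → ℂ) (x : D.X) : ℂ :=
  ∑' y : D.fibre x, ψ y.1 / ((|D.df y.1| : ℝ) : ℂ)

open Classical in
/-- `1_{Hᶜ} ∘ f`. -/
noncomputable def survive (H : Set ℝ) (y : D.X) : ℂ := if (D.fX y : ℝ) ∈ H then 0 else 1

/-- The open transfer operator `T(1_{Hᶜ} ∘ f · ψ)` on arbitrary functions. -/
noncomputable def openT (H : Set ℝ) (ψ : D.X → ℂ) : D.X → ℂ :=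
  D.T fun y => D.survive H y * ψ y

/-- `A` is the operator `φ ↦ T(u^R · 1_{Hᶜ} ∘ f · φ)` on functions of bounded variation. -/
def IsRop (H : Set ℝ) (u : ℂ) (A : D.BV →L[ℂ] D.BV) : Prop :=
  ∀ φ : D.BV, (A φ : D.X → ℂ) = D.openT H fun y => u ^ D.R y * φ y

open Classical in
/-- The operator with hole `H`, `φ ↦ T(u^R · 1_{Hᶜ} ∘ f · φ)`, as a bounded operator on `B`. For
`H = ∅` it is the closed operator; for `u = 1` it is the (open) transfer operator. -/
noncomputable def Rop (H : Set ℝ) (u : ℂ) : D.BV →L[ℂ] D.BV :=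
  if h : ∃ A, D.IsRop H u A then h.choose else 0

/-- The spectral projection `(2πi)⁻¹ ∮_{|z - 1| = δ} (z - R_H(1))⁻¹ dz`. -/
noncomputable def proj (H : Set ℝ) (δ : ℝ) : D.BV →L[ℂ] D.BV :=
  (2 * Real.pi * Complex.I : ℂ)⁻¹ • ∮ z in C(1, δ), resolvent (D.Rop H 1) z

open Classical in
/-- A function of bounded variation as an element of `B`. -/
noncomputable def toBV (ψ : D.X → ℂ) : D.BV := if h : ψ ∈ D.bv then ⟨ψ, h⟩ else 0

/-- The natural extension of `proj H δ` to functions `ψ` that need not be of bounded variation but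
whose image under the open transfer operator is, obtained from
`(z - A)⁻¹ ψ = ψ / z + z⁻¹ (z - A)⁻¹ (A ψ)`; the term `ψ / z` is holomorphic inside the contour. -/
noncomputable def projExt (H : Set ℝ) (δ : ℝ) (ψ : D.X → ℂ) : D.BV :=
  (2 * Real.pi * Complex.I : ℂ)⁻¹ •
    ∮ z in C(1, δ), z⁻¹ • resolvent (D.Rop H 1) z (D.toBV (D.openT H ψ))

/-- `1_{R ≥ b} h`. -/
noncomputable def cutoff (h : D.X → ℝ) (b : ℕ) (x : D.X) : ℂ := if b ≤ D.R x then (h x : ℂ) else 0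

/-- `h` is a version of bounded variation, with values in a compact subset of `(0, ∞)`, of the
density of `μ`. -/
def IsDensity (μ : Measure D.X) (h : D.X → ℝ) : Prop :=
  (fun x => (h x : ℂ)) ∈ D.bv ∧ (∃ K : ℝ, 1 ≤ K ∧ ∀ x, K⁻¹ ≤ h x ∧ h x ≤ K) ∧
  μ = D.leb.withDensity fun x => ENNReal.ofReal (h x)

/-- Uniform Lasota-Yorke inequalities with rate `θb` for the closed operators and for the
operators with a small hole centred at `z₀`. -/
def LasotaYorke (μ : Measure D.X) (z₀ θb : ℝ) : Prop :=
  ∃ C > 0, ∃ ε > 0, ∀ H : Set ℝ, (H = ∅ ∨ D.IsHole z₀ H ∧ 0 < D.meas μ H ∧ D.meas μ H ≤ ε) →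
    ∀ u : ℂ, ‖u‖ ≤ 1 → ∀ n : ℕ, 1 ≤ n → ∀ φ : D.BV,
      ‖(D.Rop H u ^ n) φ‖ ≤ C * ‖u‖ ^ n * θb ^ n * ‖φ‖ + C * ‖u‖ ^ n * ∫ x, ‖φ x‖ ∂D.leb

/-- Admissible radii of the contour around the eigenvalue `1` of the closed transfer operator. -/
def Admissible (θb δ : ℝ) : Prop :=
  0 < δ ∧ δ < 1 ∧ θb < (1 - δ) ^ 2 ∧
    spectrum ℂ (D.Rop ∅ 1) ∩ Metric.closedBall (1 : ℂ) δ = {1}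

/-- `|∫_{R > a} [P_H - P_∅](1_{R ≥ b} h) dLeb|`. -/
noncomputable def projError (H : Set ℝ) (δ : ℝ) (h : D.X → ℝ) (a b : ℕ) : ℝ :=
  ‖∫ x in {x : D.X | a < D.R x},
    (D.projExt H δ (D.cutoff h b) x - D.projExt ∅ δ (D.cutoff h b) x) ∂D.leb‖

/-- `μ(R > a)`. -/
noncomputable def tailGT (μ : Measure D.X) (a : ℕ) : ℝ := μ.real {x : D.X | a < D.R x}

/-- `μ(R ≥ b)`. -/
noncomputable def tailGE (μ : Measure D.X) (b : ℕ) : ℝ := μ.real {x : D.X | b ≤ D.R x}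

end YoungBase

/-! Uniform Lasota–Yorke inequalities. Bounded distortion and large images show that on a cylinder
of length `n` the weight `1/|D(f^n)|` is at most a constant times `κ^{-n}` and also a constant times
the measure of the cylinder, with variation of the same size. Hence the `n`-th power of every
operator, with or without hole, is a norm-convergent sum over words of single-branch operators
(`hasSum_wordOp`). A supremum on a cylinder is at most an average plus the variation, and the
variations over disjoint cylinders add up. Following an interval hole for `n` steps costs only a
factor linear in `n`, which the slack `θκ > 1` absorbs, so the rate can be taken to be `θ` itself
(`exists_uniform_lasotaYorke`).

Spectrum. Composition with a step map has finite rank and is close to the identity from `B` to `L¹`.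
By Lasota–Yorke a power of `T` is then a small perturbation of a finite-rank operator, and an
analytic determinant shows that `1` is isolated in the spectrum (`eventually_mem_resolventSet`).
Iterating `T` on `L¹`-approximations of the density of `μ` gives a sequence bounded in `B`, whose
limit is a version of bounded variation (`IsSRB.exists_density`).

Stability. Opening the hole changes `T` by `O(μ(H))` from `B` to `L¹`. Together with the
Lasota–Yorke inequalities this bounds `(z - A)⁻¹` on the circle uniformly in the hole, as in Keller
and Liverani (`exists_uniform_lower_bound`, `sphere_subset_resolventSet`).

The projections. The circle does not enclose `0`, so `∮ z⁻¹ (z - A)⁻¹ φ = ∮ z^{-(N+1)} A^N (z - A)⁻¹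
φ` for every `N`, with `φ` the image of `1_{R ≥ b} h`. That image has norm `O(μ(R ≥ b))`, because
only the branches with `R ≥ b` contribute (`openT_cutoff`). Write `A₀` and `A` for the closed and
the open operator. The difference of the integrands is `(A^N - A₀^N)` applied to the open resolvent
plus `A₀^N` applied to the difference of the resolvents. The latter difference is small in `L¹`, and
`A₀^N` turns this into smallness in `B`; since `B` embeds in `L^∞`, integration over `{R > a}`
supplies the factor `μ(R > a)`. This gives the terms of `E_N` (`norm_functional_proj_sub_le`).

The difference of powers. Telescoping produces terms `A₀^i (A - A₀) A^{N-1-i} χ`, each supported in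
`f^i H`. If the hole has `d_θ`-diameter at most `θ^N`, then `R = R(f^i z₀)` on `f^i H` for `i < N`,
so for `a > a_N` these sets miss `{R > a}` and the contribution vanishes
(`setIntegralL_pow_sub_eq_zero`). In general a term is bounded both by `μ(H)` and by `μ(R > a)(θ^i +
μ(H))`; interpolating the minimum and summing over `i` gives the fractional powers in the second
estimate (`IsSRB.exists_pow_sub_bound`). -/

open scoped ENNReal NNReal Topology

/-! ### Variation of indicators, products and functions on disjoint intervals. -/

section VariationLemmas

variable {α β : Type*} [LinearOrder α] [LinearOrder β]

theorem eVariationOn_le_of_monotoneOn {f : α → ℝ} {s : Set α} (hf : MonotoneOn f s) {a b : ℝ}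
    (h : ∀ x ∈ s, f x ∈ Icc a b) : eVariationOn f s ≤ ENNReal.ofReal (b - a) := by
  -- The set `s` may lack a least or a greatest point, so it is exhausted by its intersections with
  -- closed intervals whose ends lie in `s`.
  rw [eVariationOn.eq_biSup_inter_Icc]
  simp only [iSup_le_iff]
  rintro ⟨x, y⟩ ⟨hx, hy, -⟩
  rw [hf.eVariationOn_eq hx hy]
  exact ENNReal.ofReal_le_ofReal (by have := h x hx; have := h y hy; simp only [mem_Icc] at *; linarith)

theorem eVariationOn_le_of_antitoneOn {f : α → ℝ} {s : Set α} (hf : AntitoneOn f s) {a b : ℝ}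
    (h : ∀ x ∈ s, f x ∈ Icc a b) : eVariationOn f s ≤ ENNReal.ofReal (b - a) := by
  have h1 : eVariationOn f s = eVariationOn (fun x => - f x) s := by
    simp only [eVariationOn, edist_neg_neg]
  rw [h1, show b - a = -a - -b by ring]
  refine eVariationOn_le_of_monotoneOn (fun x hx y hy hxy => neg_le_neg (hf hx hy hxy)) ?_
  intro x hx
  have := h x hx
  simp only [mem_Icc] at *
  constructor <;> linarith

theorem eVariationOn_ofReal_comp (f : α → ℝ) (s : Set α) :
    eVariationOn (fun x => (f x : ℂ)) s = eVariationOn f s := by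
  simp only [eVariationOn]
  congr! 4
  exact Complex.isometry_ofReal.edist_eq _ _

theorem eVariationOn_indicator_isUpperSet_le {U : Set α} (hU : IsUpperSet U) (s : Set α) :
    eVariationOn (U.indicator (fun _ => (1 : ℂ))) s ≤ 1 := by
  classical
  have h1 : U.indicator (fun _ => (1 : ℂ)) = fun x => ((U.indicator (fun _ => (1 : ℝ)) x : ℝ) : ℂ) := by
    ext x
    by_cases hx : x ∈ U <;> simp [hx]
  rw [h1, eVariationOn_ofReal_comp]
  refine (eVariationOn_le_of_monotoneOn (a := 0) (b := 1) ?_ ?_).trans (by simp)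
  · intro x _ y _ hxy
    by_cases hx : x ∈ U
    · simp [hx, hU hxy hx]
    · simp only [hx, not_false_eq_true, indicator_of_notMem]
      exact indicator_nonneg (fun _ _ => zero_le_one) _
  · intro x _
    by_cases hx : x ∈ U <;> simp [hx]

theorem eVariationOn_sub_le (φ ψ : α → ℂ) (s : Set α) :
    eVariationOn (φ - ψ) s ≤ eVariationOn φ s + eVariationOn ψ s := by
  have h := eVariationOn_add_le φ ((-1 : ℂ) • ψ) s
  rw [eVariationOn_smul] at h
  simpa [sub_eq_add_neg] using h

/-- The indicator is a difference of two indicators of upper sets, namely the points above some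
point of `J` and those among them outside `J`; each has variation at most `1`. -/
theorem eVariationOn_indicator_ordConnected_le {J : Set α} (hJ : J.OrdConnected) (s : Set α) :
    eVariationOn (J.indicator (fun _ => (1 : ℂ))) s ≤ 2 := by
  have hU : IsUpperSet {x : α | ∃ a ∈ J, a ≤ x} := fun x y hxy ⟨a, ha, hax⟩ => ⟨a, ha, hax.trans hxy⟩
  have hV : IsUpperSet {x : α | (∃ a ∈ J, a ≤ x) ∧ x ∉ J} := by
    rintro x y hxy ⟨⟨a, ha, hax⟩, hx⟩
    exact ⟨⟨a, ha, hax.trans hxy⟩, fun hy => hx (hJ.out ha hy ⟨hax, hxy⟩)⟩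
  have h1 : J.indicator (fun _ => (1 : ℂ)) = {x : α | ∃ a ∈ J, a ≤ x}.indicator (fun _ => (1 : ℂ)) -
      {x : α | (∃ a ∈ J, a ≤ x) ∧ x ∉ J}.indicator (fun _ => (1 : ℂ)) := by
    classical
    ext x
    simp only [indicator_apply, Pi.sub_apply, mem_ofPred_eq]
    by_cases hx : x ∈ J
    · have : ∃ a ∈ J, a ≤ x := ⟨x, hx, le_rfl⟩
      simp [hx, this]
    · simp [hx]
  rw [h1]
  refine (eVariationOn_sub_le _ _ s).trans ?_
  refine (add_le_add (eVariationOn_indicator_isUpperSet_le hU s)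
    (eVariationOn_indicator_isUpperSet_le hV s)).trans ?_
  norm_num

theorem eVariationOn_mul_le {f g : α → ℂ} {M N : ℝ≥0∞} {s : Set α} (hf : ∀ x ∈ s, ‖f x‖ₑ ≤ M)
    (hg : ∀ x ∈ s, ‖g x‖ₑ ≤ N) :
    eVariationOn (fun x => f x * g x) s ≤ M * eVariationOn g s + N * eVariationOn f s :=
  eVariationOn_smul_le hf hg

/-- A function that vanishes outside an order connected set. -/
theorem eVariationOn_le_of_eq_zero {J : Set α} (hJ : J.OrdConnected) {ψ : α → ℂ}
    (h0 : ∀ x ∉ J, ψ x = 0) {M : ℝ≥0∞} (hM : ∀ x ∈ J, ‖ψ x‖ₑ ≤ M) :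
    eVariationOn ψ univ ≤ eVariationOn ψ J + 2 * M := by
  refine iSup_le ?_
  rintro ⟨n, u, hu, -⟩
  simp only
  by_cases hne : ∃ i ≤ n, u i ∈ J
  · classical
    obtain ⟨i, hin, hi⟩ := hne
    let p := Nat.find (⟨i, hi⟩ : ∃ i, u i ∈ J)
    have hp : u p ∈ J := Nat.find_spec (⟨i, hi⟩ : ∃ i, u i ∈ J)
    have hpmin : ∀ k < p, u k ∉ J := fun k hk => Nat.find_min (⟨i, hi⟩ : ∃ i, u i ∈ J) hk
    let q := Nat.findGreatest (fun k => u k ∈ J) n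
    have hq : u q ∈ J := Nat.findGreatest_spec (P := fun k => u k ∈ J) hin hi
    have hqmax : ∀ k ≤ n, u k ∈ J → k ≤ q := fun k hk h => Nat.le_findGreatest hk h
    have hpn : p ≤ n := (Nat.find_min' _ hi).trans hin
    have hpq : p ≤ q := hqmax p hpn hp
    -- Clamping the index between the first and the last visit to `J` keeps the whole chain `v`
    -- inside `J` and changes only points where `ψ` vanishes, so `ψ ∘ u = (χ ∘ u) · (ψ ∘ v)`. The
    -- product rule then splits the sum into the variation on `J` and the two jumps of the
    -- indicator.
    let v : ℕ → α := fun k => u (max p (min k q))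
    have hv : Monotone v := fun a b hab => hu (by gcongr)
    have hvJ : ∀ k, v k ∈ J := fun k =>
      hJ.out hp hq ⟨hu (le_max_left _ _), hu (by simp [hpq])⟩
    let χ : α → ℂ := J.indicator fun _ => 1
    have hψ : ∀ k ≤ n, ψ (u k) = χ (u k) * ψ (v k) := by
      intro k hk
      by_cases hkJ : u k ∈ J
      · have h1 : k ≤ q := hqmax k hk hkJ
        have h2 : p ≤ k := not_lt.1 fun h => hpmin k h hkJ
        simp [χ, hkJ, v, h1, h2]
      · simp [χ, hkJ, h0 _ hkJ]
    have hχ1 : ∀ x, ‖χ x‖ₑ ≤ 1 := by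
      intro x
      by_cases hx : x ∈ J <;> simp [χ, hx]
    have hterm : ∀ k ∈ Finset.range n, edist (ψ (u (k + 1))) (ψ (u k)) ≤
        edist (ψ (v (k + 1))) (ψ (v k)) + M * edist (χ (u (k + 1))) (χ (u k)) := by
      intro k hk
      have hk' := Finset.mem_range.1 hk
      rw [hψ k hk'.le, hψ (k + 1) hk']
      calc edist (χ (u (k + 1)) * ψ (v (k + 1))) (χ (u k) * ψ (v k))
          ≤ edist (χ (u (k + 1)) * ψ (v (k + 1))) (χ (u (k + 1)) * ψ (v k)) +
            edist (χ (u (k + 1)) * ψ (v k)) (χ (u k) * ψ (v k)) := edist_triangle _ _ _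
        _ = ‖χ (u (k + 1))‖ₑ * edist (ψ (v (k + 1))) (ψ (v k)) +
            ‖ψ (v k)‖ₑ * edist (χ (u (k + 1))) (χ (u k)) := by
          simp only [edist_eq_enorm_sub, ← mul_sub, ← sub_mul, enorm_mul]
          ring
        _ ≤ 1 * edist (ψ (v (k + 1))) (ψ (v k)) + M * edist (χ (u (k + 1))) (χ (u k)) := by
          gcongr
          · exact hχ1 _
          · exact hM _ (hvJ k)
        _ = _ := by rw [one_mul]
    refine (Finset.sum_le_sum hterm).trans ?_
    rw [Finset.sum_add_distrib, ← Finset.mul_sum, mul_comm 2 M]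
    gcongr
    · exact eVariationOn.sum_le hv hvJ
    · exact (eVariationOn.sum_le hu fun _ => mem_univ _).trans
        (eVariationOn_indicator_ordConnected_le hJ univ)
  · push Not at hne
    rw [Finset.sum_eq_zero]
    · exact zero_le
    · intro k hk
      have hk' := Finset.mem_range.1 hk
      rw [h0 _ (hne k hk'.le), h0 _ (hne (k + 1) hk'), edist_self]

/-- Disjoint order-connected sets are linearly ordered by position. Variation is superadditive over
a union of a left and a right set, so it suffices to split off the rightmost set, found by comparing
one chosen point of each set. -/
theorem finset_sum_eVariationOn_le {ι E : Type*} [PseudoEMetricSpace E] (φ : α → E) (S : ι → Set α)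
    (hS : ∀ i, (S i).OrdConnected) (hd : ∀ i j, i ≠ j → Disjoint (S i) (S j)) (F : Finset ι) :
    ∑ i ∈ F, eVariationOn φ (S i) ≤ eVariationOn φ (⋃ i ∈ F, S i) := by
  classical
  rcases F.eq_empty_or_nonempty with rfl | ⟨i₀, -⟩
  · simp
  by_cases hα : Nonempty α
  swap
  · have : IsEmpty α := not_nonempty_iff.1 hα
    simp [eVariationOn.subsingleton, Set.subsingleton_of_subsingleton]
  obtain ⟨x₀⟩ := hα
  let pt : ι → α := fun i => if h : (S i).Nonempty then h.some else x₀
  have hpt : ∀ i, (S i).Nonempty → pt i ∈ S i := fun i h => by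
    simp only [pt, h, dif_pos]; exact h.some_mem
  induction F using Finset.induction_on_max_value pt with
  | empty => simp
  | insert a F ha hmax ih =>
    rw [Finset.sum_insert ha, Finset.set_biUnion_insert, add_comm, union_comm]
    refine (add_le_add_left ih _).trans (eVariationOn.add_le_union φ ?_)
    intro x hx y hy
    simp only [mem_iUnion] at hx
    obtain ⟨j, hj, hxj⟩ := hx
    have hja : j ≠ a := fun h => ha (h ▸ hj)
    by_contra hlt
    push Not at hlt
    have hpa := hpt a ⟨y, hy⟩
    have hpj := hpt j ⟨x, hxj⟩
    have hle := hmax j hj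
    have hdis := Set.disjoint_left.1 (hd j a hja)
    rcases le_total x (pt a) with h | h
    · exact hdis hxj ((hS a).out hy hpa ⟨hlt.le, h⟩)
    · exact hdis ((hS j).out hpj hxj ⟨hle, h⟩) hpa

theorem tsum_eVariationOn_le {ι E : Type*} [PseudoEMetricSpace E] (φ : α → E) (S : ι → Set α)
    (hS : ∀ i, (S i).OrdConnected) (hd : ∀ i j, i ≠ j → Disjoint (S i) (S j)) :
    ∑' i, eVariationOn φ (S i) ≤ eVariationOn φ univ := by
  rw [ENNReal.tsum_eq_iSup_sum]
  exact iSup_le fun F => (finset_sum_eVariationOn_le φ S hS hd F).trans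
    (eVariationOn.mono φ (subset_univ _))

theorem enorm_le_add_eVariationOn {φ : α → ℂ} {s : Set α} {x y : α} (hx : x ∈ s) (hy : y ∈ s) :
    ‖φ x‖ₑ ≤ ‖φ y‖ₑ + eVariationOn φ s := by
  calc ‖φ x‖ₑ = ‖φ y + (φ x - φ y)‖ₑ := by congr 1; ring
    _ ≤ ‖φ y‖ₑ + ‖φ x - φ y‖ₑ := enorm_add_le _ _
    _ ≤ _ := by rw [← edist_eq_enorm_sub]; gcongr; exact eVariationOn.edist_le φ hx hy

end VariationLemmas

/-! ### The transfer operator of a single inverse branch. -/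

section Branch

variable {α : Type*}

open Classical in
/-- The transfer operator of one inverse branch of `F`, defined on `S`, with weight `G`. -/
noncomputable def branchOp (S : Set α) (F : α → α) (G : α → ℂ) (ψ : α → ℂ) (x : α) : ℂ :=
  if h : ∃ y ∈ S, F y = x then G h.choose * ψ h.choose else 0

variable {S S' : Set α} {F F' : α → α} {G G' : α → ℂ}

theorem branchOp_apply (hF : InjOn F S) (ψ : α → ℂ) {y : α} (hy : y ∈ S) :
    branchOp S F G ψ (F y) = G y * ψ y := by
  have h : ∃ z ∈ S, F z = F y := ⟨y, hy, rfl⟩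
  have h1 : h.choose = y := hF h.choose_spec.1 hy h.choose_spec.2
  rw [branchOp, dif_pos h, h1]

theorem branchOp_eq_zero (ψ : α → ℂ) {x : α} (hx : x ∉ F '' S) : branchOp S F G ψ x = 0 := by
  rw [branchOp, dif_neg]
  rintro ⟨y, hy, rfl⟩
  exact hx ⟨y, hy, rfl⟩

theorem branchOp_add (φ ψ : α → ℂ) :
    branchOp S F G (φ + ψ) = branchOp S F G φ + branchOp S F G ψ := by
  ext x
  by_cases h : ∃ y ∈ S, F y = x
  · simp [branchOp, h, mul_add]
  · simp [branchOp, h]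

theorem branchOp_smul (c : ℂ) (ψ : α → ℂ) : branchOp S F G (c • ψ) = c • branchOp S F G ψ := by
  ext x
  by_cases h : ∃ y ∈ S, F y = x
  · simp [branchOp, h, mul_left_comm]
  · simp [branchOp, h]

/-- Closure under composition is what lets powers of the transfer operator be expanded over words,
with multiplicative weights. -/
theorem branchOp_comp (hF : InjOn F S) (hF' : InjOn F' S') (ψ : α → ℂ) :
    branchOp S' F' G' (branchOp S F G ψ) =
      branchOp (S ∩ F ⁻¹' S') (F' ∘ F) (fun y => G' (F y) * G y) ψ := by
  have hinj : InjOn (F' ∘ F) (S ∩ F ⁻¹' S') := fun x hx y hy h =>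
    hF hx.1 hy.1 (hF' hx.2 hy.2 h)
  ext x
  by_cases hx : x ∈ F' '' S'
  · obtain ⟨z, hz, rfl⟩ := hx
    rw [branchOp_apply hF' _ hz]
    by_cases hz' : z ∈ F '' S
    · obtain ⟨y, hy, rfl⟩ := hz'
      rw [branchOp_apply hF _ hy]
      have := branchOp_apply (G := fun y => G' (F y) * G y) hinj ψ (y := y) ⟨hy, hz⟩
      simp only [Function.comp] at this
      rw [this, mul_assoc]
    · rw [branchOp_eq_zero ψ hz', mul_zero, branchOp_eq_zero]
      rintro ⟨y, ⟨hy, hy'⟩, h⟩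
      exact hz' ⟨y, hy, hF' hy' hz h⟩
  · rw [branchOp_eq_zero _ hx, branchOp_eq_zero]
    rintro ⟨y, ⟨hy, hy'⟩, rfl⟩
    exact hx ⟨F y, hy', rfl⟩

/-- The variation of the image of a function under a monotone branch. -/
theorem eVariationOn_branchOp_le [LinearOrder α] (hF : InjOn F S)
    (hmono : MonotoneOn F S ∨ AntitoneOn F S) (hJ : (F '' S).OrdConnected) {M V N : ℝ≥0∞}
    (hM : ∀ y ∈ S, ‖G y‖ₑ ≤ M) (hV : eVariationOn G S ≤ V) {ψ : α → ℂ}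
    (hN : ∀ y ∈ S, ‖ψ y‖ₑ ≤ N) :
    eVariationOn (branchOp S F G ψ) univ ≤ M * eVariationOn ψ S + (V + 2 * M) * N := by
  have h1 : eVariationOn (branchOp S F G ψ) (F '' S) = eVariationOn (fun y => G y * ψ y) S := by
    have : eVariationOn (fun y => G y * ψ y) S = eVariationOn (branchOp S F G ψ ∘ F) S :=
      eVariationOn.congr fun y hy => (branchOp_apply hF ψ hy).symm
    rw [this]
    rcases hmono with h | h
    · exact (eVariationOn.comp_eq_of_monotoneOn _ F h).symm
    · exact (eVariationOn.comp_eq_of_antitoneOn _ F h).symm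
  have h2 : ∀ x ∈ F '' S, ‖branchOp S F G ψ x‖ₑ ≤ M * N := by
    rintro _ ⟨y, hy, rfl⟩
    rw [branchOp_apply hF ψ hy, enorm_mul]
    exact mul_le_mul' (hM y hy) (hN y hy)
  refine (eVariationOn_le_of_eq_zero hJ (fun x hx => branchOp_eq_zero ψ hx) h2).trans ?_
  rw [h1]
  refine (add_le_add_left (eVariationOn_mul_le hM hN) _).trans ?_
  calc M * eVariationOn ψ S + N * eVariationOn G S + 2 * (M * N)
      ≤ M * eVariationOn ψ S + N * V + 2 * (M * N) := by gcongr
    _ = _ := by ring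

end Branch

/-! ### Lasota–Yorke inequalities and resolvent stability for a strong norm and a weak seminorm. -/

section WeakStrong

variable {E : Type*} [NormedAddCommGroup E] [NormedSpace ℂ E]

/-- Power bounds of an operator in terms of a strong norm and a weak seminorm. -/
structure UniformLY (ν : Seminorm ℂ E) (C θ : ℝ) (A : E →L[ℂ] E) : Prop where
  weak : ∀ φ, ν (A φ) ≤ ν φ
  strong : ∀ n φ, ‖(A ^ n) φ‖ ≤ C * θ ^ n * ‖φ‖ + C * ν φ

/-- A contraction inequality for one power `m` propagates to all powers by strong induction in steps
of `m`; the weak terms form a geometric series. The factor `t` is later `‖u‖` and has to be carried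
along exactly. -/
theorem lasotaYorke_iterate {ν : Seminorm ℂ E} {A : E →L[ℂ] E} {t θ M C : ℝ} {m : ℕ} (ht : 0 ≤ t)
    (hθ : 0 < θ) (hθ1 : θ < 1) (hm : 1 ≤ m) (hM : 1 ≤ M) (hC : 0 ≤ C)
    (hν : ∀ φ, ν (A φ) ≤ t * ν φ) (h1 : ∀ φ, ‖A φ‖ ≤ t * M * ‖φ‖)
    (h : ∀ φ, ‖(A ^ m) φ‖ ≤ t ^ m * (θ ^ m * ‖φ‖ + C * ν φ)) (n : ℕ) (φ : E) :
    ‖(A ^ n) φ‖ ≤ t ^ n * ((M / θ) ^ m * θ ^ n * ‖φ‖ + C / (1 - θ ^ m) * ν φ) := by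
  have hθm : θ ^ m < 1 := pow_lt_one₀ hθ.le hθ1 (by omega)
  have hD : 0 ≤ C / (1 - θ ^ m) := div_nonneg hC (by linarith)
  have hνn : ∀ n φ, ν ((A ^ n) φ) ≤ t ^ n * ν φ := by
    intro n φ
    induction n with
    | zero => simp
    | succ n ih =>
      rw [pow_succ', mul_apply_eq_comp, pow_succ']
      calc _ ≤ t * ν ((A ^ n) φ) := hν _
        _ ≤ t * (t ^ n * ν φ) := by gcongr
        _ = _ := by ring
  have hMn : ∀ n φ, ‖(A ^ n) φ‖ ≤ t ^ n * M ^ n * ‖φ‖ := by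
    intro n φ
    induction n with
    | zero => simp
    | succ n ih =>
      rw [pow_succ', mul_apply_eq_comp]
      calc _ ≤ t * M * ‖(A ^ n) φ‖ := h1 _
        _ ≤ t * M * (t ^ n * M ^ n * ‖φ‖) := by gcongr
        _ = _ := by ring
  induction n using Nat.strong_induction_on generalizing φ with
  | _ n ih =>
  have hν0 := apply_nonneg ν φ
  -- For `n < m` only the one-step bound is available; `(M/θ)^m` is large enough to dominate
  -- `M^n/θ^n`.
  rcases lt_or_ge n m with hn | hn
  · have h2 : M ^ n ≤ (M / θ) ^ m * θ ^ n := by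
      rw [div_pow, div_mul_eq_mul_div, le_div_iff₀ (by positivity)]
      exact mul_le_mul (pow_le_pow_right₀ hM hn.le) (pow_le_pow_of_le_one hθ.le hθ1.le hn.le)
        (by positivity) (by positivity)
    calc _ ≤ t ^ n * M ^ n * ‖φ‖ := hMn n φ
      _ = t ^ n * (M ^ n * ‖φ‖ + 0) := by ring
      _ ≤ _ := by gcongr; positivity
  · obtain ⟨k, rfl⟩ := Nat.exists_eq_add_of_le hn
    rw [pow_add, mul_apply_eq_comp]
    have hk := ih k (by omega) φ
    have hνk := hνn k φ
    -- The weak constant is the fixed point of `c ↦ θ^m c + C`, so it reproduces itself in each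
    -- block.
    have hDe : θ ^ m * (C / (1 - θ ^ m)) + C = C / (1 - θ ^ m) := by
      have : 1 - θ ^ m ≠ 0 := by linarith
      field_simp
      ring
    calc _ ≤ t ^ m * (θ ^ m * ‖(A ^ k) φ‖ + C * ν ((A ^ k) φ)) := h _
      _ ≤ t ^ m * (θ ^ m * (t ^ k * ((M / θ) ^ m * θ ^ k * ‖φ‖ + C / (1 - θ ^ m) * ν φ)) +
          C * (t ^ k * ν φ)) := by gcongr
      _ = t ^ m * t ^ k * ((M / θ) ^ m * (θ ^ m * θ ^ k) * ‖φ‖ +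
          (θ ^ m * (C / (1 - θ ^ m)) + C) * ν φ) := by ring
      _ = _ := by rw [hDe, pow_add, pow_add]

theorem UniformLY.weak_pow {ν : Seminorm ℂ E} {C θ : ℝ} {A : E →L[ℂ] E} (hA : UniformLY ν C θ A)
    (n : ℕ) (φ : E) : ν ((A ^ n) φ) ≤ ν φ := by
  induction n with
  | zero => simp
  | succ n ih =>
    rw [pow_succ', mul_apply_eq_comp]
    exact (hA.weak _).trans ih

theorem UniformLY.norm_pow_le {ν : Seminorm ℂ E} (hν : ∀ φ, ν φ ≤ ‖φ‖) {C θ : ℝ} {A : E →L[ℂ] E}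
    (hC : 0 ≤ C) (hθ : 0 ≤ θ) (hθ1 : θ ≤ 1) (hA : UniformLY ν C θ A)
    (n : ℕ) (φ : E) : ‖(A ^ n) φ‖ ≤ 2 * C * ‖φ‖ := by
  calc _ ≤ C * θ ^ n * ‖φ‖ + C * ν φ := hA.strong n φ
    _ ≤ C * 1 * ‖φ‖ + C * ‖φ‖ := by
      gcongr
      · exact pow_le_one₀ hθ hθ1
      · exact hν φ
    _ = _ := by ring

theorem resolvent_apply_smul_sub {A : E →L[ℂ] E} {z : ℂ} (hz : z ∈ resolventSet ℂ A) (φ : E) :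
    resolvent A z (z • φ - A φ) = φ := by
  have h : resolvent A z * (algebraMap ℂ (E →L[ℂ] E) z - A) = 1 := Ring.inverse_mul_cancel _ hz
  have := congrArg (fun B : E →L[ℂ] E => B φ) h
  simpa [Algebra.algebraMap_eq_smul_one] using this

theorem smul_sub_resolvent_apply {A : E →L[ℂ] E} {z : ℂ} (hz : z ∈ resolventSet ℂ A) (φ : E) :
    z • resolvent A z φ - A (resolvent A z φ) = φ := by
  have h : (algebraMap ℂ (E →L[ℂ] E) z - A) * resolvent A z = 1 := Ring.mul_inverse_cancel _ hz
  have := congrArg (fun B : E →L[ℂ] E => B φ) h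
  simpa [Algebra.algebraMap_eq_smul_one] using this

/-- Finite geometric expansion of the solution of `z φ - A φ = ψ`. -/
theorem geometric_expansion {A : E →L[ℂ] E} {z : ℂ} (hz : z ≠ 0) {φ ψ : E}
    (h : z • φ - A φ = ψ) (n : ℕ) :
    φ = ∑ j ∈ Finset.range n, (z⁻¹ ^ (j + 1)) • (A ^ j) ψ + z⁻¹ ^ n • (A ^ n) φ := by
  induction n with
  | zero => simp
  | succ n ih =>
    have h1 : (A ^ n) φ = z⁻¹ • (A ^ n) ψ + z⁻¹ • (A ^ (n + 1)) φ := by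
      rw [← h, map_sub, map_smul, smul_sub, smul_smul, inv_mul_cancel₀ hz, one_smul, pow_succ,
        mul_apply_eq_comp]
      abel
    rw [Finset.sum_range_succ]
    conv_lhs => rw [ih]
    rw [h1, smul_add, smul_smul, smul_smul, ← pow_succ]
    abel

theorem sum_inv_pow_le {ρ : ℝ} (hρ : 0 < ρ) (hρ1 : ρ < 1) (N : ℕ) :
    ∑ j ∈ Finset.range N, ρ⁻¹ ^ (j + 1) ≤ ρ⁻¹ ^ N * (1 / (1 - ρ)) := by
  induction N with
  | zero => simp; linarith
  | succ n ih =>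
    rw [Finset.sum_range_succ]
    have h : 1 - ρ ≠ 0 := by linarith
    calc _ ≤ ρ⁻¹ ^ n * (1 / (1 - ρ)) + ρ⁻¹ ^ (n + 1) := by gcongr
      _ = _ := by rw [pow_succ]; field_simp; ring

/-- The resolvent in the weak norm. -/
theorem weak_resolvent_le {ν : Seminorm ℂ E} (hν : ∀ φ, ν φ ≤ ‖φ‖) {C θ ρ M : ℝ} {A : E →L[ℂ] E}
    (hA : UniformLY ν C θ A) (hθ : 0 ≤ θ) (hρ : 0 < ρ) (hρ1 : ρ < 1)
    {z : ℂ} (hρz : ρ ≤ ‖z‖) (hz : z ∈ resolventSet ℂ A) (hM0 : 0 ≤ M)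
    (hM : ∀ φ, ‖resolvent A z φ‖ ≤ M * ‖φ‖) (N : ℕ) (ψ : E) :
    ν (resolvent A z ψ) ≤ (1 / (1 - ρ) + M * C) * (ρ⁻¹ ^ N * (θ ^ N * ‖ψ‖ + ν ψ)) := by
  have hz0 : z ≠ 0 := by rintro rfl; simp at hρz; linarith
  have hi : ‖z⁻¹‖ ≤ ρ⁻¹ := by rw [norm_inv]; gcongr
  have hcomm : (A ^ N) (resolvent A z ψ) = resolvent A z ((A ^ N) ψ) := by
    rw [← resolvent_apply_smul_sub hz ((A ^ N) (resolvent A z ψ))]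
    congr 1
    rw [← map_smul, ← mul_apply_eq_comp A, ← pow_succ', pow_succ,
      mul_apply_eq_comp, ← map_sub, smul_sub_resolvent_apply hz]
  rw [geometric_expansion hz0 (smul_sub_resolvent_apply hz ψ) N, hcomm]
  have h1 : ν (∑ j ∈ Finset.range N, (z⁻¹ ^ (j + 1)) • (A ^ j) ψ) ≤
      ρ⁻¹ ^ N * (1 / (1 - ρ)) * ν ψ := by
    calc _ ≤ ∑ j ∈ Finset.range N, ν ((z⁻¹ ^ (j + 1)) • (A ^ j) ψ) := by
          refine Finset.le_sum_of_subadditive ν (map_zero ν).le (map_add_le_add ν) _ _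
      _ ≤ ∑ j ∈ Finset.range N, ρ⁻¹ ^ (j + 1) * ν ψ := by
          refine Finset.sum_le_sum fun j _ => ?_
          rw [map_smul_eq_mul, norm_pow]
          gcongr
          exact hA.weak_pow j ψ
      _ ≤ _ := by
          rw [← Finset.sum_mul]
          gcongr
          exact sum_inv_pow_le hρ hρ1 N
  have h2 : ν (z⁻¹ ^ N • resolvent A z ((A ^ N) ψ)) ≤
      ρ⁻¹ ^ N * (M * (C * θ ^ N * ‖ψ‖ + C * ν ψ)) := by
    rw [map_smul_eq_mul, norm_pow]
    gcongr
    refine (hν _).trans ((hM _).trans ?_)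
    gcongr
    exact hA.strong N ψ
  have hν0 := apply_nonneg ν ψ
  have h3 : 0 ≤ 1 / (1 - ρ) := by
    have : 0 < 1 - ρ := by linarith
    positivity
  calc _ ≤ ρ⁻¹ ^ N * (1 / (1 - ρ)) * ν ψ + ρ⁻¹ ^ N * (M * (C * θ ^ N * ‖ψ‖ + C * ν ψ)) :=
        (map_add_le_add ν _ _).trans (add_le_add h1 h2)
    _ ≤ ρ⁻¹ ^ N * (1 / (1 - ρ)) * (θ ^ N * ‖ψ‖ + ν ψ) +
          ρ⁻¹ ^ N * (M * (C * θ ^ N * ‖ψ‖ + C * ν ψ)) := by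
        gcongr
        have : 0 ≤ θ ^ N * ‖ψ‖ := by positivity
        linarith
    _ = _ := by ring

/-- Stability of the resolvent under perturbations that are small from the strong to the weak
norm. -/
theorem exists_uniform_lower_bound {ν : Seminorm ℂ E} (hν : ∀ φ, ν φ ≤ ‖φ‖) {C θ ρ M : ℝ}
    (hC : 1 ≤ C) (hθ : 0 < θ) (hρ : 0 < ρ) (hρ1 : ρ < 1) (hθρ : θ < ρ) (hM0 : 0 ≤ M) :
    ∃ η > 0, ∃ K > 0, ∀ A₀ A : E →L[ℂ] E, UniformLY ν C θ A₀ → UniformLY ν C θ A →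
      (∀ φ, ν (A φ - A₀ φ) ≤ η * ‖φ‖) → ∀ z ∈ resolventSet ℂ A₀, ρ ≤ ‖z‖ →
      (∀ φ, ‖resolvent A₀ z φ‖ ≤ M * ‖φ‖) → ∀ φ, ‖φ‖ ≤ K * ‖z • φ - A φ‖ := by
  have hq : Filter.Tendsto (fun n : ℕ => (θ / ρ) ^ n) Filter.atTop (𝓝 0) :=
    tendsto_pow_atTop_nhds_zero_of_lt_one (by positivity) ((div_lt_one hρ).2 hθρ)
  -- Three multiples of `‖φ‖` have to be absorbed on the left, each made at most a quarter: first
  -- `n` controls the strong part of the expansion, then `N` the strong part of the weak resolvent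
  -- bound, and finally `η = 1/(4Q)` the perturbation. This leaves `‖φ‖/4`, hence the factor `4` in
  -- the constant.
  obtain ⟨n, hn⟩ : ∃ n : ℕ, C * (θ / ρ) ^ n < 1 / 4 := by
    have := hq.const_mul C
    rw [mul_zero] at this
    exact (this.eventually_lt_const (by norm_num)).exists
  have h1ρ : 0 < 1 - ρ := by linarith
  set D := 1 / (1 - ρ) + M * C with hD
  have hD0 : 0 < D := by positivity
  obtain ⟨N, hN⟩ : ∃ N : ℕ, (ρ⁻¹ ^ n * C * D * (4 * C)) * (θ / ρ) ^ N < 1 / 4 := by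
    have := hq.const_mul (ρ⁻¹ ^ n * C * D * (4 * C))
    rw [mul_zero] at this
    exact (this.eventually_lt_const (by norm_num)).exists
  set Q := ρ⁻¹ ^ n * C * D * ρ⁻¹ ^ N with hQ
  have hQ0 : 0 < Q := by positivity
  refine ⟨1 / (4 * Q), by positivity,
    4 * ((∑ j ∈ Finset.range n, ρ⁻¹ ^ (j + 1)) * (2 * C) + ρ⁻¹ ^ n * C * M) + 1, by positivity, ?_⟩
  intro A₀ A hA₀ hA hη z hz hρz hM φ
  set ψ := z • φ - A φ with hψ
  have hz0 : z ≠ 0 := by rintro rfl; simp at hρz; linarith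
  have hi : ‖z⁻¹‖ ≤ ρ⁻¹ := by rw [norm_inv]; gcongr
  have hθ1 : θ ≤ 1 := by linarith
  have hb := hA.norm_pow_le hν (by linarith) hθ.le hθ1
  have hb₀ := hA₀.norm_pow_le hν (by linarith) hθ.le hθ1
  have hν0 := apply_nonneg ν φ
  -- strong part
  have hs : ‖φ‖ ≤ (∑ j ∈ Finset.range n, ρ⁻¹ ^ (j + 1)) * (2 * C) * ‖ψ‖ +
      ρ⁻¹ ^ n * (C * θ ^ n * ‖φ‖ + C * ν φ) := by
    calc ‖φ‖ = ‖∑ j ∈ Finset.range n, (z⁻¹ ^ (j + 1)) • (A ^ j) ψ + z⁻¹ ^ n • (A ^ n) φ‖ := by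
          rw [← geometric_expansion hz0 hψ.symm n]
      _ ≤ ∑ j ∈ Finset.range n, ‖(z⁻¹ ^ (j + 1)) • (A ^ j) ψ‖ + ‖z⁻¹ ^ n • (A ^ n) φ‖ :=
          (norm_add_le _ _).trans (add_le_add_left (norm_sum_le _ _) _)
      _ ≤ ∑ j ∈ Finset.range n, ρ⁻¹ ^ (j + 1) * (2 * C * ‖ψ‖) +
          ρ⁻¹ ^ n * (C * θ ^ n * ‖φ‖ + C * ν φ) := by
          gcongr with j _
          · rw [norm_smul, norm_pow]
            gcongr
            exact hb j ψ
          · rw [norm_smul, norm_pow]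
            gcongr
            exact hA.strong n φ
      _ = _ := by rw [← Finset.sum_mul]; ring
  -- weak part
  have hw : ν φ ≤ M * ‖ψ‖ + D * (ρ⁻¹ ^ N * (θ ^ N * (4 * C * ‖φ‖) + 1 / (4 * Q) * ‖φ‖)) := by
    -- Second resolvent identity, written without assuming that `z - A` is invertible.
    have e : φ = resolvent A₀ z ψ + resolvent A₀ z (A φ - A₀ φ) := by
      rw [← map_add, hψ, sub_add_sub_cancel, resolvent_apply_smul_sub hz]
    calc ν φ = ν (resolvent A₀ z ψ + resolvent A₀ z (A φ - A₀ φ)) := by rw [← e]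
      _ ≤ ν (resolvent A₀ z ψ) + ν (resolvent A₀ z (A φ - A₀ φ)) := map_add_le_add ν _ _
      _ ≤ M * ‖ψ‖ + D * (ρ⁻¹ ^ N * (θ ^ N * ‖A φ - A₀ φ‖ + ν (A φ - A₀ φ))) :=
          add_le_add ((hν _).trans (hM _))
            (weak_resolvent_le hν hA₀ hθ.le hρ hρ1 hρz hz hM0 hM N _)
      _ ≤ _ := by
          gcongr
          · refine (norm_sub_le _ _).trans ?_
            have h1 := hb 1 φ
            have h2 := hb₀ 1 φ
            rw [pow_one] at h1 h2
            linarith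
          · exact hη φ
  set S := ∑ j ∈ Finset.range n, ρ⁻¹ ^ (j + 1)
  have e1 : ρ⁻¹ ^ n * (C * θ ^ n * ‖φ‖) = (C * (θ / ρ) ^ n) * ‖φ‖ := by
    rw [div_eq_mul_inv, mul_pow]; ring
  have e2 : ρ⁻¹ ^ n * (C * (D * (ρ⁻¹ ^ N * (θ ^ N * (4 * C * ‖φ‖))))) =
      (ρ⁻¹ ^ n * C * D * (4 * C)) * (θ / ρ) ^ N * ‖φ‖ := by
    rw [div_eq_mul_inv, mul_pow]; ring
  have e3 : ρ⁻¹ ^ n * (C * (D * (ρ⁻¹ ^ N * (1 / (4 * Q) * ‖φ‖)))) = 1 / 4 * ‖φ‖ := by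
    have : ρ⁻¹ ^ n * (C * (D * (ρ⁻¹ ^ N * (1 / (4 * Q) * ‖φ‖)))) = (Q / (4 * Q)) * ‖φ‖ := by
      rw [hQ]; ring
    rw [this]
    congr 1
    field_simp
  have h4 : ρ⁻¹ ^ n * (C * ν φ) ≤ ρ⁻¹ ^ n * (C * (M * ‖ψ‖ +
      D * (ρ⁻¹ ^ N * (θ ^ N * (4 * C * ‖φ‖) + 1 / (4 * Q) * ‖φ‖)))) := by gcongr
  have h5 : (C * (θ / ρ) ^ n) * ‖φ‖ ≤ 1 / 4 * ‖φ‖ := by gcongr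
  have h6 : (ρ⁻¹ ^ n * C * D * (4 * C)) * (θ / ρ) ^ N * ‖φ‖ ≤ 1 / 4 * ‖φ‖ := by gcongr
  have h7 : 0 ≤ ‖ψ‖ := norm_nonneg _
  have h8 : ρ⁻¹ ^ n * (C * (M * ‖ψ‖ +
      D * (ρ⁻¹ ^ N * (θ ^ N * (4 * C * ‖φ‖) + 1 / (4 * Q) * ‖φ‖)))) =
      ρ⁻¹ ^ n * C * M * ‖ψ‖ + ρ⁻¹ ^ n * (C * (D * (ρ⁻¹ ^ N * (θ ^ N * (4 * C * ‖φ‖))))) +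
      ρ⁻¹ ^ n * (C * (D * (ρ⁻¹ ^ N * (1 / (4 * Q) * ‖φ‖)))) := by ring
  rw [mul_add (ρ⁻¹ ^ n), e1] at hs
  rw [h8, e2, e3] at h4
  nlinarith

/-- If `z` is in the spectrum then `z^n` is in that of `A^n`, so `|z|^n` is bounded by the uniformly
bounded norms of the powers. -/
theorem mem_resolventSet_of_one_lt [CompleteSpace E] {A : E →L[ℂ] E} {C : ℝ}
    (hA : ∀ n φ, ‖(A ^ n) φ‖ ≤ C * ‖φ‖) {z : ℂ} (hz : 1 < ‖z‖) : z ∈ resolventSet ℂ A := by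
  by_contra hcon
  have hs : z ∈ spectrum ℂ A := hcon
  have h : ∀ n : ℕ, ‖z‖ ^ n ≤ max C 0 * ‖(1 : E →L[ℂ] E)‖ := by
    intro n
    have h1 := spectrum.norm_le_norm_mul_of_mem (spectrum.pow_mem_pow A n hs)
    rw [norm_pow] at h1
    refine h1.trans ?_
    gcongr
    refine ContinuousLinearMap.opNorm_le_bound _ (le_max_right _ _) fun φ => ?_
    exact (hA n φ).trans (by gcongr; exact le_max_left _ _)
  obtain ⟨n, hn⟩ := pow_unbounded_of_one_lt (max C 0 * ‖(1 : E →L[ℂ] E)‖) hz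
  exact absurd (h n) (not_le.2 hn)

theorem norm_resolvent_apply_le {A : E →L[ℂ] E} {z : ℂ} {K : ℝ} (hz : z ∈ resolventSet ℂ A)
    (h : ∀ φ, ‖φ‖ ≤ K * ‖z • φ - A φ‖) (φ : E) : ‖resolvent A z φ‖ ≤ K * ‖φ‖ := by
  have := h (resolvent A z φ)
  rwa [smul_sub_resolvent_apply hz] at this

/-- A lower bound for `z - A` yields injectivity only; surjectivity comes from connectedness. The
circle meets the resolvent set at `1 + δ`, outside the unit disc. The resolvent set is open, and by
the lower bound and a Neumann series its trace on the circle is also closed. -/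
theorem sphere_subset_resolventSet [CompleteSpace E] {A : E →L[ℂ] E} {C δ K : ℝ} (hδ : 0 < δ)
    (hK : 0 < K) (hA : ∀ n φ, ‖(A ^ n) φ‖ ≤ C * ‖φ‖)
    (h : ∀ z ∈ Metric.sphere (1 : ℂ) δ, ∀ φ, ‖φ‖ ≤ K * ‖z • φ - A φ‖) :
    Metric.sphere (1 : ℂ) δ ⊆ resolventSet ℂ A := by
  have hpre : IsPreconnected (Metric.sphere (1 : ℂ) δ) := isPreconnected_sphere (by simp) _ _
  refine hpre.subset_of_closure_inter_subset (spectrum.isOpen_resolventSet A) ?_ ?_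
  · refine ⟨1 + δ, by simp [hδ.le], mem_resolventSet_of_one_lt hA ?_⟩
    have : (1 + δ : ℂ) = ((1 + δ : ℝ) : ℂ) := by push_cast; rfl
    rw [this, Complex.norm_real, Real.norm_of_nonneg (by linarith)]
    linarith
  · rintro z ⟨hz, hzs⟩
    obtain ⟨w, hw, hwz⟩ := Metric.mem_closure_iff.1 hz (1 / (4 * K)) (by positivity)
    have hzw : ‖w - z‖ < 1 / (4 * K) := by rwa [dist_comm, dist_eq_norm] at hwz
    have hlow : ∀ φ, ‖φ‖ ≤ 2 * K * ‖w • φ - A φ‖ := by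
      intro φ
      have h1 := h z hzs φ
      have h2 : ‖z • φ - A φ‖ ≤ ‖w • φ - A φ‖ + ‖w - z‖ * ‖φ‖ := by
        rw [← norm_smul]
        refine (norm_sub_le _ _).trans' (le_of_eq ?_)
        congr 1
        rw [sub_smul]; abel
      have h3 : K * (‖w - z‖ * ‖φ‖) ≤ 1 / 4 * ‖φ‖ := by
        calc K * (‖w - z‖ * ‖φ‖) ≤ K * (1 / (4 * K) * ‖φ‖) := by gcongr
          _ = _ := by field_simp
      have h4 : K * ‖z • φ - A φ‖ ≤ K * (‖w • φ - A φ‖ + ‖w - z‖ * ‖φ‖) := by gcongr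
      rw [mul_add] at h4
      have := norm_nonneg φ
      linarith
    have hRw : ‖resolvent A w‖ ≤ 2 * K := by
      refine ContinuousLinearMap.opNorm_le_bound _ (by positivity) fun φ => ?_
      exact norm_resolvent_apply_le hw hlow φ
    -- `z - A = (w - A) (1 - (w - z) R(w))`
    have hu : IsUnit (1 - (w - z) • resolvent A w) := by
      refine isUnit_one_sub_of_norm_lt_one ?_
      rw [norm_smul]
      calc ‖w - z‖ * ‖resolvent A w‖ ≤ 1 / (4 * K) * (2 * K) := by gcongr
        _ < 1 := by field_simp; norm_num
    have hprod : algebraMap ℂ (E →L[ℂ] E) z - A =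
        (algebraMap ℂ (E →L[ℂ] E) w - A) * (1 - (w - z) • resolvent A w) := by
      have h1 : (algebraMap ℂ (E →L[ℂ] E) w - A) * resolvent A w = 1 := Ring.mul_inverse_cancel _ hw
      rw [mul_sub, mul_one, mul_smul_comm, h1, ← Algebra.algebraMap_eq_smul_one, map_sub]
      abel
    rw [spectrum.mem_resolventSet_iff, hprod]
    exact IsUnit.mul hw hu

end WeakStrong

/-! ### Small perturbations of finite-rank operators have isolated spectrum near `1`. -/

section FiniteRank

variable {E : Type*} [NormedAddCommGroup E] [NormedSpace ℂ E]

/-- Inverting `1 - K` for a finite-rank `K` reduces to inverting the matrix `m = 1 - (ℓ p (e q))`: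
the inverse is `1 + U`, where `U` has the coefficients of `m⁻¹` with respect to the same vectors and
functionals. -/
theorem isUnit_one_sub_sum_smulRight {ι : Type*} [Fintype ι] [DecidableEq ι] (ℓ : ι → E →L[ℂ] ℂ)
    (e : ι → E) (hdet : (1 - Matrix.of fun p q => ℓ p (e q)).det ≠ 0) :
    IsUnit (1 - ∑ q, (ℓ q).smulRight (e q)) := by
  set m : Matrix ι ι ℂ := 1 - Matrix.of fun p q => ℓ p (e q) with hm
  have hu : IsUnit m.det := isUnit_iff_ne_zero.2 hdet
  let N := m⁻¹
  have hNm : ∀ p q, ∑ r, N p r * ℓ r (e q) = N p q - (1 : Matrix ι ι ℂ) p q := by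
    intro p q
    have h := congrFun (congrFun (Matrix.nonsing_inv_mul m hu) p) q
    rw [hm, mul_sub, mul_one, Matrix.sub_apply, Matrix.mul_apply] at h
    simp only [Matrix.of_apply] at h
    rw [← h]
    simp [N, hm]
  have hmN : ∀ p q, ∑ r, ℓ p (e r) * N r q = N p q - (1 : Matrix ι ι ℂ) p q := by
    intro p q
    have h := congrFun (congrFun (Matrix.mul_nonsing_inv m hu) p) q
    rw [hm, sub_mul, one_mul, Matrix.sub_apply, Matrix.mul_apply] at h
    simp only [Matrix.of_apply] at h
    rw [← h]
    simp [N, hm]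
  let U := ∑ p, ∑ q, N p q • (ℓ q).smulRight (e p)
  let K := ∑ q, (ℓ q).smulRight (e q)
  have hK : ∀ φ, K φ = ∑ q, ℓ q φ • e q := fun φ => by simp [K]
  have hU : ∀ φ, U φ = ∑ p, (∑ q, N p q * ℓ q φ) • e p := fun φ => by
    simp [U, Finset.sum_smul, mul_smul]
  have hKU : K * U = U - K := by
    ext φ
    rw [mul_apply_eq_comp, sub_apply, hK, hU φ, hK φ, ← Finset.sum_sub_distrib]
    refine Finset.sum_congr rfl fun p _ => ?_
    rw [← sub_smul]
    congr 1
    rw [map_sum]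
    simp only [map_smul, smul_eq_mul]
    calc ∑ r, (∑ q, N r q * ℓ q φ) * ℓ p (e r) = ∑ q, (∑ r, ℓ p (e r) * N r q) * ℓ q φ := by
          simp only [Finset.sum_mul]
          rw [Finset.sum_comm]
          refine Finset.sum_congr rfl fun _ _ => Finset.sum_congr rfl fun _ _ => by ring
      _ = ∑ q, (N p q * ℓ q φ - (1 : Matrix ι ι ℂ) p q * ℓ q φ) := by
          refine Finset.sum_congr rfl fun q _ => by rw [hmN]; ring
      _ = _ := by rw [Finset.sum_sub_distrib]; simp [Matrix.one_apply]
  have hUK : U * K = U - K := by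
    ext φ
    rw [mul_apply_eq_comp, sub_apply, hU, hU φ, hK φ, ← Finset.sum_sub_distrib]
    refine Finset.sum_congr rfl fun p _ => ?_
    rw [← sub_smul]
    congr 1
    simp only [map_sum, map_smul, smul_eq_mul, Finset.mul_sum]
    calc ∑ r, ∑ q, N p r * (ℓ q φ * ℓ r (e q)) = ∑ q, (∑ r, N p r * ℓ r (e q)) * ℓ q φ := by
          simp only [Finset.sum_mul]
          rw [Finset.sum_comm]
          refine Finset.sum_congr rfl fun _ _ => Finset.sum_congr rfl fun _ _ => by ring
      _ = ∑ q, (N p q * ℓ q φ - (1 : Matrix ι ι ℂ) p q * ℓ q φ) := by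
          refine Finset.sum_congr rfl fun q _ => by rw [hNm]; ring
      _ = _ := by rw [Finset.sum_sub_distrib]; simp [Matrix.one_apply]
  refine ⟨⟨1 - K, 1 + U, ?_, ?_⟩, rfl⟩
  · rw [sub_mul, one_mul, mul_add, mul_one, hKU]; abel
  · rw [add_mul, one_mul, mul_sub, mul_one, hUK]; abel

/-- If a power of `A` is a small perturbation of an operator of finite rank, then `1` is not an
accumulation point of the spectrum of `A`. -/
theorem eventually_mem_resolventSet_of_finite_rank [CompleteSpace E] {ι : Type*} [Fintype ι]
    (A : E →L[ℂ] E) {n : ℕ}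
    (hn : 1 ≤ n) (ℓ : ι → E →L[ℂ] ℂ) (e : ι → E)
    (hS : ‖A ^ n - ∑ q, (ℓ q).smulRight (e q)‖ ≤ 1 / 2) :
    ∀ᶠ z in 𝓝[≠] (1 : ℂ), z ∈ resolventSet ℂ A := by
  classical
  set S := A ^ n - ∑ q, (ℓ q).smulRight (e q) with hSdef
  -- A connected region containing `1`, reaching infinity and disjoint from the spectrum of `S`, as
  -- `‖S‖ ≤ 1/2`. On it the determinant is analytic and not identically zero, so its zeros cannot
  -- accumulate at `1`.
  let U : Set ℂ := {w | 1 / 2 < w.re}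
  have hUo : IsOpen U := isOpen_lt continuous_const Complex.continuous_re
  have hUc : IsPreconnected U := (convex_halfSpace_re_gt (1 / 2)).isPreconnected
  have hUr : ∀ w ∈ U, w ∈ resolventSet ℂ S := by
    intro w hw
    rcases subsingleton_or_nontrivial E with hE | hE
    · rw [spectrum.mem_resolventSet_iff]
      have : Subsingleton (E →L[ℂ] E) := ⟨fun f g => by ext x; exact Subsingleton.elim _ _⟩
      exact isUnit_of_subsingleton _
    · refine spectrum.mem_resolventSet_of_norm_lt ?_
      have h1 : (1 / 2 : ℝ) < w.re := hw
      have := Complex.re_le_norm w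
      linarith
  let m : ℂ → Matrix ι ι ℂ := fun w => 1 - Matrix.of fun p q => ℓ p (resolvent S w (e q))
  have hentry : ∀ p q, DifferentiableOn ℂ (fun w => ℓ p (resolvent S w (e q))) U := by
    intro p q w hw
    have h1 := (spectrum.hasDerivAt_resolvent_const_left (hUr w hw)).differentiableAt
    have h2 : DifferentiableAt ℂ (fun w => resolvent S w (e q)) w :=
      h1.clm_apply (differentiableAt_const _)
    exact ((ℓ p).differentiableAt.comp w h2).differentiableWithinAt
  have hdiff : DifferentiableOn ℂ (fun w => (m w).det) U := by
    simp only [Matrix.det_apply]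
    refine DifferentiableOn.fun_sum fun σ _ => DifferentiableOn.const_smul ?_ _
    refine DifferentiableOn.fun_finsetProd fun i _ => ?_
    simp only [m, Matrix.sub_apply, Matrix.of_apply]
    exact (differentiableOn_const _).sub (hentry _ _)
  have han : AnalyticOnNhd ℂ (fun w => (m w).det) U := hdiff.analyticOnNhd hUo
  -- the determinant tends to `1` at infinity
  have hlarge : ∃ w ∈ U, (m w).det ≠ 0 := by
    have ht : Filter.Tendsto (fun r : ℝ => (m (r : ℂ)).det) Filter.atTop (𝓝 1) := by
      have h0 : Filter.Tendsto (fun r : ℝ => resolvent S (r : ℂ)) Filter.atTop (𝓝 0) :=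
        (spectrum.resolvent_tendsto_cobounded S).comp
          (RCLike.tendsto_ofReal_atTop_cobounded ℂ)
      have h1 : Filter.Tendsto (fun r : ℝ => m (r : ℂ)) Filter.atTop (𝓝 1) := by
        refine tendsto_pi_nhds.2 fun p => tendsto_pi_nhds.2 fun q => ?_
        have h2 : Filter.Tendsto (fun r : ℝ => ℓ p (resolvent S (r : ℂ) (e q))) Filter.atTop
            (𝓝 (ℓ p ((0 : E →L[ℂ] E) (e q)))) :=
          ((ℓ p).continuous.tendsto _).comp
            (((ContinuousLinearMap.apply ℂ E (e q)).continuous.tendsto _).comp h0)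
        have h3 := h2.const_sub ((1 : Matrix ι ι ℂ) p q)
        simpa [m] using h3
      have h2 := ((continuous_id.matrix_det (A := fun M : Matrix ι ι ℂ => M)).tendsto 1).comp h1
      simpa [Function.comp_def] using h2
    obtain ⟨r, hr1, hr2⟩ := ((ht.eventually_ne one_ne_zero).and
      (Filter.eventually_gt_atTop (1 / 2 : ℝ))).exists
    exact ⟨(r : ℂ), by simpa [U] using hr2, hr1⟩
  have hres : ∀ w ∈ U, (m w).det ≠ 0 → w ∈ resolventSet ℂ (A ^ n) := by
    intro w hw hd
    have h1 := isUnit_one_sub_sum_smulRight ℓ (fun q => resolvent S w (e q)) hd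
    -- Factoring out `w - S` leaves the identity minus a finite-rank operator, whose invertibility
    -- the determinant decides.
    have h2 : algebraMap ℂ (E →L[ℂ] E) w - A ^ n = (algebraMap ℂ (E →L[ℂ] E) w - S) *
        (1 - ∑ q, (ℓ q).smulRight (resolvent S w (e q))) := by
      have h3 : (algebraMap ℂ (E →L[ℂ] E) w - S) * ∑ q, (ℓ q).smulRight (resolvent S w (e q)) =
          ∑ q, (ℓ q).smulRight (e q) := by
        rw [Finset.mul_sum]
        refine Finset.sum_congr rfl fun q _ => ?_
        ext φ
        have := smul_sub_resolvent_apply (hUr w hw) (e q)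
        simp only [mul_apply_eq_comp, ContinuousLinearMap.smulRight_apply, map_smul]
        congr 1
      rw [mul_sub, mul_one, h3, hSdef]
      abel
    rw [spectrum.mem_resolventSet_iff, h2]
    exact IsUnit.mul (hUr w hw) h1
  have h1U : (1 : ℂ) ∈ U := by norm_num [U]
  have hev : ∀ᶠ w in 𝓝[≠] (1 : ℂ), w ∈ resolventSet ℂ (A ^ n) := by
    have h1 : ∀ᶠ w in 𝓝[≠] (1 : ℂ), (m w).det ≠ 0 := by
      by_contra hcon
      have hfr : ∃ᶠ w in 𝓝[≠] (1 : ℂ), (m w).det = 0 := by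
        simpa [Filter.not_eventually] using hcon
      obtain ⟨w, hw, hne⟩ := hlarge
      exact hne (han.eqOn_zero_of_preconnected_of_frequently_eq_zero hUc h1U hfr hw)
    filter_upwards [h1, mem_nhdsWithin_of_mem_nhds (hUo.mem_nhds h1U)] with w hw1 hw2
    exact hres w hw2 hw1
  -- Passing from `A^n` back to `A` requires `z^n ≠ 1` for `z ≠ 1` near `1`; this holds because the
  -- derivative `n` does not vanish.
  have hpow : Filter.Tendsto (fun z : ℂ => z ^ n) (𝓝[≠] 1) (𝓝[≠] 1) := by
    have hd : HasDerivAt (fun z : ℂ => z ^ n) ((n : ℂ) * 1 ^ (n - 1)) 1 := hasDerivAt_pow n 1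
    have hne : (n : ℂ) * 1 ^ (n - 1) ≠ 0 := by
      simp; omega
    have := hd.tendsto_nhdsNE hne
    simpa using this
  filter_upwards [hpow.eventually hev] with z hz
  by_contra hcon
  exact spectrum.pow_mem_pow A n (show z ∈ spectrum ℂ A from hcon) hz

end FiniteRank

/-! ### Contour integrals of resolvents and comparison of spectral projections. -/

section Contour

variable {E : Type*} [NormedAddCommGroup E] [NormedSpace ℂ E]

theorem continuousOn_resolvent [CompleteSpace E] (A : E →L[ℂ] E) :
    ContinuousOn (fun z : ℂ => resolvent A z) (resolventSet ℂ A) := fun _ hz =>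
  (spectrum.hasDerivAt_resolvent_const_left hz).continuousAt.continuousWithinAt

theorem ne_zero_of_mem_closedBall_one {δ : ℝ} (hδ : δ < 1) {z : ℂ}
    (hz : z ∈ Metric.closedBall (1 : ℂ) δ) : z ≠ 0 := by
  rintro rfl
  simp at hz
  linarith

theorem one_sub_le_norm_of_mem_sphere {δ : ℝ} {z : ℂ} (hz : z ∈ Metric.sphere (1 : ℂ) δ) :
    1 - δ ≤ ‖z‖ := by
  have h1 : ‖z - 1‖ = δ := by simpa [dist_eq_norm] using hz
  have h2 := norm_sub_norm_le (1 : ℂ) z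
  rw [norm_sub_rev, h1, norm_one] at h2
  linarith

/-- Cauchy's theorem: since `δ < 1`, the closed disc avoids the pole at `0`. -/
theorem circleIntegral_inv_pow_smul {δ : ℝ} (hδ : 0 < δ) (hδ1 : δ < 1) (n : ℕ) (φ : E) :
    ∮ z in C(1, δ), (z⁻¹ ^ n) • φ = 0 := by
  have hd : DifferentiableOn ℂ (fun z : ℂ => (z⁻¹ ^ n) • φ) (Metric.closedBall 1 δ) := by
    intro z hz
    have : z ≠ 0 := ne_zero_of_mem_closedBall_one hδ1 hz
    fun_prop (disch := assumption)
  have hd' : DiffContOnCl ℂ (fun z : ℂ => (z⁻¹ ^ n) • φ) (Metric.ball 1 δ) := by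
    refine DifferentiableOn.diffContOnCl ?_
    rwa [closure_ball _ hδ.ne']
  exact hd'.circleIntegral_eq_zero hδ.le

theorem continuousOn_inv_pow_smul {δ : ℝ} (hδ1 : δ < 1) (n : ℕ) {g : ℂ → E}
    (hg : ContinuousOn g (Metric.sphere (1 : ℂ) δ)) :
    ContinuousOn (fun z : ℂ => (z⁻¹ ^ n) • g z) (Metric.sphere (1 : ℂ) δ) := by
  refine ContinuousOn.smul (ContinuousOn.pow (ContinuousOn.inv₀ continuousOn_id ?_) n) hg
  intro z hz
  exact ne_zero_of_mem_closedBall_one hδ1 (Metric.sphere_subset_closedBall hz)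

theorem continuousOn_resolvent_apply [CompleteSpace E] {δ : ℝ} {A : E →L[ℂ] E}
    (hs : Metric.sphere (1 : ℂ) δ ⊆ resolventSet ℂ A) (φ : E) :
    ContinuousOn (fun z : ℂ => resolvent A z φ) (Metric.sphere (1 : ℂ) δ) :=
  ((continuousOn_resolvent A).mono hs).clm_apply continuousOn_const

variable [CompleteSpace E]

/-- The first `N` terms of the geometric expansion of the resolvent are multiples of powers of `z⁻¹`
and integrate to zero. The gain is a free factor `A^N`, whose smoothing is then available, at the
price of `|z|^{-N}`. -/
theorem circleIntegral_inv_smul_resolvent {δ : ℝ} (hδ : 0 < δ) (hδ1 : δ < 1) {A : E →L[ℂ] E}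
    (hs : Metric.sphere (1 : ℂ) δ ⊆ resolventSet ℂ A) (N : ℕ) (φ : E) :
    ∮ z in C(1, δ), z⁻¹ • resolvent A z φ =
      ∮ z in C(1, δ), (z⁻¹ ^ (N + 1)) • (A ^ N) (resolvent A z φ) := by
  have hexp : EqOn (fun z : ℂ => z⁻¹ • resolvent A z φ)
      (fun z => (∑ j ∈ Finset.range N, (z⁻¹ ^ (j + 2)) • (A ^ j) φ) +
        (z⁻¹ ^ (N + 1)) • (A ^ N) (resolvent A z φ)) (Metric.sphere 1 δ) := by
    intro z hz
    have hz0 := ne_zero_of_mem_closedBall_one hδ1 (Metric.sphere_subset_closedBall hz)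
    have h := geometric_expansion hz0 (smul_sub_resolvent_apply (hs hz) φ) N
    change z⁻¹ • resolvent A z φ = _
    conv_lhs => rw [h]
    rw [smul_add, Finset.smul_sum, smul_smul, ← pow_succ']
    congr 1
    refine Finset.sum_congr rfl fun j _ => ?_
    rw [smul_smul, ← pow_succ']
  have hterm : ∀ j, CircleIntegrable (fun z : ℂ => (z⁻¹ ^ (j + 2)) • (A ^ j) φ) 1 δ := fun j =>
    (continuousOn_inv_pow_smul hδ1 _ continuousOn_const).circleIntegrable hδ.le
  rw [circleIntegral.integral_congr hδ.le hexp, circleIntegral.integral_add,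
    circleIntegral.integral_fun_sum]
  · rw [Finset.sum_eq_zero fun j _ => circleIntegral_inv_pow_smul hδ hδ1 (j + 2) _, zero_add]
  · exact fun j _ => hterm j
  · exact CircleIntegrable.fun_sum _ fun j _ => hterm j
  · exact (continuousOn_inv_pow_smul hδ1 _
      ((A ^ N).continuous.comp_continuousOn (continuousOn_resolvent_apply hs φ))).circleIntegrable
      hδ.le

theorem clm_circleIntegral {F : Type*} [NormedAddCommGroup F] [NormedSpace ℂ F] [CompleteSpace F]
    (Λ : E →L[ℂ] F) {g : ℂ → E} {c : ℂ} {r : ℝ} (hg : CircleIntegrable g c r) :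
    Λ (∮ z in C(c, r), g z) = ∮ z in C(c, r), Λ (g z) := by
  simp only [circleIntegral]
  rw [← ContinuousLinearMap.intervalIntegral_comp_comm _ hg.out]
  simp

/-- One step of the same expansion. It shows that the formula used for functions outside `B` agrees
with the projection on `B`. -/
theorem circleIntegral_resolvent_apply {δ : ℝ} (hδ : 0 < δ) (hδ1 : δ < 1) {A : E →L[ℂ] E}
    (hs : Metric.sphere (1 : ℂ) δ ⊆ resolventSet ℂ A) (φ : E) :
    (∮ z in C(1, δ), resolvent A z) φ = ∮ z in C(1, δ), z⁻¹ • resolvent A z (A φ) := by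
  have hi : CircleIntegrable (fun z : ℂ => resolvent A z) 1 δ :=
    ((continuousOn_resolvent A).mono hs).circleIntegrable hδ.le
  have h1 := clm_circleIntegral (ContinuousLinearMap.apply ℂ E φ) hi
  simp only [ContinuousLinearMap.apply_apply] at h1
  have hexp : EqOn (fun z : ℂ => resolvent A z φ)
      (fun z => (z⁻¹ ^ 1) • φ + z⁻¹ • resolvent A z (A φ)) (Metric.sphere 1 δ) := by
    intro z hz
    have hz0 := ne_zero_of_mem_closedBall_one hδ1 (Metric.sphere_subset_closedBall hz)
    have h2 := resolvent_apply_smul_sub (hs hz) φ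
    rw [map_sub, map_smul, sub_eq_iff_eq_add] at h2
    change resolvent A z φ = (z⁻¹ ^ 1) • φ + z⁻¹ • resolvent A z (A φ)
    rw [pow_one, ← smul_add, ← h2, smul_smul, inv_mul_cancel₀ hz0, one_smul]
  rw [h1, circleIntegral.integral_congr hδ.le hexp, circleIntegral.integral_add,
    circleIntegral_inv_pow_smul hδ hδ1, zero_add]
  · exact (continuousOn_inv_pow_smul hδ1 _ continuousOn_const).circleIntegrable hδ.le
  · have := continuousOn_inv_pow_smul hδ1 1 (continuousOn_resolvent_apply hs (A φ))
    simp only [pow_one] at this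
    exact this.circleIntegrable hδ.le

/-- Difference of two contour integrals, tested against a functional, in terms of the `N`-th
iterates. -/
theorem norm_functional_contour_sub_le {δ B : ℝ} (hδ : 0 < δ) (hδ1 : δ < 1) {A₀ A : E →L[ℂ] E}
    (hs₀ : Metric.sphere (1 : ℂ) δ ⊆ resolventSet ℂ A₀)
    (hs : Metric.sphere (1 : ℂ) δ ⊆ resolventSet ℂ A) (Λ : E →L[ℂ] ℂ) (N : ℕ) (φ φ₀ : E)
    (hB0 : 0 ≤ B)
    (hB : ∀ z ∈ Metric.sphere (1 : ℂ) δ,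
      ‖Λ ((A ^ N) (resolvent A z φ)) - Λ ((A₀ ^ N) (resolvent A₀ z φ₀))‖ ≤ B) :
    ‖Λ ((2 * Real.pi * Complex.I : ℂ)⁻¹ • (∮ z in C(1, δ), z⁻¹ • resolvent A z φ) -
      (2 * Real.pi * Complex.I : ℂ)⁻¹ • (∮ z in C(1, δ), z⁻¹ • resolvent A₀ z φ₀))‖ ≤
      (1 - δ)⁻¹ ^ (N + 1) * B := by
  have hi : ∀ (A : E →L[ℂ] E) (_ : Metric.sphere (1 : ℂ) δ ⊆ resolventSet ℂ A) (φ : E),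
      CircleIntegrable (fun z : ℂ => (z⁻¹ ^ (N + 1)) • (A ^ N) (resolvent A z φ)) 1 δ :=
    fun A hs φ => (continuousOn_inv_pow_smul hδ1 _
      ((A ^ N).continuous.comp_continuousOn (continuousOn_resolvent_apply hs φ))).circleIntegrable
      hδ.le
  rw [circleIntegral_inv_smul_resolvent hδ hδ1 hs N, circleIntegral_inv_smul_resolvent hδ hδ1 hs₀ N,
    ← smul_sub, ← circleIntegral.integral_sub (hi A hs φ) (hi A₀ hs₀ φ₀), map_smul,
    clm_circleIntegral Λ (CircleIntegrable.fun_sub (hi A hs φ) (hi A₀ hs₀ φ₀))]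
  refine (circleIntegral.norm_two_pi_i_inv_smul_integral_le_of_norm_le_const
    (C := (1 - δ)⁻¹ ^ (N + 1) * B) hδ.le fun z hz => ?_).trans ?_
  · rw [← smul_sub, map_smul, map_sub, norm_smul, norm_pow, norm_inv]
    have h1 := one_sub_le_norm_of_mem_sphere hz
    have h2 : 0 < 1 - δ := by linarith
    gcongr
    exact hB z hz
  -- The normalised contour integral carries the radius `δ` as a factor, which is dropped because `δ
  -- < 1`.
  · have h2 : 0 < 1 - δ := by linarith
    have : 0 ≤ (1 - δ)⁻¹ ^ (N + 1) * B := by positivity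
    nlinarith

/-- The effect of a perturbation that is small from the strong to the weak norm on the spectral
projections, tested against a functional. -/
theorem norm_functional_proj_sub_le {ν : Seminorm ℂ E} (hν : ∀ φ, ν φ ≤ ‖φ‖)
    {C θ δ M K η τ b κ : ℝ} (hC : 1 ≤ C) (hθ : 0 < θ) (hδ : 0 < δ) (hδ1 : δ < 1)
    (hθρ : θ < 1 - δ) (hM0 : 0 ≤ M) (hK0 : 0 ≤ K) (hη0 : 0 ≤ η) (hτ0 : 0 ≤ τ) (hb0 : 0 ≤ b)
    (hκ0 : 0 ≤ κ)
    {A₀ A : E →L[ℂ] E} (hA₀ : UniformLY ν C θ A₀) (hA : UniformLY ν C θ A)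
    (hη : ∀ φ, ν (A φ - A₀ φ) ≤ η * ‖φ‖)
    (hs₀ : Metric.sphere (1 : ℂ) δ ⊆ resolventSet ℂ A₀)
    (hs : Metric.sphere (1 : ℂ) δ ⊆ resolventSet ℂ A)
    (hM : ∀ z ∈ Metric.sphere (1 : ℂ) δ, ∀ φ, ‖resolvent A₀ z φ‖ ≤ M * ‖φ‖)
    (hK : ∀ z ∈ Metric.sphere (1 : ℂ) δ, ∀ φ, ‖resolvent A z φ‖ ≤ K * ‖φ‖)
    {φ φ₀ : E} (hφ : ‖φ‖ ≤ b) (hφ₀ : ‖φ₀‖ ≤ b) (hφφ : ν (φ - φ₀) ≤ η * b)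
    {Λ : E →L[ℂ] ℂ} (hΛ : ∀ χ, ‖Λ χ‖ ≤ τ * ‖χ‖) {N : ℕ}
    (hκ : ∀ χ, ‖Λ ((A ^ N) χ - (A₀ ^ N) χ)‖ ≤ κ * ‖χ‖) :
    ‖Λ ((2 * Real.pi * Complex.I : ℂ)⁻¹ • (∮ z in C(1, δ), z⁻¹ • resolvent A z φ) -
      (2 * Real.pi * Complex.I : ℂ)⁻¹ • (∮ z in C(1, δ), z⁻¹ • resolvent A₀ z φ₀))‖ ≤
      (1 - δ)⁻¹ ^ (N + 1) * (κ * (K * b) + τ * (C * (M + (1 / δ + M * C)) *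
        ((4 * C * K + K + 3) * b) * ((1 - δ)⁻¹ ^ N * (θ ^ N + η)))) := by
  have h1δ : 0 < 1 - δ := by linarith
  refine norm_functional_contour_sub_le hδ hδ1 hs₀ hs Λ N φ φ₀ (by positivity) fun z hz => ?_
  set χ := resolvent A z φ with hχ
  set χ' := χ - resolvent A₀ z φ₀ with hχ'
  set ψ := (A χ - A₀ χ) + (φ - φ₀) with hψ
  have hχn : ‖χ‖ ≤ K * b := (hK z hz φ).trans (by gcongr)
  -- Both the change of operator and the change of initial function enter through the single vector
  -- `ψ`, which is weakly of size `η b`.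
  have e1 : χ' = resolvent A₀ z ψ := by
    have h1 := smul_sub_resolvent_apply (hs hz) φ
    have h2 : ψ = (z • χ - A₀ χ) - φ₀ := by rw [hψ, ← h1]; abel
    rw [hχ', h2, map_sub, resolvent_apply_smul_sub (hs₀ hz)]
  have e2 : Λ ((A ^ N) χ) - Λ ((A₀ ^ N) (resolvent A₀ z φ₀)) =
      Λ ((A ^ N) χ - (A₀ ^ N) χ) + Λ ((A₀ ^ N) χ') := by
    rw [hχ']; simp only [map_sub]; ring
  have hψn : ‖ψ‖ ≤ (4 * C * K + K + 3) * b := by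
    have hb := hA.norm_pow_le hν (by linarith) hθ.le (by linarith) 1 χ
    have hb₀ := hA₀.norm_pow_le hν (by linarith) hθ.le (by linarith) 1 χ
    rw [pow_one] at hb hb₀
    have h1 : ‖ψ‖ ≤ ‖A χ‖ + ‖A₀ χ‖ + (‖φ‖ + ‖φ₀‖) :=
      (norm_add_le _ _).trans (add_le_add (norm_sub_le _ _) (norm_sub_le _ _))
    have h2 : 2 * C * ‖χ‖ ≤ 2 * C * (K * b) := by gcongr
    nlinarith [mul_nonneg hK0 hb0]
  have hψν : ν ψ ≤ (4 * C * K + K + 3) * b * η := by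
    have h1 : ν ψ ≤ η * ‖χ‖ + η * b := (map_add_le_add ν _ _).trans (add_le_add (hη χ) hφφ)
    have h2 : η * ‖χ‖ ≤ η * (K * b) := by gcongr
    have h3 : 0 ≤ C * K * b * η := by positivity
    nlinarith [mul_nonneg hb0 hη0]
  have hw : ν χ' ≤ (1 / δ + M * C) * ((1 - δ)⁻¹ ^ N *
      ((4 * C * K + K + 3) * b * (θ ^ N + η))) := by
    rw [e1]
    have h1 := weak_resolvent_le hν hA₀ hθ.le h1δ (by linarith)
      (one_sub_le_norm_of_mem_sphere hz) (hs₀ hz) hM0 (hM z hz) N ψ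
    rw [sub_sub_cancel] at h1
    refine h1.trans ?_
    gcongr
    calc θ ^ N * ‖ψ‖ + ν ψ ≤ θ ^ N * ((4 * C * K + K + 3) * b) + (4 * C * K + K + 3) * b * η := by
          gcongr
      _ = _ := by ring
  have hst : ‖χ'‖ ≤ M * ((4 * C * K + K + 3) * b) := by
    rw [e1]
    exact (hM z hz ψ).trans (by gcongr)
  rw [e2]
  refine (norm_add_le _ _).trans (add_le_add ((hκ χ).trans (by gcongr)) ?_)
  refine (hΛ _).trans ?_
  gcongr
  have h1 : 1 ≤ (1 - δ)⁻¹ ^ N := one_le_pow₀ ((one_le_inv₀ h1δ).2 (by linarith))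
  have h2 : 0 ≤ M * ((4 * C * K + K + 3) * b) := by positivity
  -- The difference of resolvents is small only in the weak norm; the `N` iterates of `A₀` convert
  -- this into a strong bound. The weak resolvent estimate is used with the same `N`, which is why
  -- `(1 - δ)^{-N}` occurs twice in the total.
  calc ‖(A₀ ^ N) χ'‖ ≤ C * θ ^ N * ‖χ'‖ + C * ν χ' := hA₀.strong N χ'
    _ ≤ C * θ ^ N * (M * ((4 * C * K + K + 3) * b)) + C * ((1 / δ + M * C) * ((1 - δ)⁻¹ ^ N *
      ((4 * C * K + K + 3) * b * (θ ^ N + η)))) := by gcongr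
    _ ≤ C * ((1 - δ)⁻¹ ^ N * (θ ^ N + η)) * (M * ((4 * C * K + K + 3) * b)) +
        C * ((1 / δ + M * C) * ((1 - δ)⁻¹ ^ N * ((4 * C * K + K + 3) * b * (θ ^ N + η)))) := by
      gcongr
      have h3 : 0 ≤ θ ^ N + η := by positivity
      nlinarith
    _ = _ := by ring

end Contour

theorem eVariationOn_le_mul_of_edist_le {α E F : Type*} [LinearOrder α] [PseudoEMetricSpace E]
    [PseudoEMetricSpace F] {g : α → E} {h : α → F} {s : Set α} {c : ℝ≥0∞}
    (H : ∀ x ∈ s, ∀ y ∈ s, edist (g x) (g y) ≤ c * edist (h x) (h y)) :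
    eVariationOn g s ≤ c * eVariationOn h s := by
  refine iSup_le fun p => ?_
  calc _ ≤ ∑ i ∈ Finset.range p.1, c * edist (h (p.2.1 (i + 1))) (h (p.2.1 i)) :=
        Finset.sum_le_sum fun i _ => H _ (p.2.2.2 _) _ (p.2.2.2 _)
    _ ≤ _ := by
      rw [← Finset.mul_sum]
      gcongr
      exact eVariationOn.sum_le p.2.2.1 p.2.2.2

/-! ### Cylinders, their images, and bounded distortion. -/

namespace YoungBase

variable (D : YoungBase)

/-- The partition elements as subsets of the base. -/
def cell (i : ℕ) : Set D.X := {x | (x : ℝ) ∈ D.P i}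

theorem coe_fX (x : D.X) : (D.fX x : ℝ) = D.f x := rfl

theorem coe_iterate_fX (n : ℕ) (x : D.X) : (D.fX^[n] x : ℝ) = D.f^[n] x := by
  induction n generalizing x with
  | zero => rfl
  | succ n ih => rw [Function.iterate_succ_apply, Function.iterate_succ_apply, ih, coe_fX]

theorem injOn_cell (i : ℕ) : InjOn D.fX (D.cell i) := fun _ hx _ hy h =>
  Subtype.ext (D.f_injOn i hx hy (congrArg Subtype.val h))

theorem ordConnected_cell (i : ℕ) : (D.cell i).OrdConnected :=
  ⟨fun _ hx _ hy _ hz => (D.P_ordConnected i).out hx hy hz⟩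

theorem disjoint_cell {i j : ℕ} (hij : i ≠ j) : Disjoint (D.cell i) (D.cell j) :=
  Set.disjoint_left.2 fun _ hx hy => Set.disjoint_left.1 (D.P_disjoint i j hij) hx hy

theorem image_coe_cell (i : ℕ) : ((↑) : D.X → ℝ) '' D.cell i = D.P i := by
  ext x
  constructor
  · rintro ⟨y, hy, rfl⟩; exact hy
  · exact fun hx => ⟨⟨x, D.P_subset i hx⟩, hx, rfl⟩

theorem image_coe_fX (i : ℕ) : ((↑) : D.X → ℝ) '' (D.fX '' D.cell i) = D.f '' D.P i := by
  rw [← D.image_coe_cell i, image_image, image_image]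
  rfl

theorem continuousOn_f (i : ℕ) : ContinuousOn D.f (D.P i) := fun x hx =>
  (D.hasDeriv i x hx).continuousWithinAt

theorem exists_expansion : ∃ κ : ℝ, 1 < κ ∧ 1 < D.θ * κ ∧ ∀ i, ∀ x ∈ D.P i, κ ≤ |D.df x| := by
  obtain ⟨κ, h1, h2⟩ := D.expansion
  have h3 := D.θ_mem.1
  have h4 := (one_lt_inv₀ h3).2 D.θ_mem.2
  refine ⟨κ, h4.trans h1, ?_, h2⟩
  rw [inv_lt_iff_one_lt_mul₀ h3] at h1
  rwa [mul_comm] at h1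

theorem df_ne_zero {i : ℕ} {x : ℝ} (hx : x ∈ D.P i) : D.df x ≠ 0 := by
  obtain ⟨κ, h1, -, h2⟩ := D.exists_expansion
  intro h
  have := h2 i x hx
  rw [h, abs_zero] at this
  linarith

theorem exists_slope {i : ℕ} {x y : ℝ} (hx : x ∈ D.P i) (hy : y ∈ D.P i) (hxy : x < y) :
    ∃ ξ ∈ D.P i, ξ ∈ Ioo x y ∧ D.f y - D.f x = D.df ξ * (y - x) := by
  have hsub : Icc x y ⊆ D.P i := (D.P_ordConnected i).out hx hy
  obtain ⟨ξ, hξ, h⟩ := exists_hasDerivAt_eq_slope D.f D.df hxy ((D.continuousOn_f i).mono hsub)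
    fun z hz => (D.hasDeriv i z (hsub (Ioo_subset_Icc_self hz))).hasDerivAt
      (Filter.mem_of_superset (Icc_mem_nhds hz.1 hz.2) hsub)
  refine ⟨ξ, hsub (Ioo_subset_Icc_self hξ), hξ, ?_⟩
  rw [h, div_mul_cancel₀]
  linarith

/-- The derivative need not be continuous, but by Darboux it has the intermediate value property, so
a nonvanishing derivative keeps its sign on an interval. -/
theorem monotoneOn_or_antitoneOn_f (i : ℕ) :
    MonotoneOn D.f (D.P i) ∨ AntitoneOn D.f (D.P i) := by
  have hc : Convex ℝ (D.P i) := (D.P_ordConnected i).convex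
  rcases hasDerivWithinAt_forall_lt_or_forall_gt_of_forall_ne hc (D.hasDeriv i)
    (fun z hz => D.df_ne_zero hz) with h | h
  · refine Or.inr fun a ha b hb hab => ?_
    rcases hab.eq_or_lt with rfl | hab
    · rfl
    · obtain ⟨ξ, hξ, -, e⟩ := D.exists_slope ha hb hab
      have := h ξ hξ
      nlinarith
  · refine Or.inl fun a ha b hb hab => ?_
    rcases hab.eq_or_lt with rfl | hab
    · rfl
    · obtain ⟨ξ, hξ, -, e⟩ := D.exists_slope ha hb hab
      have := h ξ hξ
      nlinarith

/-- The last clause keeps `f ξ` between the images of the endpoints, so the distortion hypothesis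
compares `df ξ` with `df x` in terms of the distance of these images. -/
theorem exists_abs_slope {i : ℕ} {x y : ℝ} (hx : x ∈ D.P i) (hy : y ∈ D.P i) :
    ∃ ξ ∈ D.P i, |D.f x - D.f y| = |D.df ξ| * |x - y| ∧ |D.f ξ - D.f x| ≤ |D.f x - D.f y| := by
  rcases eq_or_ne x y with rfl | hne
  · exact ⟨x, hx, by simp, by simp⟩
  obtain ⟨ξ, hξ, hm, e⟩ : ∃ ξ ∈ D.P i, ξ ∈ uIcc x y ∧ |D.f x - D.f y| = |D.df ξ| * |x - y| := by
    rcases lt_or_gt_of_ne hne with h | h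
    · obtain ⟨ξ, hξ, hm, e⟩ := D.exists_slope hx hy h
      refine ⟨ξ, hξ, ?_, by rw [abs_sub_comm, e, abs_mul, abs_sub_comm x]⟩
      rw [uIcc_of_le h.le]; exact Ioo_subset_Icc_self hm
    · obtain ⟨ξ, hξ, hm, e⟩ := D.exists_slope hy hx h
      refine ⟨ξ, hξ, ?_, by rw [e, abs_mul]⟩
      rw [uIcc_of_ge h.le]; exact Ioo_subset_Icc_self hm
  refine ⟨ξ, hξ, e, ?_⟩
  have h1 : D.f ξ ∈ uIcc (D.f x) (D.f y) := by
    rw [mem_uIcc] at hm ⊢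
    rcases D.monotoneOn_or_antitoneOn_f i with h | h <;> rcases hm with ⟨h1, h2⟩ | ⟨h1, h2⟩
    · exact Or.inl ⟨h hx hξ h1, h hξ hy h2⟩
    · exact Or.inr ⟨h hy hξ h1, h hξ hx h2⟩
    · exact Or.inr ⟨h hξ hy h2, h hx hξ h1⟩
    · exact Or.inl ⟨h hξ hx h2, h hy hξ h1⟩
  rw [abs_sub_comm (D.f x)]
  exact abs_sub_left_of_mem_uIcc h1

/-- The cylinder of points whose first `n` iterates follow the itinerary `w`. -/
def cyl (n : ℕ) (w : Fin n → ℕ) : Set D.X := {x | ∀ j : Fin n, (D.fX^[j] x : ℝ) ∈ D.P (w j)}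

theorem cyl_succ {n : ℕ} (w : Fin (n + 1) → ℕ) :
    D.cyl (n + 1) w = D.cell (w 0) ∩ D.fX ⁻¹' D.cyl n (Fin.tail w) := by
  ext x
  simp only [cyl, mem_ofPred_eq, Fin.forall_fin_succ, cell, mem_inter_iff, mem_preimage, Fin.tail]
  rfl

/-- The absolute value of the derivative of the `n`-th iterate. -/
noncomputable def derivN (n : ℕ) (x : D.X) : ℝ := ∏ j ∈ Finset.range n, |D.df (D.fX^[j] x)|

theorem derivN_succ (n : ℕ) (x : D.X) : D.derivN (n + 1) x = |D.df x| * D.derivN n (D.fX x) := by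
  rw [derivN, Finset.prod_range_succ', mul_comm]
  rfl

theorem injOn_cyl (n : ℕ) (w : Fin n → ℕ) : InjOn D.fX^[n] (D.cyl n w) := by
  induction n with
  | zero => exact fun x _ y _ h => h
  | succ n ih =>
    rw [cyl_succ]
    exact fun x hx y hy h => D.injOn_cell _ hx.1 hy.1 (ih _ hx.2 hy.2 h)

theorem disjoint_cyl {n : ℕ} {w w' : Fin n → ℕ} (h : w ≠ w') :
    Disjoint (D.cyl n w) (D.cyl n w') := by
  obtain ⟨j, hj⟩ := Function.ne_iff.1 h
  exact Set.disjoint_left.2 fun x hx hx' =>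
    Set.disjoint_left.1 (D.P_disjoint _ _ hj) (hx j) (hx' j)

theorem monotoneOn_or_antitoneOn_fX (i : ℕ) :
    MonotoneOn D.fX (D.cell i) ∨ AntitoneOn D.fX (D.cell i) :=
  (D.monotoneOn_or_antitoneOn_f i).imp (fun h _ hx _ hy hxy => h hx hy hxy)
    (fun h _ hx _ hy hxy => h hx hy hxy)

theorem monotoneOn_or_antitoneOn_cyl (n : ℕ) (w : Fin n → ℕ) {m : ℕ} (hm : m ≤ n) :
    MonotoneOn D.fX^[m] (D.cyl n w) ∨ AntitoneOn D.fX^[m] (D.cyl n w) := by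
  induction n generalizing m with
  | zero =>
    obtain rfl : m = 0 := by omega
    exact Or.inl fun x _ y _ h => h
  | succ n ih =>
    cases m with
    | zero => exact Or.inl fun x _ y _ h => h
    | succ m =>
      rw [cyl_succ]
      have h1 := D.monotoneOn_or_antitoneOn_fX (w 0)
      have h2 := ih (Fin.tail w) (m := m) (by omega)
      rcases h1 with h1 | h1 <;> rcases h2 with h2 | h2
      · exact Or.inl fun x hx y hy h => h2 hx.2 hy.2 (h1 hx.1 hy.1 h)
      · exact Or.inr fun x hx y hy h => h2 hx.2 hy.2 (h1 hx.1 hy.1 h)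
      · exact Or.inr fun x hx y hy h => h2 hy.2 hx.2 (h1 hx.1 hy.1 h)
      · exact Or.inl fun x hx y hy h => h2 hy.2 hx.2 (h1 hx.1 hy.1 h)

theorem ordConnected_cyl (n : ℕ) (w : Fin n → ℕ) : (D.cyl n w).OrdConnected := by
  induction n with
  | zero =>
    have : D.cyl 0 w = univ := by ext x; simp [cyl]
    rw [this]
    exact ordConnected_univ
  | succ n ih =>
    rw [cyl_succ]
    refine ⟨fun x hx y hy z hz => ?_⟩
    have hzc := (D.ordConnected_cell (w 0)).out hx.1 hy.1 hz
    refine ⟨hzc, ?_⟩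
    rcases D.monotoneOn_or_antitoneOn_fX (w 0) with h | h
    · exact (ih _).out hx.2 hy.2 ⟨h hx.1 hzc hz.1, h hzc hy.1 hz.2⟩
    · exact (ih _).out hy.2 hx.2 ⟨h hzc hy.1 hz.2, h hx.1 hzc hz.1⟩

theorem ordConnected_image_cell (i : ℕ) : (D.fX '' D.cell i).OrdConnected := by
  have h1 : (D.f '' D.P i).OrdConnected :=
    ((D.P_ordConnected i).isPreconnected.image _ (D.continuousOn_f i)).ordConnected
  refine ⟨fun x hx y hy z hz => ?_⟩
  have h2 : ∀ u ∈ D.fX '' D.cell i, (u : ℝ) ∈ D.f '' D.P i := fun u hu => by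
    rw [← D.image_coe_fX i]; exact ⟨u, hu, rfl⟩
  obtain ⟨y', hy', e⟩ := h1.out (h2 x hx) (h2 y hy) ⟨hz.1, hz.2⟩
  exact ⟨⟨y', D.P_subset i hy'⟩, hy', Subtype.ext e⟩

/-- By the Markov property the image of the first cell either contains or misses the next cell, so a
nonempty cylinder is carried onto the full image of a single cell. Images of cylinders therefore
inherit connectedness and the lower bound on their length. -/
theorem image_cyl (n : ℕ) (w : Fin (n + 1) → ℕ) :
    D.fX^[n + 1] '' D.cyl (n + 1) w = ∅ ∨
      ∃ i, D.fX^[n + 1] '' D.cyl (n + 1) w = D.fX '' D.cell i := by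
  induction n with
  | zero =>
    refine Or.inr ⟨w 0, ?_⟩
    have : D.cyl 1 w = D.cell (w 0) := by
      rw [cyl_succ]; ext x; simp [cyl]
    rw [this]; rfl
  | succ n ih =>
    have h1 : D.fX^[n + 2] '' D.cyl (n + 2) w =
        D.fX^[n + 1] '' (D.fX '' (D.cell (w 0) ∩ D.fX ⁻¹' D.cyl (n + 1) (Fin.tail w))) := by
      rw [cyl_succ, image_image]; rfl
    rw [image_inter_preimage] at h1
    have hsub : D.cyl (n + 1) (Fin.tail w) ⊆ D.cell (w 1) := by
      rw [cyl_succ]; exact inter_subset_left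
    rcases D.f_markov (w 0) (w 1) with h | h
    · have : D.cyl (n + 1) (Fin.tail w) ⊆ D.fX '' D.cell (w 0) := by
        refine hsub.trans fun x hx => ?_
        obtain ⟨y, hy, e⟩ := h hx
        exact ⟨⟨y, D.P_subset _ hy⟩, hy, Subtype.ext e⟩
      rw [inter_eq_self_of_subset_right this] at h1
      rw [h1]
      exact ih _
    · left
      rw [h1, image_eq_empty, ← subset_empty_iff]
      rintro x ⟨⟨y, hy, rfl⟩, hx⟩
      exact Set.disjoint_left.1 h (hsub hx) ⟨y, hy, rfl⟩

theorem ordConnected_image_cyl (n : ℕ) (w : Fin (n + 1) → ℕ) :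
    (D.fX^[n + 1] '' D.cyl (n + 1) w).OrdConnected := by
  rcases D.image_cyl n w with h | ⟨i, h⟩
  · rw [h]; exact ordConnected_empty
  · rw [h]; exact D.ordConnected_image_cell i

theorem pow_le_derivN {κ : ℝ} (hκ : 0 ≤ κ) (h : ∀ i, ∀ x ∈ D.P i, κ ≤ |D.df x|) {n : ℕ}
    {w : Fin n → ℕ} {x : D.X} (hx : x ∈ D.cyl n w) : κ ^ n ≤ D.derivN n x := by
  induction n generalizing x with
  | zero => simp [derivN]
  | succ n ih =>
    rw [cyl_succ] at hx
    rw [derivN_succ, pow_succ']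
    exact mul_le_mul (h _ _ hx.1) (ih hx.2) (by positivity) (abs_nonneg _)

theorem derivN_pos {n : ℕ} {w : Fin n → ℕ} {x : D.X} (hx : x ∈ D.cyl n w) : 0 < D.derivN n x := by
  obtain ⟨κ, h1, -, h2⟩ := D.exists_expansion
  exact (by positivity : 0 < κ ^ n).trans_le (D.pow_le_derivN (by linarith) h2 hx)

theorem pow_mul_dist_le {κ : ℝ} (hκ : 0 ≤ κ) (h : ∀ i, ∀ x ∈ D.P i, κ ≤ |D.df x|) {n : ℕ}
    {w : Fin n → ℕ} {x y : D.X} (hx : x ∈ D.cyl n w) (hy : y ∈ D.cyl n w) :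
    κ ^ n * dist x y ≤ dist (D.fX^[n] x) (D.fX^[n] y) := by
  induction n generalizing x y with
  | zero => simp
  | succ n ih =>
    rw [cyl_succ] at hx hy
    have h1 := ih hx.2 hy.2
    obtain ⟨ξ, hξ, e, -⟩ := D.exists_abs_slope hx.1 hy.1
    have h2 : κ * dist x y ≤ dist (D.fX x) (D.fX y) := by
      rw [Subtype.dist_eq, Subtype.dist_eq, Real.dist_eq, Real.dist_eq, coe_fX, coe_fX, e]
      gcongr
      exact h _ ξ hξ
    rw [Function.iterate_succ_apply, Function.iterate_succ_apply]
    calc κ ^ (n + 1) * dist x y = κ ^ n * (κ * dist x y) := by ring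
      _ ≤ κ ^ n * dist (D.fX x) (D.fX y) := by gcongr
      _ ≤ _ := h1

/-- Bounded distortion of the iterates. -/
theorem exists_distortion_bound {α C : ℝ} (hα : 0 < α) (hC : 0 < C)
    (hdist : ∀ i, ∀ x ∈ D.P i, ∀ y ∈ D.P i, |(|D.df x| / |D.df y|) - 1| ≤ C * |D.f x - D.f y| ^ α) :
    ∃ C' : ℝ, 0 < C' ∧ ∀ (n : ℕ) (w : Fin n → ℕ), ∀ x ∈ D.cyl n w, ∀ y ∈ D.cyl n w,
      D.derivN n x ≤ Real.exp (C' * dist (D.fX^[n] x) (D.fX^[n] y) ^ α) * D.derivN n y ∧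
      dist (D.fX^[n] x) (D.fX^[n] y) ≤
        Real.exp (C' * dist (D.fX^[n] x) (D.fX^[n] y) ^ α) * D.derivN n x * dist x y := by
  obtain ⟨κ, hκ1, -, hκ⟩ := D.exists_expansion
  have hκ0 : 0 < κ := by linarith
  set l : ℝ := (κ ^ α)⁻¹ with hl
  have hκα : 1 < κ ^ α := Real.one_lt_rpow hκ1 hα
  have hl0 : 0 < l := by positivity
  have hl1 : l < 1 := inv_lt_one_of_one_lt₀ hκα
  -- The second inequality replaces a mean value theorem for the iterate. Both are proved by
  -- induction on the number of steps, with the partial geometric sum in the exponent.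
  have key : ∀ (n : ℕ) (w : Fin n → ℕ), ∀ x ∈ D.cyl n w, ∀ y ∈ D.cyl n w,
      D.derivN n x ≤ Real.exp (C * (∑ j ∈ Finset.range n, l ^ j) *
        dist (D.fX^[n] x) (D.fX^[n] y) ^ α) * D.derivN n y ∧
      dist (D.fX^[n] x) (D.fX^[n] y) ≤ Real.exp (C * (∑ j ∈ Finset.range n, l ^ j) *
        dist (D.fX^[n] x) (D.fX^[n] y) ^ α) * D.derivN n x * dist x y := by
    intro n
    induction n with
    | zero => intro w x _ y _; simp [derivN]
    | succ n ih =>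
      intro w x hx y hy
      rw [cyl_succ] at hx hy
      obtain ⟨ih1, ih2⟩ := ih _ _ hx.2 _ hy.2
      rw [← Function.iterate_succ_apply, ← Function.iterate_succ_apply] at ih1 ih2
      set Δ := dist (D.fX^[n + 1] x) (D.fX^[n + 1] y) with hΔ
      -- Backward contraction: points at distance `Δ` after `n + 1` steps were at distance at most
      -- `κ^{-n} Δ` after the first one. This makes the distortion contributions a geometric series
      -- with ratio `l = κ^{-α}`.
      have hb : dist (D.fX x) (D.fX y) ^ α ≤ l ^ n * Δ ^ α := by
        have h1 := D.pow_mul_dist_le hκ0.le hκ hx.2 hy.2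
        rw [← Function.iterate_succ_apply, ← Function.iterate_succ_apply, ← hΔ] at h1
        have h2 : (κ ^ n * dist (D.fX x) (D.fX y)) ^ α ≤ Δ ^ α := by gcongr
        rw [Real.mul_rpow (by positivity) dist_nonneg, ← Real.rpow_natCast, ← Real.rpow_mul hκ0.le,
          mul_comm (n : ℝ), Real.rpow_mul hκ0.le, Real.rpow_natCast] at h2
        rw [hl, inv_pow, ← div_eq_inv_mul, le_div_iff₀ (by positivity), mul_comm]
        exact h2
      have hone : ∀ u v : ℝ, u ∈ D.P (w 0) → v ∈ D.P (w 0) → |D.f u - D.f v| ≤ dist (D.fX x) (D.fX y) →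
          |D.df u| ≤ Real.exp (C * (l ^ n * Δ ^ α)) * |D.df v| := by
        intro u v hu hv huv
        have h1 := hdist _ u hu v hv
        have h2 : 0 < |D.df v| := abs_pos.2 (D.df_ne_zero hv)
        rw [← div_le_iff₀ h2]
        have h3 : |D.f u - D.f v| ^ α ≤ dist (D.fX x) (D.fX y) ^ α := by gcongr
        have h4 : C * |D.f u - D.f v| ^ α ≤ C * (l ^ n * Δ ^ α) := by gcongr; exact h3.trans hb
        have h5 := Real.add_one_le_exp (C * (l ^ n * Δ ^ α))
        have h6 := (abs_le.1 h1).2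
        linarith
      have hexp : Real.exp (C * (∑ j ∈ Finset.range (n + 1), l ^ j) * Δ ^ α) =
          Real.exp (C * (l ^ n * Δ ^ α)) * Real.exp (C * (∑ j ∈ Finset.range n, l ^ j) * Δ ^ α) := by
        rw [← Real.exp_add, Finset.sum_range_succ]
        congr 1; ring
      have hpos : 0 ≤ D.derivN n (D.fX x) := Finset.prod_nonneg fun _ _ => abs_nonneg _
      have hpos' : 0 ≤ D.derivN n (D.fX y) := Finset.prod_nonneg fun _ _ => abs_nonneg _
      have hd : dist (D.fX x) (D.fX y) = |D.f x - D.f y| := rfl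
      have hd' : dist x y = |(x : ℝ) - y| := rfl
      rw [hexp, derivN_succ, derivN_succ]
      refine ⟨?_, ?_⟩
      · calc _ ≤ (Real.exp (C * (l ^ n * Δ ^ α)) * |D.df y|) *
              (Real.exp (C * (∑ j ∈ Finset.range n, l ^ j) * Δ ^ α) * D.derivN n (D.fX y)) :=
              mul_le_mul (hone x y hx.1 hy.1 hd.ge) ih1 hpos (by positivity)
          _ = _ := by ring
      · obtain ⟨ξ, hξ, e, hξx⟩ := D.exists_abs_slope hx.1 hy.1
        have h1 := hone ξ x hξ hx.1 (hξx.trans hd.ge)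
        have h2 : dist (D.fX x) (D.fX y) ≤ Real.exp (C * (l ^ n * Δ ^ α)) * |D.df x| * dist x y := by
          rw [hd, hd', e]
          gcongr
        calc Δ ≤ Real.exp (C * (∑ j ∈ Finset.range n, l ^ j) * Δ ^ α) * D.derivN n (D.fX x) *
              dist (D.fX x) (D.fX y) := ih2
          _ ≤ Real.exp (C * (∑ j ∈ Finset.range n, l ^ j) * Δ ^ α) * D.derivN n (D.fX x) *
              (Real.exp (C * (l ^ n * Δ ^ α)) * |D.df x| * dist x y) := by gcongr
          _ = _ := by ring
  have hsum : ∀ n, ∑ j ∈ Finset.range n, l ^ j ≤ (1 - l)⁻¹ := fun n => by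
    rw [← tsum_geometric_of_lt_one hl0.le hl1]
    exact (summable_geometric_of_lt_one hl0.le hl1).sum_le_tsum _ fun _ _ => by positivity
  have h1l : 0 < 1 - l := by linarith
  refine ⟨C * (1 - l)⁻¹, by positivity, fun n w x hx y hy => ?_⟩
  obtain ⟨h1, h2⟩ := key n w x hx y hy
  have hle : Real.exp (C * (∑ j ∈ Finset.range n, l ^ j) * dist (D.fX^[n] x) (D.fX^[n] y) ^ α) ≤
      Real.exp (C * (1 - l)⁻¹ * dist (D.fX^[n] x) (D.fX^[n] y) ^ α) := by
    gcongr
    exact hsum n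
  have hp := (D.derivN_pos hx).le
  have hp' := (D.derivN_pos hy).le
  exact ⟨h1.trans (by gcongr), h2.trans (by gcongr)⟩

end YoungBase

/-! ### Size and variation of the weights of iterates on cylinders. -/

namespace YoungBase

variable (D : YoungBase)

theorem leb_apply (s : Set D.X) : D.leb s = (volume D.X)⁻¹ * volume (((↑) : D.X → ℝ) '' s) := by
  rw [leb, normalizedLebesgue, Measure.smul_apply, smul_eq_mul,
    (MeasurableEmbedding.subtype_coe D.measurableSet_X).comap_apply]

theorem volume_image_coe (s : Set D.X) :
    volume (((↑) : D.X → ℝ) '' s) = volume D.X * D.leb s := by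
  rw [leb_apply, ← mul_assoc, ENNReal.mul_inv_cancel D.volume_X_ne_zero D.volume_X_ne_top, one_mul]

theorem exists_radius : ∃ r : ℝ, 0 < r ∧ ∀ x : D.X, (x : ℝ) ∈ Icc (-r) r := by
  obtain ⟨r, hr⟩ := D.X_isBounded.subset_closedBall 0
  refine ⟨max r 1, by positivity, fun x => ?_⟩
  have := hr x.2
  rw [Metric.mem_closedBall, dist_zero_right, Real.norm_eq_abs] at this
  exact abs_le.1 (this.trans (le_max_left _ _))

/-- Lebesgue measure on the line is one-dimensional Hausdorff measure, so a Lipschitz bound suffices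
and no derivative of the iterate is needed. -/
theorem volume_image_le_of_dist_le {S : Set D.X} {F : D.X → D.X} {K : ℝ}
    (h : ∀ x ∈ S, ∀ y ∈ S, dist (F x) (F y) ≤ K * dist x y) :
    volume (((↑) : D.X → ℝ) '' (F '' S)) ≤ ENNReal.ofReal K * volume (((↑) : D.X → ℝ) '' S) := by
  have hL : LipschitzOnWith K.toNNReal (fun x => (F x : ℝ)) S := by
    refine LipschitzOnWith.of_dist_le_mul fun x hx y hy => (h x hx y hy).trans ?_
    gcongr
    exact Real.le_coe_toNNReal K
  have h1 := hL.hausdorffMeasure_image_le (d := 1) zero_le_one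
  rw [← (isometry_subtype_coe (s := D.X)).hausdorffMeasure_image (Or.inl zero_le_one) S,
    hausdorffMeasure_real, ENNReal.rpow_one] at h1
  rwa [image_image]

/-- Uniform control of the inverse of the derivative of the iterates on cylinders. -/
theorem exists_inv_derivN_bound : ∃ κ Q : ℝ, 1 < κ ∧ 1 < D.θ * κ ∧ 1 ≤ Q ∧
    ∀ (n : ℕ) (w : Fin (n + 1) → ℕ), ∃ M : ℝ, 0 ≤ M ∧ M ≤ Q * (κ ^ (n + 1))⁻¹ ∧
      M ≤ Q * D.leb.real (D.cyl (n + 1) w) ∧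
      (∀ y ∈ D.cyl (n + 1) w, (D.derivN (n + 1) y)⁻¹ ≤ M) ∧
      eVariationOn (fun y => (D.derivN (n + 1) y)⁻¹) (D.cyl (n + 1) w) ≤ ENNReal.ofReal (Q * M) := by
  obtain ⟨κ, hκ1, hκθ, hκ⟩ := D.exists_expansion
  obtain ⟨r, hr0, hr⟩ := D.exists_radius
  obtain ⟨c, hc0, hc⟩ := D.big_images
  obtain ⟨α, C, hα, hC, hdist, hcase⟩ : ∃ α C : ℝ, 0 < α ∧ 0 < C ∧
      (∀ i, ∀ x ∈ D.P i, ∀ y ∈ D.P i, |(|D.df x| / |D.df y|) - 1| ≤ C * |D.f x - D.f y| ^ α) ∧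
      (α = 1 ∨ ∀ n : ℕ, 1 ≤ n → ∀ w : ℕ → ℕ,
        MonotoneOn (fun x => ∏ j ∈ Finset.range n, D.df (D.f^[j] x))
          {x | ∀ j < n, D.f^[j] x ∈ D.P (w j)} ∨
        AntitoneOn (fun x => ∏ j ∈ Finset.range n, D.df (D.f^[j] x))
          {x | ∀ j < n, D.f^[j] x ∈ D.P (w j)}) := by
    rcases D.distortion with ⟨C, hC, h⟩ | ⟨⟨α, hα, C, hC, h⟩, h'⟩
    · exact ⟨1, C, one_pos, hC, by simpa using h, Or.inl rfl⟩
    · exact ⟨α, C, hα.1, hC, h, Or.inr h'⟩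
  obtain ⟨C', hC', hD⟩ := D.exists_distortion_bound hα hC hdist
  have hdia : ∀ x y : D.X, dist x y ≤ 2 * r := fun x y => by
    have h1 := hr x
    have h2 := hr y
    rw [Subtype.dist_eq, Real.dist_eq, abs_le]
    constructor <;> linarith [h1.1, h1.2, h2.1, h2.2]
  set K := Real.exp (C' * (2 * r) ^ α) with hK
  have hK1 : 1 ≤ K := Real.one_le_exp (by positivity)
  have hexp : ∀ x y : D.X, Real.exp (C' * dist x y ^ α) ≤ K := fun x y => by
    have := hdia x y
    rw [hK]; gcongr
  set v := (volume D.X).toReal with hv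
  have hv0 : 0 < v := ENNReal.toReal_pos D.volume_X_ne_zero D.volume_X_ne_top
  -- One summand per requirement: exponential smallness, comparison with the measure of the
  -- cylinder, variation under Lipschitz distortion, variation under monotone derivatives.
  set Q := K + K ^ 3 * v / c + C' * K * K * (2 * r) + 2 * K ^ 2 with hQ
  have hQa : K ≤ Q := by
    have : 0 ≤ K ^ 3 * v / c + C' * K * K * (2 * r) + 2 * K ^ 2 := by positivity
    linarith
  have hQb : K ^ 3 * v / c ≤ Q := by
    have : 0 ≤ K + C' * K * K * (2 * r) + 2 * K ^ 2 := by positivity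
    linarith
  have hQc : C' * K * K * (2 * r) ≤ Q := by
    have : 0 ≤ K + K ^ 3 * v / c + 2 * K ^ 2 := by positivity
    linarith
  have hQd : 2 * K ^ 2 ≤ Q := by
    have : 0 ≤ K + K ^ 3 * v / c + C' * K * K * (2 * r) := by positivity
    linarith
  refine ⟨κ, Q, hκ1, hκθ, hK1.trans hQa, fun n w => ?_⟩
  rcases (D.cyl (n + 1) w).eq_empty_or_nonempty with he | ⟨x₀, hx₀⟩
  · refine ⟨0, le_rfl, by positivity, by positivity, by simp [he], by simp [he]⟩
  set S := D.cyl (n + 1) w with hS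
  set d := D.derivN (n + 1) with hd
  have hpos : ∀ y ∈ S, 0 < d y := fun y hy => D.derivN_pos hy
  have hcomp : ∀ x ∈ S, ∀ y ∈ S, d x ≤ K * d y := fun x hx y hy =>
    (hD _ _ x hx y hy).1.trans (by have := (hpos y hy).le; gcongr; exact hexp _ _)
  have hd0 := hpos x₀ hx₀
  -- By distortion the derivative at one reference point determines it on the whole cylinder up to
  -- the factor `K`.
  refine ⟨K * (d x₀)⁻¹, by positivity, ?_, ?_, ?_, ?_⟩
  · have := D.pow_le_derivN (by linarith) hκ hx₀
    gcongr
  · -- the image of the cylinder is large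
    have hlip : ∀ x ∈ S, ∀ y ∈ S,
        dist (D.fX^[n + 1] x) (D.fX^[n + 1] y) ≤ (K ^ 2 * d x₀) * dist x y := by
      intro x hx y hy
      have hdx := (hpos x hx).le
      calc _ ≤ K * d x * dist x y :=
            (hD _ _ x hx y hy).2.trans (by gcongr; exact hexp _ _)
        _ ≤ K * (K * d x₀) * dist x y := by gcongr; exact hcomp x hx x₀ hx₀
        _ = _ := by ring
    have h1 := D.volume_image_le_of_dist_le hlip
    have h2 : ENNReal.ofReal c ≤ volume (((↑) : D.X → ℝ) '' (D.fX^[n + 1] '' S)) := by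
      rcases D.image_cyl n w with h | ⟨i, h⟩
      · exact absurd h (Nonempty.ne_empty ⟨_, x₀, hx₀, rfl⟩)
      · rw [h, D.image_coe_fX]; exact hc i
    have h3 := h2.trans h1
    rw [volume_image_coe, ← ENNReal.ofReal_toReal D.volume_X_ne_top, ← hv,
      ← ENNReal.ofReal_toReal (measure_ne_top D.leb S), ← ENNReal.ofReal_mul hv0.le,
      ← ENNReal.ofReal_mul (by positivity),
      ENNReal.ofReal_le_ofReal_iff (by positivity)] at h3
    change c ≤ K ^ 2 * d x₀ * (v * D.leb.real S) at h3
    have h4 : (d x₀)⁻¹ ≤ K ^ 2 * v / c * D.leb.real S := by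
      rw [inv_le_iff_one_le_mul₀ hd0]
      rw [show K ^ 2 * v / c * D.leb.real S * d x₀ = (K ^ 2 * d x₀ * (v * D.leb.real S)) / c by ring,
        one_le_div hc0]
      exact h3
    calc K * (d x₀)⁻¹ ≤ K * (K ^ 2 * v / c * D.leb.real S) := by gcongr
      _ = K ^ 3 * v / c * D.leb.real S := by ring
      _ ≤ _ := by gcongr
  · intro y hy
    have := hcomp x₀ hx₀ y hy
    rw [inv_le_iff_one_le_mul₀ (hpos y hy), mul_assoc, mul_comm _ (d y), ← mul_assoc,
      ← div_eq_mul_inv, one_le_div hd0]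
    exact this
  · have hinv : ∀ x ∈ S, ∀ y ∈ S, |(d x)⁻¹ - (d y)⁻¹| = |d x - d y| / (d x * d y) := by
      intro x hx y hy
      rw [inv_sub_inv (hpos x hx).ne' (hpos y hy).ne', abs_div, abs_sub_comm,
        abs_of_pos (mul_pos (hpos x hx) (hpos y hy))]
    have hlow : ∀ x ∈ S, d x₀ / K ≤ d x := fun x hx => by
      rw [div_le_iff₀ (by positivity), mul_comm]; exact hcomp x₀ hx₀ x hx
    rcases hcase with rfl | hmon
    · -- Lipschitz distortion
      have hone : ∀ x ∈ S, ∀ y ∈ S, d x - d y ≤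
          C' * K * dist (D.fX^[n + 1] x) (D.fX^[n + 1] y) * d y := by
        intro x hx y hy
        have h1 := (hD _ _ x hx y hy).1
        rw [Real.rpow_one] at h1
        set t := C' * dist (D.fX^[n + 1] x) (D.fX^[n + 1] y) with ht
        have ht0 : 0 ≤ t := by positivity
        have h2 : Real.exp t - 1 ≤ t * Real.exp t := by
          have h3 := Real.add_one_le_exp (-t)
          have h4 : Real.exp (-t) * Real.exp t = 1 := by rw [← Real.exp_add]; simp
          nlinarith [Real.exp_pos t]
        have h3 : Real.exp t ≤ K := by
          have := hexp (D.fX^[n + 1] x) (D.fX^[n + 1] y)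
          rwa [Real.rpow_one] at this
        have hdy := hpos y hy
        calc d x - d y ≤ (Real.exp t - 1) * d y := by
              have : d x ≤ Real.exp t * d y := h1
              linarith
          _ ≤ (t * K) * d y := by gcongr; exact h2.trans (by gcongr)
          _ = _ := by rw [ht]; ring
      have hlip : ∀ x ∈ S, ∀ y ∈ S, edist ((d x)⁻¹) ((d y)⁻¹) ≤
          ENNReal.ofReal (C' * K * K * (d x₀)⁻¹) *
            edist (D.fX^[n + 1] x : ℝ) (D.fX^[n + 1] y : ℝ) := by
        intro x hx y hy
        rw [edist_dist, edist_dist, ← ENNReal.ofReal_mul (by positivity), Real.dist_eq, hinv x hx y hy]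
        refine ENNReal.ofReal_le_ofReal ?_
        change _ ≤ C' * K * K * (d x₀)⁻¹ * dist (D.fX^[n + 1] x) (D.fX^[n + 1] y)
        wlog hxy : d y ≤ d x generalizing x y
        · have := this y hy x hx (le_of_not_ge hxy)
          rwa [abs_sub_comm, mul_comm (d y), dist_comm] at this
        rw [abs_of_nonneg (by linarith)]
        have hdx := hpos x hx
        have hdy := hpos y hy
        calc (d x - d y) / (d x * d y) ≤
              (C' * K * dist (D.fX^[n + 1] x) (D.fX^[n + 1] y) * d y) / (d x * d y) := by
              gcongr; exact hone x hx y hy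
          _ = C' * K * dist (D.fX^[n + 1] x) (D.fX^[n + 1] y) * (d x)⁻¹ := by field_simp
          _ ≤ C' * K * dist (D.fX^[n + 1] x) (D.fX^[n + 1] y) * (d x₀ / K)⁻¹ := by
              gcongr; exact hlow x hx
          _ = _ := by rw [inv_div]; field_simp
      refine (eVariationOn_le_mul_of_edist_le hlip).trans ?_
      -- With Lipschitz distortion `1/d` is a Lipschitz function of the image point, and the iterate
      -- is monotone on the cylinder with values in `[-r, r]`. A Hölder exponent below `1` would not
      -- preserve finite variation, hence the other alternative.
      have hvar : eVariationOn (fun x => (D.fX^[n + 1] x : ℝ)) S ≤ ENNReal.ofReal (r - -r) := by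
        rcases D.monotoneOn_or_antitoneOn_cyl (n + 1) w le_rfl with h | h
        · exact eVariationOn_le_of_monotoneOn (fun x hx y hy hxy => h hx hy hxy) fun x _ => hr _
        · exact eVariationOn_le_of_antitoneOn (fun x hx y hy hxy => h hx hy hxy) fun x _ => hr _
      calc _ ≤ ENNReal.ofReal (C' * K * K * (d x₀)⁻¹) * ENNReal.ofReal (r - -r) := by gcongr
        _ = ENNReal.ofReal (C' * K * K * (2 * r) * (1 * (d x₀)⁻¹)) := by
            rw [← ENNReal.ofReal_mul (by positivity)]; congr 1; ring
        _ ≤ _ := by gcongr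
    · -- monotone derivatives
      let pr : D.X → ℝ := fun x => ∏ j ∈ Finset.range (n + 1), D.df (D.f^[j] x)
      have habs : ∀ x, |pr x| = d x := fun x => by
        simp only [pr, hd, derivN, Finset.abs_prod, coe_iterate_fX]
      have hbd : ∀ x ∈ S, pr x ∈ Icc (-(K * d x₀)) (K * d x₀) := fun x hx =>
        abs_le.1 ((habs x).le.trans (hcomp x hx x₀ hx₀))
      have hprv : eVariationOn pr S ≤ ENNReal.ofReal (K * d x₀ - -(K * d x₀)) := by
        -- The monotonicity hypothesis takes infinite itineraries; beyond the length of the word the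
        -- symbol `0` is an irrelevant default.
        have hmem : ∀ x ∈ S, (x : ℝ) ∈ {x : ℝ | ∀ j < n + 1,
            D.f^[j] x ∈ D.P ((fun j => if h : j < n + 1 then w ⟨j, h⟩ else 0) j)} := by
          intro x hx j hj
          have := hx ⟨j, hj⟩
          rw [coe_iterate_fX] at this
          simpa [hj] using this
        rcases hmon (n + 1) (by omega) (fun j => if h : j < n + 1 then w ⟨j, h⟩ else 0) with h | h
        · exact eVariationOn_le_of_monotoneOn
            (fun x hx y hy hxy => h (hmem x hx) (hmem y hy) hxy) hbd
        · exact eVariationOn_le_of_antitoneOn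
            (fun x hx y hy hxy => h (hmem x hx) (hmem y hy) hxy) hbd
      have hlip : ∀ x ∈ S, ∀ y ∈ S, edist ((d x)⁻¹) ((d y)⁻¹) ≤
          ENNReal.ofReal ((K * (d x₀)⁻¹) ^ 2) * edist (pr x) (pr y) := by
        intro x hx y hy
        rw [edist_dist, edist_dist, ← ENNReal.ofReal_mul (by positivity), Real.dist_eq,
          hinv x hx y hy, Real.dist_eq]
        refine ENNReal.ofReal_le_ofReal ?_
        have h1 : |d x - d y| ≤ |pr x - pr y| := by
          rw [← habs x, ← habs y]; exact abs_abs_sub_abs_le _ _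
        have h2 := hlow x hx
        have h3 := hlow y hy
        have := (hpos x hx).le
        calc |d x - d y| / (d x * d y) ≤ |pr x - pr y| / ((d x₀ / K) * (d x₀ / K)) := by gcongr
          _ = _ := by field_simp
      refine (eVariationOn_le_mul_of_edist_le hlip).trans ?_
      calc _ ≤ ENNReal.ofReal ((K * (d x₀)⁻¹) ^ 2) * ENNReal.ofReal (K * d x₀ - -(K * d x₀)) := by
            gcongr
        _ = ENNReal.ofReal (2 * K ^ 2 * (K * (d x₀)⁻¹)) := by
            rw [← ENNReal.ofReal_mul (by positivity)]; congr 1; field_simp; ring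
        _ ≤ _ := by gcongr

/-- The weight of the open, weighted transfer operator. -/
noncomputable def wt (H : Set ℝ) (u : ℂ) (y : D.X) : ℂ :=
  D.survive H y * u ^ D.R y / ((|D.df y| : ℝ) : ℂ)

/-- The weight of the `n`-th iterate. -/
noncomputable def wtN (H : Set ℝ) (u : ℂ) (n : ℕ) (y : D.X) : ℂ :=
  ∏ j ∈ Finset.range n, D.wt H u (D.fX^[j] y)

theorem wtN_succ (H : Set ℝ) (u : ℂ) (n : ℕ) (y : D.X) :
    D.wtN H u (n + 1) y = D.wtN H u n (D.fX y) * D.wt H u y := by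
  rw [wtN, Finset.prod_range_succ']
  rfl

theorem enorm_survive_le (H : Set ℝ) (y : D.X) : ‖D.survive H y‖ₑ ≤ 1 := by
  unfold survive
  split_ifs <;> simp

theorem survive_eq (H : Set ℝ) (y : D.X) :
    D.survive H y = 1 - ({x : D.X | (x : ℝ) ∈ H}.indicator fun _ => (1 : ℂ)) (D.fX y) := by
  classical
  unfold survive
  by_cases h : (D.fX y : ℝ) ∈ H <;> simp [h]

/-- Up to sign and constant this is the indicator of the interval `H` composed with the monotone map
`f^{j+1}`, so it jumps at most twice. -/
theorem eVariationOn_survive_iterate_le {H : Set ℝ} (hH : H.OrdConnected) {n : ℕ} (w : Fin n → ℕ)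
    {j : ℕ} (hj : j < n) : eVariationOn (fun y => D.survive H (D.fX^[j] y)) (D.cyl n w) ≤ 2 := by
  have hJ : {x : D.X | (x : ℝ) ∈ H}.OrdConnected :=
    ⟨fun _ hx _ hy _ hz => hH.out hx hy hz⟩
  set g := {x : D.X | (x : ℝ) ∈ H}.indicator fun _ => (1 : ℂ) with hg
  have h1 : eVariationOn (fun y => D.survive H (D.fX^[j] y)) (D.cyl n w) ≤
      1 * eVariationOn (g ∘ D.fX^[j + 1]) (D.cyl n w) := by
    refine eVariationOn_le_mul_of_edist_le fun x _ y _ => ?_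
    rw [survive_eq, survive_eq, one_mul, edist_sub_left]
    simp only [Function.comp, Function.iterate_succ_apply', hg, le_refl]
  rw [one_mul] at h1
  refine h1.trans (le_trans ?_ (eVariationOn_indicator_ordConnected_le hJ univ))
  rcases D.monotoneOn_or_antitoneOn_cyl n w (m := j + 1) hj with h | h
  · exact eVariationOn.comp_le_of_monotoneOn _ _ h (mapsTo_univ _ _)
  · exact eVariationOn.comp_le_of_antitoneOn _ _ h (mapsTo_univ _ _)

theorem prod_survive_bounds {H : Set ℝ} (hH : H.OrdConnected) {n : ℕ} (w : Fin n → ℕ) {m : ℕ}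
    (hm : m ≤ n) :
    (∀ y, ‖∏ j ∈ Finset.range m, D.survive H (D.fX^[j] y)‖ₑ ≤ 1) ∧
    eVariationOn (fun y => ∏ j ∈ Finset.range m, D.survive H (D.fX^[j] y)) (D.cyl n w) ≤ 2 * m := by
  induction m with
  | zero =>
    refine ⟨by simp, ?_⟩
    simp only [Finset.range_zero, Finset.prod_empty, CharP.cast_eq_zero, mul_zero, nonpos_iff_eq_zero]
    exact eVariationOn.constant_on (by rintro _ ⟨a, -, rfl⟩ _ ⟨b, -, rfl⟩; rfl)
  | succ m ih =>
    obtain ⟨h1, h2⟩ := ih (by omega)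
    simp only [Finset.prod_range_succ]
    refine ⟨fun y => ?_, ?_⟩
    · rw [enorm_mul]
      exact mul_le_one' (h1 y) (D.enorm_survive_le H _)
    · refine (eVariationOn_mul_le (M := 1) (N := 1) (fun y _ => h1 y)
        (fun y _ => D.enorm_survive_le H _)).trans ?_
      rw [one_mul, one_mul]
      calc _ ≤ (2 : ℝ≥0∞) + 2 * m := add_le_add (D.eVariationOn_survive_iterate_le hH w (by omega)) h2
        _ = _ := by push_cast; ring

theorem R_pos_cell {i : ℕ} {y : D.X} (hy : y ∈ D.cell i) : 1 ≤ D.R y := D.R_pos i y hy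

/-- The return time is constant along an itinerary, so the parameter `u` adds nothing to the
variation; since `R ≥ 1`, each step gains a factor `‖u‖`. -/
theorem exists_prod_pow_R {u : ℂ} (hu : ‖u‖ ≤ 1) {n : ℕ} (w : Fin n → ℕ) : ∃ c : ℂ, ‖c‖ ≤ ‖u‖ ^ n ∧
    ∀ y ∈ D.cyl n w, ∏ j ∈ Finset.range n, u ^ D.R (D.fX^[j] y) = c := by
  rcases (D.cyl n w).eq_empty_or_nonempty with h | ⟨x, hx⟩
  · exact ⟨0, by simp, by simp [h]⟩
  refine ⟨∏ j ∈ Finset.range n, u ^ D.R (D.fX^[j] x), ?_, fun y hy => ?_⟩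
  · rw [norm_prod]
    calc _ ≤ ∏ j ∈ Finset.range n, ‖u‖ := by
          refine Finset.prod_le_prod (fun _ _ => norm_nonneg _) fun j hj => ?_
          rw [norm_pow]
          have := D.R_pos _ _ (hx ⟨j, Finset.mem_range.1 hj⟩)
          exact pow_le_of_le_one (norm_nonneg _) hu (by simp only at this; omega)
      _ = _ := by simp
  · refine Finset.prod_congr rfl fun j hj => ?_
    rw [D.R_const _ _ (hy ⟨j, Finset.mem_range.1 hj⟩) _ (hx ⟨j, Finset.mem_range.1 hj⟩)]

/-- Size and variation of the weights of the iterates on cylinders. -/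
theorem exists_weight_bound : ∃ κ Q : ℝ, 1 < κ ∧ 1 < D.θ * κ ∧ 1 ≤ Q ∧
    ∀ H : Set ℝ, H.OrdConnected → ∀ u : ℂ, ‖u‖ ≤ 1 → ∀ (n : ℕ) (w : Fin (n + 1) → ℕ),
    ∃ M : ℝ, 0 ≤ M ∧ M ≤ Q * (κ ^ (n + 1))⁻¹ ∧ M ≤ Q * D.leb.real (D.cyl (n + 1) w) ∧
      (∀ y ∈ D.cyl (n + 1) w, ‖D.wtN H u (n + 1) y‖ₑ ≤ ENNReal.ofReal (‖u‖ ^ (n + 1) * M)) ∧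
      eVariationOn (D.wtN H u (n + 1)) (D.cyl (n + 1) w) ≤
        ENNReal.ofReal (‖u‖ ^ (n + 1) * ((Q + 2 * (n + 1)) * M)) := by
  obtain ⟨κ, Q, h1, h2, h3, h⟩ := D.exists_inv_derivN_bound
  refine ⟨κ, Q, h1, h2, h3, fun H hH u hu n w => ?_⟩
  obtain ⟨M, hM0, hMa, hMb, hMc, hMd⟩ := h n w
  obtain ⟨c, hc, hcy⟩ := D.exists_prod_pow_R hu w
  obtain ⟨hs1, hs2⟩ := D.prod_survive_bounds hH w le_rfl
  set S := D.cyl (n + 1) w with hS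
  have hG : ∀ y ∈ S, D.wtN H u (n + 1) y =
      (∏ j ∈ Finset.range (n + 1), D.survive H (D.fX^[j] y)) *
        (c * (((D.derivN (n + 1) y)⁻¹ : ℝ) : ℂ)) := by
    intro y hy
    simp only [wtN, wt, derivN, Finset.prod_div_distrib, Finset.prod_mul_distrib, hcy y hy]
    push_cast
    rw [div_eq_mul_inv, mul_assoc]
  have hb : ∀ y ∈ S, ‖c * (((D.derivN (n + 1) y)⁻¹ : ℝ) : ℂ)‖ₑ ≤
      ENNReal.ofReal (‖u‖ ^ (n + 1) * M) := by
    intro y hy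
    rw [← ofReal_norm]
    refine ENNReal.ofReal_le_ofReal ?_
    rw [norm_mul, Complex.norm_real, Real.norm_of_nonneg (inv_nonneg.2 (D.derivN_pos hy).le)]
    have := hMc y hy
    have := inv_nonneg.2 (D.derivN_pos hy).le
    gcongr
  have hvar : eVariationOn (fun y => c * (((D.derivN (n + 1) y)⁻¹ : ℝ) : ℂ)) S ≤
      ENNReal.ofReal (‖u‖ ^ (n + 1) * (Q * M)) := by
    have h5 := eVariationOn_smul c (fun y : D.X => (((D.derivN (n + 1) y)⁻¹ : ℝ) : ℂ)) S
    have h6 : (c • fun y : D.X => (((D.derivN (n + 1) y)⁻¹ : ℝ) : ℂ)) =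
      fun y => c * (((D.derivN (n + 1) y)⁻¹ : ℝ) : ℂ) := rfl
    rw [h6] at h5
    rw [h5, eVariationOn_ofReal_comp, ENNReal.ofReal_mul (by positivity), ← ofReal_norm]
    gcongr
  refine ⟨M, hM0, hMa, hMb, fun y hy => ?_, ?_⟩
  · rw [hG y hy, enorm_mul]
    calc _ ≤ 1 * ENNReal.ofReal (‖u‖ ^ (n + 1) * M) := mul_le_mul' (hs1 y) (hb y hy)
      _ = _ := one_mul _
  · rw [eVariationOn.congr hG]
    refine (eVariationOn_mul_le (fun y _ => hs1 y) hb).trans ?_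
    calc _ ≤ 1 * ENNReal.ofReal (‖u‖ ^ (n + 1) * (Q * M)) +
          ENNReal.ofReal (‖u‖ ^ (n + 1) * M) * (2 * (n + 1 : ℕ)) := by gcongr
      _ = ENNReal.ofReal (‖u‖ ^ (n + 1) * (Q * M)) +
          ENNReal.ofReal (‖u‖ ^ (n + 1) * M) * ENNReal.ofReal (2 * (n + 1)) := by
          rw [one_mul, ENNReal.ofReal_mul (by norm_num : (0 : ℝ) ≤ 2)]
          congr 3
          · simp
          · rw [← Nat.cast_succ, ENNReal.ofReal_natCast]
      _ = _ := by
          rw [← ENNReal.ofReal_mul (by positivity), ← ENNReal.ofReal_add (by positivity) (by positivity)]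
          congr 1; ring

end YoungBase

/-! ### Branch operators as bounded operators on functions of bounded variation. -/

namespace YoungBase

variable (D : YoungBase)

theorem measurableSet_of_ordConnected {s : Set D.X} (hs : s.OrdConnected) : MeasurableSet s := by
  have h : s = ((↑) : D.X → ℝ) ⁻¹' {r : ℝ | ∃ a ∈ s, ∃ b ∈ s, (a : ℝ) ≤ r ∧ r ≤ b} := by
    ext x
    constructor
    · exact fun hx => ⟨x, hx, x, hx, le_rfl, le_rfl⟩
    · rintro ⟨a, ha, b, hb, h1, h2⟩
      exact hs.out ha hb ⟨h1, h2⟩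
  rw [h]
  refine measurable_subtype_coe (OrdConnected.measurableSet ⟨?_⟩)
  rintro x ⟨a, ha, -, -, h1, -⟩ y ⟨-, -, b, hb, -, h2⟩ z hz
  exact ⟨a, ha, b, hb, h1.trans hz.1, hz.2.trans h2⟩

theorem measurable_of_monotone {p : D.X → ℝ} (hp : Monotone p) : Measurable p := by
  refine measurable_of_Iio fun c => D.measurableSet_of_ordConnected ⟨?_⟩
  exact fun x _ y hy z hz => (hp hz.2).trans_lt hy

/-- Jordan decomposition of the real and imaginary parts into monotone functions. Together with
boundedness this makes integrability automatic in `B`. -/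
theorem measurable_of_boundedVariationOn {φ : D.X → ℂ} (h : BoundedVariationOn φ univ) :
    Measurable φ := by
  have hreal : ∀ g : D.X → ℝ, BoundedVariationOn g univ → Measurable g := by
    intro g hg
    obtain ⟨p, q, hp, hq, rfl⟩ :=
      hg.locallyBoundedVariationOn.exists_monotoneOn_sub_monotoneOn
    exact (D.measurable_of_monotone (monotoneOn_univ.1 hp)).sub
      (D.measurable_of_monotone (monotoneOn_univ.1 hq))
  have hre : Measurable fun x => (φ x).re :=
    hreal _ ((LipschitzWith.of_dist_le_mul (K := 1) fun a b => by
      rw [NNReal.coe_one, one_mul, dist_eq_norm, dist_eq_norm, ← Complex.sub_re]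
      exact Complex.abs_re_le_norm _).comp_boundedVariationOn h)
  have him : Measurable fun x => (φ x).im :=
    hreal _ ((LipschitzWith.of_dist_le_mul (K := 1) fun a b => by
      rw [NNReal.coe_one, one_mul, dist_eq_norm, dist_eq_norm, ← Complex.sub_im]
      exact Complex.abs_im_le_norm _).comp_boundedVariationOn h)
  have : φ = fun x => ((φ x).re : ℂ) + ((φ x).im : ℂ) * Complex.I := by
    ext x; exact (Complex.re_add_im _).symm
  rw [this]
  exact (Complex.measurable_ofReal.comp hre).add
    ((Complex.measurable_ofReal.comp him).mul_const _)

theorem mem_bv_of_boundedVariationOn {φ : D.X → ℂ} (h : BoundedVariationOn φ univ) : φ ∈ D.bv := by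
  refine ⟨h, ?_⟩
  obtain ⟨x₀, hx₀⟩ := D.X_nonempty
  refine Integrable.of_bound (D.measurable_of_boundedVariationOn h).aestronglyMeasurable
    (‖φ ⟨x₀, hx₀⟩‖ + (eVariationOn φ univ).toReal) (Filter.Eventually.of_forall fun x => ?_)
  have h1 := h.dist_le (mem_univ x) (mem_univ ⟨x₀, hx₀⟩)
  rw [dist_eq_norm] at h1
  have := norm_le_norm_add_norm_sub' (φ x) (φ ⟨x₀, hx₀⟩)
  linarith

theorem measurable_BV (φ : D.BV) : Measurable (φ : D.X → ℂ) :=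
  D.measurable_of_boundedVariationOn φ.2.1

theorem BV_ext {φ ψ : D.BV} (h : ∀ x, φ x = ψ x) : φ = ψ := Subtype.ext (funext h)

theorem enorm_BV (φ : D.BV) : ‖φ‖ₑ = ∫⁻ x, ‖φ x‖ₑ ∂D.leb + eVariationOn φ univ := by
  rw [← ofReal_norm, norm_def, ENNReal.ofReal_add (integral_nonneg fun _ => norm_nonneg _)
    ENNReal.toReal_nonneg, ENNReal.ofReal_toReal φ.2.1, ofReal_integral_norm_eq_lintegral_enorm φ.2.2]

theorem enorm_apply_le (φ : D.BV) (x : D.X) : ‖φ x‖ₑ ≤ ‖φ‖ₑ := by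
  rw [← ofReal_norm, ← ofReal_norm]
  exact ENNReal.ofReal_le_ofReal (D.norm_apply_le φ x)

theorem eVariationOn_le_enorm (φ : D.BV) (s : Set D.X) : eVariationOn φ s ≤ ‖φ‖ₑ := by
  rw [enorm_BV]
  exact (eVariationOn.mono _ (subset_univ _)).trans le_add_self

theorem lintegral_le_of_enorm_le {φ : D.X → ℂ} {N : ℝ≥0∞} (h : ∀ x, ‖φ x‖ₑ ≤ N) :
    ∫⁻ x, ‖φ x‖ₑ ∂D.leb ≤ N :=
  (lintegral_mono h).trans (by simp)

/-- Point evaluation as a functional. -/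
noncomputable def evalL (x : D.X) : D.BV →L[ℂ] ℂ :=
  LinearMap.mkContinuous
    { toFun := fun φ : D.BV => φ x
      map_add' := fun _ _ => rfl
      map_smul' := fun _ _ => rfl }
    1 fun φ => (D.norm_apply_le φ x).trans_eq (one_mul _).symm

theorem evalL_apply (x : D.X) (φ : D.BV) : D.evalL x φ = φ x := rfl

/-- A linear operator on functions that is bounded in the norm of bounded variation. -/
theorem exists_clm_of_enorm_bound (L : (D.X → ℂ) → D.X → ℂ) (hadd : ∀ φ ψ, L (φ + ψ) = L φ + L ψ)
    (hsmul : ∀ (c : ℂ) φ, L (c • φ) = c • L φ) {K : ℝ} (hK : 0 ≤ K)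
    (h1 : ∀ φ : D.BV, ∫⁻ x, ‖L φ x‖ₑ ∂D.leb + eVariationOn (L φ) univ ≤ ENNReal.ofReal K * ‖φ‖ₑ) :
    ∃ A : D.BV →L[ℂ] D.BV, (∀ φ : D.BV, (A φ : D.X → ℂ) = L φ) ∧ ‖A‖ ≤ K := by
  have hmem : ∀ φ : D.BV, L φ ∈ D.bv := fun φ => D.mem_bv_of_boundedVariationOn <|
    ne_top_of_le_ne_top (ENNReal.mul_ne_top ENNReal.ofReal_ne_top enorm_ne_top)
      (le_add_self.trans (h1 φ))
  let A₀ : D.BV →ₗ[ℂ] D.BV :=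
    { toFun := fun φ => ⟨L φ, hmem φ⟩
      map_add' := fun φ ψ => Subtype.ext (hadd φ ψ)
      map_smul' := fun c φ => Subtype.ext (hsmul c φ) }
  have hb : ∀ φ, ‖A₀ φ‖ ≤ K * ‖φ‖ := fun φ => by
    have h2 : ‖A₀ φ‖ₑ ≤ ENNReal.ofReal K * ‖φ‖ₑ := by rw [enorm_BV]; exact h1 φ
    rw [← ofReal_norm, ← ofReal_norm, ← ENNReal.ofReal_mul hK] at h2
    exact (ENNReal.ofReal_le_ofReal_iff (by positivity)).1 h2
  exact ⟨A₀.mkContinuous K hb, fun φ => rfl, A₀.mkContinuous_norm_le hK hb⟩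

/-- The constants in the bounds on the weights. -/
structure WeightBound (κ Q : ℝ) : Prop where
  one_lt : 1 < κ
  one_lt_mul : 1 < D.θ * κ
  one_le : 1 ≤ Q
  bound : ∀ H : Set ℝ, H.OrdConnected → ∀ u : ℂ, ‖u‖ ≤ 1 → ∀ (n : ℕ) (w : Fin (n + 1) → ℕ),
    ∃ M : ℝ, 0 ≤ M ∧ M ≤ Q * (κ ^ (n + 1))⁻¹ ∧ M ≤ Q * D.leb.real (D.cyl (n + 1) w) ∧
      (∀ y ∈ D.cyl (n + 1) w, ‖D.wtN H u (n + 1) y‖ₑ ≤ ENNReal.ofReal (‖u‖ ^ (n + 1) * M)) ∧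
      eVariationOn (D.wtN H u (n + 1)) (D.cyl (n + 1) w) ≤
        ENNReal.ofReal (‖u‖ ^ (n + 1) * ((Q + 2 * (n + 1)) * M))

variable {D}

/-- Each value on `S` is at most the average over `S` plus the variation on `S`. The average has the
factor `1 / leb S`, which `M ≤ Q leb S` compensates: this is where the weak norm of the Lasota–Yorke
inequality comes from. -/
theorem sup_average_bound {S : Set D.X} (hS : MeasurableSet S) {M Q : ℝ} (hM : 0 ≤ M)
    (hMQ : M ≤ Q * D.leb.real S) (φ : D.BV) :
    ENNReal.ofReal M * (⨆ y ∈ S, ‖φ y‖ₑ) ≤ ENNReal.ofReal M * eVariationOn φ S +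
      ENNReal.ofReal Q * ∫⁻ y in S, ‖φ y‖ₑ ∂D.leb := by
  simp only [ENNReal.mul_iSup]
  refine iSup₂_le fun x hx => ?_
  rcases eq_or_ne (D.leb S) 0 with h0 | h0
  · have : M = 0 := le_antisymm (by simpa [measureReal_def, h0] using hMQ) hM
    simp [this]
  have hl : D.leb S * ‖φ x‖ₑ ≤ D.leb S * eVariationOn φ S + ∫⁻ y in S, ‖φ y‖ₑ ∂D.leb := by
    have h1 : ∫⁻ _ in S, ‖φ x‖ₑ ∂D.leb ≤ ∫⁻ y in S, (‖φ y‖ₑ + eVariationOn φ S) ∂D.leb :=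
      setLIntegral_mono' hS fun y hy => enorm_le_add_eVariationOn hx hy
    rw [lintegral_add_right _ measurable_const, setLIntegral_const, setLIntegral_const] at h1
    rw [mul_comm, mul_comm (D.leb S), add_comm]
    exact h1
  have hlt : D.leb S ≠ ⊤ := measure_ne_top _ _
  have hMl : ENNReal.ofReal M / D.leb S ≤ ENNReal.ofReal Q := by
    refine ENNReal.div_le_of_le_mul ?_
    rw [← ENNReal.ofReal_toReal hlt]
    rcases le_or_gt 0 Q with hQ | hQ
    · rw [← ENNReal.ofReal_mul hQ]; exact ENNReal.ofReal_le_ofReal hMQ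
    · have : M ≤ 0 := hMQ.trans (mul_nonpos_of_nonpos_of_nonneg hQ.le measureReal_nonneg)
      simp [ENNReal.ofReal_of_nonpos this]
  have hdm : ENNReal.ofReal M / D.leb S * D.leb S = ENNReal.ofReal M :=
    ENNReal.div_mul_cancel h0 hlt
  calc ENNReal.ofReal M * ‖φ x‖ₑ = ENNReal.ofReal M / D.leb S * (D.leb S * ‖φ x‖ₑ) := by
        rw [← mul_assoc, hdm]
    _ ≤ ENNReal.ofReal M / D.leb S * (D.leb S * eVariationOn φ S + ∫⁻ y in S, ‖φ y‖ₑ ∂D.leb) := by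
        gcongr
    _ = ENNReal.ofReal M * eVariationOn φ S +
          ENNReal.ofReal M / D.leb S * ∫⁻ y in S, ‖φ y‖ₑ ∂D.leb := by
        rw [mul_add, ← mul_assoc, hdm]
    _ ≤ _ := by gcongr

/-- The branch of the `n + 1`-st iterate of the transfer operator that belongs to a cylinder. -/
noncomputable def wordFun (D : YoungBase) (H : Set ℝ) (u : ℂ) (n : ℕ) (w : Fin (n + 1) → ℕ)
    (ψ : D.X → ℂ) : D.X → ℂ :=
  branchOp (D.cyl (n + 1) w) D.fX^[n + 1] (D.wtN H u (n + 1)) ψ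

theorem wordFun_bound {κ Q : ℝ} (hW : D.WeightBound κ Q) {H : Set ℝ} (hH : H.OrdConnected) {u : ℂ}
    (hu : ‖u‖ ≤ 1) (n : ℕ) (w : Fin (n + 1) → ℕ) : ∃ M : ℝ, 0 ≤ M ∧ M ≤ Q * (κ ^ (n + 1))⁻¹ ∧
      M ≤ Q * D.leb.real (D.cyl (n + 1) w) ∧ ∀ φ : D.BV,
      ∫⁻ x, ‖D.wordFun H u n w φ x‖ₑ ∂D.leb + eVariationOn (D.wordFun H u n w φ) univ ≤
        ENNReal.ofReal (‖u‖ ^ (n + 1)) *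
          (ENNReal.ofReal M * eVariationOn φ (D.cyl (n + 1) w) + ENNReal.ofReal (Q + 2 * n + 5) *
            (ENNReal.ofReal M * ⨆ y ∈ D.cyl (n + 1) w, ‖φ y‖ₑ)) := by
  obtain ⟨M, hM0, hMa, hMb, hMc, hMd⟩ := hW.bound H hH u hu n w
  have hQ := hW.one_le
  refine ⟨M, hM0, hMa, hMb, fun φ => ?_⟩
  set S := D.cyl (n + 1) w with hS
  set N := ⨆ y ∈ S, ‖φ y‖ₑ with hN
  have hNy : ∀ y ∈ S, ‖φ y‖ₑ ≤ N := fun y hy => le_iSup₂ (f := fun y (_ : y ∈ S) => ‖φ y‖ₑ) y hy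
  have h1 : ∀ x, ‖D.wordFun H u n w φ x‖ₑ ≤ ENNReal.ofReal (‖u‖ ^ (n + 1) * M) * N := by
    intro x
    by_cases hx : x ∈ D.fX^[n + 1] '' S
    · obtain ⟨y, hy, rfl⟩ := hx
      rw [wordFun, branchOp_apply (D.injOn_cyl _ w) _ hy, enorm_mul]
      exact mul_le_mul' (hMc y hy) (hNy y hy)
    · rw [wordFun, branchOp_eq_zero _ hx]; simp
  have h2 := eVariationOn_branchOp_le (D.injOn_cyl (n + 1) w)
    (D.monotoneOn_or_antitoneOn_cyl (n + 1) w le_rfl) (D.ordConnected_image_cyl n w) hMc hMd hNy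
  refine (add_le_add (D.lintegral_le_of_enorm_le h1) h2).trans (le_of_eq ?_)
  -- Two units pay for the jumps at the ends of the image interval, one for the `L¹` part of the
  -- norm.
  have hc : (ENNReal.ofReal (Q + 2 * n + 5)) = ENNReal.ofReal (Q + 2 * (n + 1)) + 3 := by
    rw [show (3 : ℝ≥0∞) = ENNReal.ofReal 3 by simp, ← ENNReal.ofReal_add (by positivity) (by norm_num)]
    congr 1; ring
  rw [hc, ENNReal.ofReal_mul (by positivity), ENNReal.ofReal_mul (by positivity),
    ENNReal.ofReal_mul (by positivity)]
  ring

theorem wordFun_enorm_le {κ Q : ℝ} (hW : D.WeightBound κ Q) {H : Set ℝ} (hH : H.OrdConnected) {u : ℂ}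
    (hu : ‖u‖ ≤ 1) (n : ℕ) (w : Fin (n + 1) → ℕ) (φ : D.BV) :
      ∫⁻ x, ‖D.wordFun H u n w φ x‖ₑ ∂D.leb + eVariationOn (D.wordFun H u n w φ) univ ≤
        ENNReal.ofReal (‖u‖ ^ (n + 1) * (Q * (Q + 2 * n + 6))) *
          (ENNReal.ofReal ((κ ^ (n + 1))⁻¹) * eVariationOn φ (D.cyl (n + 1) w) +
            ∫⁻ y in D.cyl (n + 1) w, ‖φ y‖ₑ ∂D.leb) := by
  obtain ⟨M, hM0, hMa, hMb, hφ⟩ := wordFun_bound hW hH hu n w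
  have hQ := hW.one_le
  have hκ := hW.one_lt
  have hS := D.measurableSet_of_ordConnected (D.ordConnected_cyl (n + 1) w)
  refine (hφ φ).trans ?_
  rw [ENNReal.ofReal_mul (by positivity), mul_assoc]
  gcongr
  set V := eVariationOn φ (D.cyl (n + 1) w)
  set I := ∫⁻ y in D.cyl (n + 1) w, ‖φ y‖ₑ ∂D.leb
  have h6 : ENNReal.ofReal (Q + 2 * n + 6) = ENNReal.ofReal (Q + 2 * n + 5) + 1 := by
    rw [← ENNReal.ofReal_one, ← ENNReal.ofReal_add (by positivity) (by norm_num)]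
    congr 1; ring
  calc _ ≤ ENNReal.ofReal M * V + ENNReal.ofReal (Q + 2 * n + 5) *
        (ENNReal.ofReal M * V + ENNReal.ofReal Q * I) := by
        gcongr; exact sup_average_bound hS hM0 hMb φ
    _ ≤ ENNReal.ofReal (Q + 2 * n + 6) * (ENNReal.ofReal M * V + ENNReal.ofReal Q * I) := by
        rw [h6, add_mul, one_mul, add_comm]
        gcongr
        exact le_self_add
    _ ≤ ENNReal.ofReal (Q + 2 * n + 6) *
          (ENNReal.ofReal (Q * (κ ^ (n + 1))⁻¹) * V + ENNReal.ofReal Q * I) := by gcongr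
    _ = _ := by
        rw [ENNReal.ofReal_mul (by positivity), ENNReal.ofReal_mul (by positivity)]
        ring

theorem exists_wordOp {κ Q : ℝ} (hW : D.WeightBound κ Q) {H : Set ℝ} (hH : H.OrdConnected) {u : ℂ}
    (hu : ‖u‖ ≤ 1) (n : ℕ) (w : Fin (n + 1) → ℕ) : ∃ A : D.BV →L[ℂ] D.BV,
      (∀ φ : D.BV, (A φ : D.X → ℂ) = D.wordFun H u n w φ) ∧
      ‖A‖ ≤ (Q + 2 * n + 6) * Q * D.leb.real (D.cyl (n + 1) w) := by
  obtain ⟨M, hM0, -, hMb, hφ⟩ := wordFun_bound hW hH hu n w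
  have hQ := hW.one_le
  refine D.exists_clm_of_enorm_bound (D.wordFun H u n w) (fun _ _ => branchOp_add _ _)
    (fun _ _ => branchOp_smul _ _) (by positivity) fun φ => (hφ φ).trans ?_
  have h1 : ENNReal.ofReal (‖u‖ ^ (n + 1)) ≤ 1 := by
    rw [ENNReal.ofReal_le_one]
    exact pow_le_one₀ (norm_nonneg _) hu
  have h2 : (⨆ y ∈ D.cyl (n + 1) w, ‖φ y‖ₑ) ≤ ‖φ‖ₑ := iSup₂_le fun y _ => D.enorm_apply_le φ y
  calc _ ≤ 1 * (ENNReal.ofReal M * ‖φ‖ₑ + ENNReal.ofReal (Q + 2 * n + 5) *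
        (ENNReal.ofReal M * ‖φ‖ₑ)) := by
        gcongr
        exact D.eVariationOn_le_enorm φ _
    _ = ENNReal.ofReal ((Q + 2 * n + 6) * M) * ‖φ‖ₑ := by
        rw [one_mul, ← mul_assoc, ← ENNReal.ofReal_mul (by positivity), ← add_mul,
          ← ENNReal.ofReal_add (by positivity) (by positivity)]
        congr 2; ring
    _ ≤ _ := by
        rw [mul_assoc]
        gcongr

end YoungBase

/-! ### The operators as sums over words, and the uniform Lasota–Yorke inequalities. -/

namespace YoungBase

variable {D : YoungBase}

theorem measurableSet_cyl (n : ℕ) (w : Fin n → ℕ) : MeasurableSet (D.cyl n w) :=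
  D.measurableSet_of_ordConnected (D.ordConnected_cyl n w)

theorem summable_leb_cyl (n : ℕ) : Summable fun w : Fin n → ℕ => D.leb.real (D.cyl n w) := by
  refine ENNReal.summable_toReal ?_
  rw [← measure_iUnion (fun w w' h => D.disjoint_cyl h) fun w => measurableSet_cyl n w]
  exact measure_ne_top _ _

theorem cyl_one (v : Fin 1 → ℕ) : D.cyl 1 v = D.cell (v 0) := by
  ext x
  simp [cyl, cell]

theorem tsum_leb_cyl_one_le (I : Set (Fin 1 → ℕ)) {s : Set D.X} (hs : ∀ v ∈ I, D.cyl 1 v ⊆ s) :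
    ∑' v, I.indicator (fun v => D.leb.real (D.cyl 1 v)) v ≤ D.leb.real s := by
  have h1 : ∑' v : I, D.leb (D.cyl 1 v) ≤ D.leb s := by
    rw [← measure_iUnion (fun v w h => D.disjoint_cyl (Subtype.coe_ne_coe.2 h))
      fun v => measurableSet_cyl 1 _]
    exact measure_mono (iUnion_subset fun v => hs v v.2)
  rw [← tsum_subtype]
  unfold Measure.real
  rw [← ENNReal.tsum_toReal_eq fun v => measure_ne_top _ _]
  exact ENNReal.toReal_mono (measure_ne_top _ _) h1

theorem wtN_one (H : Set ℝ) (u : ℂ) : D.wtN H u 1 = D.wt H u := by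
  ext y
  simp [wtN]

/-- Each cell contains at most one preimage of `x`, so the fibre embeds in the set of words of
length one, and the branches that miss `x` contribute zero. -/
theorem openT_eq_tsum (H : Set ℝ) (u : ℂ) (ψ : D.X → ℂ) (x : D.X) :
    D.openT H (fun y => u ^ D.R y * ψ y) x = ∑' v : Fin 1 → ℕ, D.wordFun H u 0 v ψ x := by
  choose i hi using fun y : D.fibre x => mem_iUnion.1 y.2.1
  have hcell : ∀ y : D.fibre x, y.1 ∈ D.cyl 1 fun _ => i y := fun y => by
    rw [cyl_one]; exact hi y
  have hinj : Function.Injective fun (y : D.fibre x) (_ : Fin 1) => i y := by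
    intro y y' h
    have h1 : i y = i y' := congrFun h 0
    refine Subtype.ext (D.injOn_cell (i y) (hi y) ?_ (y.2.2.trans y'.2.2.symm))
    rw [h1]
    exact hi y'
  have hsupp : (Function.support fun v : Fin 1 → ℕ => D.wordFun H u 0 v ψ x) ⊆
      Set.range fun (y : D.fibre x) (_ : Fin 1) => i y := by
    intro v hv
    by_cases hx : x ∈ D.fX^[0 + 1] '' D.cyl 1 v
    · obtain ⟨y, hy, hyx⟩ := hx
      rw [cyl_one] at hy
      refine ⟨⟨y, mem_iUnion.2 ⟨v 0, hy⟩, hyx⟩, ?_⟩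
      ext j
      rw [Subsingleton.elim j 0]
      by_contra hne
      exact Set.disjoint_left.1 (D.disjoint_cell hne) (hi _) hy
    · exact absurd (branchOp_eq_zero _ hx) hv
  rw [← hinj.tsum_eq hsupp]
  refine tsum_congr fun y => ?_
  have h2 : D.fX^[0 + 1] y.1 = x := y.2.2
  rw [wordFun]
  conv_rhs => rw [← h2]
  rw [branchOp_apply (D.injOn_cyl 1 _) _ (hcell y), wtN_one, wt]
  ring

theorem norm_wordOp_le {κ Q : ℝ} (hW : D.WeightBound κ Q) {H : Set ℝ} (hH : H.OrdConnected) {u : ℂ}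
    (hu : ‖u‖ ≤ 1) {n : ℕ} {w : Fin (n + 1) → ℕ} {A : D.BV →L[ℂ] D.BV}
    (hA : ∀ φ : D.BV, (A φ : D.X → ℂ) = D.wordFun H u n w φ) :
    ‖A‖ ≤ (Q + 2 * n + 6) * Q * D.leb.real (D.cyl (n + 1) w) := by
  obtain ⟨B, hB, h⟩ := exists_wordOp hW hH hu n w
  have : A = B := ContinuousLinearMap.ext fun φ => Subtype.ext ((hA φ).trans (hB φ).symm)
  rwa [this]

theorem summable_norm_wordOp {κ Q : ℝ} (hW : D.WeightBound κ Q) {H : Set ℝ} (hH : H.OrdConnected)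
    {u : ℂ} (hu : ‖u‖ ≤ 1) {n : ℕ} {op : (Fin (n + 1) → ℕ) → D.BV →L[ℂ] D.BV}
    (hop : ∀ w φ, (op w φ : D.X → ℂ) = D.wordFun H u n w φ) : Summable fun w => ‖op w‖ :=
  Summable.of_nonneg_of_le (fun _ => norm_nonneg _) (fun w => norm_wordOp_le hW hH hu (hop w))
    ((summable_leb_cyl (n + 1)).mul_left _)

theorem isRop_tsum {κ Q : ℝ} (hW : D.WeightBound κ Q) {H : Set ℝ} (hH : H.OrdConnected)
    {u : ℂ} (hu : ‖u‖ ≤ 1) {op : (Fin 1 → ℕ) → D.BV →L[ℂ] D.BV}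
    (hop : ∀ w φ, (op w φ : D.X → ℂ) = D.wordFun H u 0 w φ) : D.IsRop H u (∑' v, op v) := by
  intro φ
  ext x
  have h := (summable_norm_wordOp hW hH hu hop).of_norm.hasSum
  have h1 : HasSum (fun v => op v φ x) ((∑' v, op v) φ x) :=
    ((D.evalL x).hasSum ((ContinuousLinearMap.apply ℂ D.BV φ).hasSum h))
  rw [openT_eq_tsum, ← h1.tsum_eq]
  exact tsum_congr fun v => congrFun (hop v φ) x

theorem IsRop.unique {H : Set ℝ} {u : ℂ} {A B : D.BV →L[ℂ] D.BV} (hA : D.IsRop H u A)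
    (hB : D.IsRop H u B) : A = B :=
  ContinuousLinearMap.ext fun φ => Subtype.ext ((hA φ).trans (hB φ).symm)

theorem isRop_Rop {κ Q : ℝ} (hW : D.WeightBound κ Q) {H : Set ℝ} (hH : H.OrdConnected) {u : ℂ}
    (hu : ‖u‖ ≤ 1) : D.IsRop H u (D.Rop H u) := by
  choose op hop _ using exists_wordOp hW hH hu 0
  have h : ∃ A, D.IsRop H u A := ⟨_, isRop_tsum hW hH hu hop⟩
  rw [Rop, dif_pos h]
  exact h.choose_spec

theorem wordFun_cons (H : Set ℝ) (u : ℂ) (n : ℕ) (v : Fin 1 → ℕ) (w : Fin (n + 1) → ℕ)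
    (ψ : D.X → ℂ) : D.wordFun H u n w (D.wordFun H u 0 v ψ) =
      D.wordFun H u (n + 1) (Fin.cons (v 0) w : Fin (n + 2) → ℕ) ψ := by
  have h1 : D.cyl (n + 1 + 1) (Fin.cons (v 0) w : Fin (n + 2) → ℕ) =
      D.cyl (0 + 1) v ∩ D.fX^[0 + 1] ⁻¹' D.cyl (n + 1) w := by
    rw [cyl_succ, Fin.tail_cons, Fin.cons_zero, ← cyl_one]
    rfl
  have h2 : D.wtN H u (n + 1 + 1) =
      fun y => D.wtN H u (n + 1) (D.fX^[0 + 1] y) * D.wtN H u (0 + 1) y := by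
    ext y
    rw [wtN_succ, zero_add, wtN_one]
    rfl
  rw [wordFun, wordFun, branchOp_comp (D.injOn_cyl _ v) (D.injOn_cyl _ w), wordFun, h1, h2]
  rfl

/-- The norm of a branch operator is at most a multiple of the measure of its cylinder, so the
series converges absolutely in operator norm and products of such series may be rearranged over
pairs of words. -/
theorem hasSum_wordOp {κ Q : ℝ} (hW : D.WeightBound κ Q) {H : Set ℝ} (hH : H.OrdConnected) {u : ℂ}
    (hu : ‖u‖ ≤ 1) (n : ℕ) {op : (Fin (n + 1) → ℕ) → D.BV →L[ℂ] D.BV}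
    (hop : ∀ w φ, (op w φ : D.X → ℂ) = D.wordFun H u n w φ) : HasSum op (D.Rop H u ^ (n + 1)) := by
  have h0 : ∀ {op : (Fin 1 → ℕ) → D.BV →L[ℂ] D.BV},
      (∀ w φ, (op w φ : D.X → ℂ) = D.wordFun H u 0 w φ) → HasSum op (D.Rop H u) := by
    intro op hop
    rw [(isRop_Rop hW hH hu).unique (isRop_tsum hW hH hu hop)]
    exact (summable_norm_wordOp hW hH hu hop).of_norm.hasSum
  induction n with
  | zero =>
    have h1 := h0 hop
    rwa [← pow_one (D.Rop H u)] at h1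
  | succ n ih =>
    choose op₁ hop₁ _ using exists_wordOp hW hH hu n
    choose op₀ hop₀ _ using exists_wordOp hW hH hu 0
    have h1 := ih hop₁
    have h2 := h0 hop₀
    have h3 := h1.mul h2 (summable_mul_of_summable_norm (summable_norm_wordOp hW hH hu hop₁)
      (summable_norm_wordOp hW hH hu hop₀))
    rw [← pow_succ] at h3
    -- In the product the one-letter branch acts first, so its letter goes in front of the word.
    let e : (Fin (n + 1) → ℕ) × (Fin 1 → ℕ) ≃ (Fin (n + 2) → ℕ) :=
      (Equiv.prodComm _ _).trans (((Equiv.funUnique (Fin 1) ℕ).prodCongr (Equiv.refl _)).trans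
        (Fin.consEquiv fun _ => ℕ))
    rw [← e.hasSum_iff]
    have h4 : op ∘ e = fun x => op₁ x.1 * op₀ x.2 := by
      funext ⟨w, v⟩
      refine ContinuousLinearMap.ext fun φ => Subtype.ext ?_
      change (op (Fin.cons (v 0) w) φ : D.X → ℂ) = (op₁ w (op₀ v φ) : D.X → ℂ)
      rw [hop, hop₁, hop₀, wordFun_cons]
    rwa [h4]

/-- Summation of the branch estimates: variations and integrals over the disjoint cylinders add up
to at most the global ones. -/
theorem enorm_Rop_pow_le {κ Q : ℝ} (hW : D.WeightBound κ Q) {H : Set ℝ} (hH : H.OrdConnected)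
    {u : ℂ} (hu : ‖u‖ ≤ 1) (n : ℕ) (φ : D.BV) : ‖(D.Rop H u ^ (n + 1)) φ‖ₑ ≤
      ENNReal.ofReal (‖u‖ ^ (n + 1) * (Q * (Q + 2 * n + 6))) *
        (ENNReal.ofReal ((κ ^ (n + 1))⁻¹) * eVariationOn φ univ + ∫⁻ y, ‖φ y‖ₑ ∂D.leb) := by
  choose op hop _ using exists_wordOp hW hH hu n
  have h1 : HasSum (fun w => op w φ) ((D.Rop H u ^ (n + 1)) φ) :=
    (ContinuousLinearMap.apply ℂ D.BV φ).hasSum (hasSum_wordOp hW hH hu n hop)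
  rw [← h1.tsum_eq]
  refine enorm_tsum_le_tsum_enorm.trans ?_
  calc ∑' w, ‖op w φ‖ₑ
      ≤ ∑' w, ENNReal.ofReal (‖u‖ ^ (n + 1) * (Q * (Q + 2 * n + 6))) *
          (ENNReal.ofReal ((κ ^ (n + 1))⁻¹) * eVariationOn φ (D.cyl (n + 1) w) +
            ∫⁻ y in D.cyl (n + 1) w, ‖φ y‖ₑ ∂D.leb) := by
        refine ENNReal.tsum_le_tsum fun w => ?_
        rw [enorm_BV, hop]
        exact wordFun_enorm_le hW hH hu n w φ
    _ ≤ _ := by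
        rw [ENNReal.tsum_mul_left, ENNReal.tsum_add, ENNReal.tsum_mul_left]
        gcongr
        · exact tsum_eVariationOn_le _ _ (fun w => D.ordConnected_cyl _ w)
            fun w w' h => D.disjoint_cyl h
        · rw [← lintegral_iUnion (fun w => measurableSet_cyl _ w)
            fun w w' h => D.disjoint_cyl h]
          exact setLIntegral_le_lintegral _ _

/-- The change of variables formula on one cell. -/
theorem lintegral_image_cell (i : ℕ) (g : D.X → ℝ≥0∞) :
    ∫⁻ x in D.fX '' D.cell i, g x ∂D.leb =
      ∫⁻ y in D.cell i, ENNReal.ofReal |D.df y| * g (D.fX y) ∂D.leb := by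
  -- The change of variables formula is applied on the line, so `g` is extended by zero; its values
  -- off the base never enter.
  set G := Function.extend ((↑) : D.X → ℝ) g 0 with hG
  have hGx : ∀ x : D.X, G x = g x := fun x => Subtype.val_injective.extend_apply g 0 x
  have h := lintegral_image_eq_lintegral_abs_deriv_mul (D.P_ordConnected i).measurableSet
    (D.hasDeriv i) (D.f_injOn i) G
  rw [← D.image_coe_fX i, ← D.image_coe_cell i] at h
  simp only [leb, normalizedLebesgue, Measure.restrict_smul, lintegral_smul_measure]
  congr 1
  have h1 := setLIntegral_subtype D.measurableSet_X (D.fX '' D.cell i) (μ := volume) G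
  have h2 := setLIntegral_subtype D.measurableSet_X (D.cell i) (μ := volume)
    (fun y => ENNReal.ofReal |D.df y| * G (D.f y))
  simp only [hGx] at h1
  rw [h1, h, ← h2]
  refine lintegral_congr fun y => ?_
  rw [← hGx, coe_fX]

theorem setIntegral_comap (t : Set D.X) (G : ℝ → ℂ) :
    ∫ x in t, G x ∂(Measure.comap ((↑) : D.X → ℝ) volume) =
      ∫ x in ((↑) : D.X → ℝ) '' t, G x := by
  have h := (MeasurableEmbedding.subtype_coe D.measurableSet_X).setIntegral_map
    (μ := Measure.comap ((↑) : D.X → ℝ) volume) G (((↑) : D.X → ℝ) '' t)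
  rw [preimage_image_eq _ Subtype.val_injective, map_comap_subtype_coe D.measurableSet_X,
    Measure.restrict_restrict_of_subset (by rintro _ ⟨x, -, rfl⟩; exact x.2)] at h
  exact h.symm

theorem integral_image_cell (i : ℕ) (g : D.X → ℂ) :
    ∫ x in D.fX '' D.cell i, g x ∂D.leb =
      ∫ y in D.cell i, |D.df y| • g (D.fX y) ∂D.leb := by
  set G := Function.extend ((↑) : D.X → ℝ) g 0 with hG
  have hGx : ∀ x : D.X, G x = g x := fun x => Subtype.val_injective.extend_apply g 0 x
  have h := integral_image_eq_integral_abs_deriv_smul (D.P_ordConnected i).measurableSet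
    (D.hasDeriv i) (D.f_injOn i) G
  rw [← D.image_coe_fX i, ← D.image_coe_cell i, ← setIntegral_comap,
    ← setIntegral_comap (G := fun y => |D.df y| • G (D.f y))] at h
  simp only [leb, normalizedLebesgue, Measure.restrict_smul, integral_smul_measure]
  congr 1
  simp only [hGx] at h
  rw [h]
  refine integral_congr_ae (Filter.Eventually.of_forall fun y => ?_)
  simp only [← hGx, coe_fX]

theorem wordFun_image {H : Set ℝ} {u : ℂ} {v : Fin 1 → ℕ} (ψ : D.X → ℂ) {y : D.X}
    (hy : y ∈ D.cell (v 0)) : D.wordFun H u 0 v ψ (D.fX y) = D.wt H u y * ψ y := by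
  rw [← cyl_one] at hy
  change branchOp (D.cyl 1 v) D.fX^[1] (D.wtN H u 1) ψ (D.fX^[1] y) = _
  rw [branchOp_apply (D.injOn_cyl 1 v) ψ hy, wtN_one]

theorem wordFun_eq_zero {H : Set ℝ} {u : ℂ} {v : Fin 1 → ℕ} (ψ : D.X → ℂ) {x : D.X}
    (hx : x ∉ D.fX '' D.cell (v 0)) : D.wordFun H u 0 v ψ x = 0 := by
  rw [← cyl_one] at hx
  exact branchOp_eq_zero ψ hx

theorem abs_df_mul_wt {H : Set ℝ} {u : ℂ} {i : ℕ} {y : D.X} (hy : y ∈ D.cell i) :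
    ((|D.df y| : ℝ) : ℂ) * D.wt H u y = D.survive H y * u ^ D.R y := by
  have h : ((|D.df y| : ℝ) : ℂ) ≠ 0 := by
    exact_mod_cast abs_ne_zero.2 (D.df_ne_zero hy)
  rw [wt, mul_div_cancel₀ _ h]

theorem lintegral_wordFun_le (H : Set ℝ) {u : ℂ} (hu : ‖u‖ ≤ 1) (v : Fin 1 → ℕ) (ψ : D.X → ℂ) :
    ∫⁻ x, ‖D.wordFun H u 0 v ψ x‖ₑ ∂D.leb ≤ ‖u‖ₑ * ∫⁻ y in D.cell (v 0), ‖ψ y‖ₑ ∂D.leb := by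
  have hm := D.measurableSet_of_ordConnected (D.ordConnected_image_cell (v 0))
  have hc := D.measurableSet_of_ordConnected (D.ordConnected_cell (v 0))
  have h1 : ∫⁻ x, ‖D.wordFun H u 0 v ψ x‖ₑ ∂D.leb =
      ∫⁻ x in D.fX '' D.cell (v 0), ‖D.wordFun H u 0 v ψ x‖ₑ ∂D.leb := by
    rw [← lintegral_indicator hm]
    refine lintegral_congr fun x => ?_
    by_cases hx : x ∈ D.fX '' D.cell (v 0)
    · rw [indicator_of_mem hx]
    · rw [indicator_of_notMem hx, wordFun_eq_zero ψ hx, enorm_zero]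
  rw [h1, lintegral_image_cell, ← lintegral_const_mul' _ _ enorm_ne_top]
  refine setLIntegral_mono' hc fun y hy => ?_
  have h2 : ENNReal.ofReal |D.df y| = ‖((|D.df y| : ℝ) : ℂ)‖ₑ := by
    rw [← ofReal_norm, Complex.norm_real, Real.norm_eq_abs, abs_abs]
  rw [wordFun_image ψ hy, h2, ← enorm_mul, ← mul_assoc, abs_df_mul_wt hy, enorm_mul, enorm_mul]
  gcongr
  calc ‖D.survive H y‖ₑ * ‖u ^ D.R y‖ₑ ≤ 1 * ‖u‖ₑ := by
        gcongr
        · exact D.enorm_survive_le H y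
        · rw [← ofReal_norm, ← ofReal_norm, norm_pow]
          exact ENNReal.ofReal_le_ofReal
            (pow_le_of_le_one (norm_nonneg _) hu (by have := D.R_pos_cell hy; omega))
    _ = _ := one_mul _

theorem Rop_apply_eq_tsum {κ Q : ℝ} (hW : D.WeightBound κ Q) {H : Set ℝ} (hH : H.OrdConnected)
    {u : ℂ} (hu : ‖u‖ ≤ 1) (φ : D.BV) (x : D.X) :
    D.Rop H u φ x = ∑' v, D.wordFun H u 0 v φ x := by
  rw [isRop_Rop hW hH hu φ, openT_eq_tsum]

theorem lintegral_Rop_le {κ Q : ℝ} (hW : D.WeightBound κ Q) {H : Set ℝ} (hH : H.OrdConnected)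
    {u : ℂ} (hu : ‖u‖ ≤ 1) (φ : D.BV) :
    ∫⁻ x, ‖D.Rop H u φ x‖ₑ ∂D.leb ≤ ‖u‖ₑ * ∫⁻ x, ‖φ x‖ₑ ∂D.leb := by
  choose op hop _ using exists_wordOp hW hH hu 0
  calc ∫⁻ x, ‖D.Rop H u φ x‖ₑ ∂D.leb
      ≤ ∫⁻ x, ∑' v, ‖D.wordFun H u 0 v φ x‖ₑ ∂D.leb := by
        refine lintegral_mono fun x => ?_
        rw [Rop_apply_eq_tsum hW hH hu]
        exact enorm_tsum_le_tsum_enorm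
    _ = ∑' v, ∫⁻ x, ‖D.wordFun H u 0 v φ x‖ₑ ∂D.leb := by
        refine lintegral_tsum fun v => ?_
        rw [← hop v φ]
        exact (D.measurable_BV _).enorm.aemeasurable
    _ ≤ ∑' v : Fin 1 → ℕ, ‖u‖ₑ * ∫⁻ y in D.cell (v 0), ‖φ y‖ₑ ∂D.leb :=
        ENNReal.tsum_le_tsum fun v => lintegral_wordFun_le H hu v φ
    _ ≤ _ := by
        rw [ENNReal.tsum_mul_left]
        gcongr
        simp only [← cyl_one]
        rw [← lintegral_iUnion (fun w => measurableSet_cyl _ w) fun w w' h => D.disjoint_cyl h]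
        exact setLIntegral_le_lintegral _ _

variable (D) in
/-- The `L¹`-norm, as a seminorm on the functions of bounded variation. -/
noncomputable def nu : Seminorm ℂ D.BV :=
  Seminorm.of (fun φ => ∫ x, ‖φ x‖ ∂D.leb)
    (fun φ ψ => by
      rw [← integral_add φ.2.2.norm ψ.2.2.norm]
      exact integral_mono (φ + ψ).2.2.norm (φ.2.2.norm.add ψ.2.2.norm) fun x => norm_add_le _ _)
    (fun c φ => by
      rw [← integral_const_mul]
      exact integral_congr_ae (Filter.Eventually.of_forall fun x => norm_mul c (φ x)))

theorem nu_apply (φ : D.BV) : D.nu φ = ∫ x, ‖φ x‖ ∂D.leb := rfl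

theorem ofReal_nu (φ : D.BV) : ENNReal.ofReal (D.nu φ) = ∫⁻ x, ‖φ x‖ₑ ∂D.leb :=
  ofReal_integral_norm_eq_lintegral_enorm φ.2.2

theorem nu_le_norm (φ : D.BV) : D.nu φ ≤ ‖φ‖ := by
  rw [norm_def]
  exact le_add_of_nonneg_right ENNReal.toReal_nonneg

theorem nu_Rop_le {κ Q : ℝ} (hW : D.WeightBound κ Q) {H : Set ℝ} (hH : H.OrdConnected)
    {u : ℂ} (hu : ‖u‖ ≤ 1) (φ : D.BV) : D.nu (D.Rop H u φ) ≤ ‖u‖ * D.nu φ := by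
  have h := lintegral_Rop_le hW hH hu φ
  rw [← ofReal_nu, ← ofReal_nu, ← ofReal_norm, ← ENNReal.ofReal_mul (norm_nonneg _)] at h
  exact (ENNReal.ofReal_le_ofReal_iff (mul_nonneg (norm_nonneg _) (apply_nonneg _ _))).1 h

theorem norm_Rop_pow_le {κ Q : ℝ} (hW : D.WeightBound κ Q) {H : Set ℝ} (hH : H.OrdConnected)
    {u : ℂ} (hu : ‖u‖ ≤ 1) (n : ℕ) (φ : D.BV) : ‖(D.Rop H u ^ (n + 1)) φ‖ ≤
      ‖u‖ ^ (n + 1) * (Q * (Q + 2 * n + 6)) * ((κ ^ (n + 1))⁻¹ * ‖φ‖ + D.nu φ) := by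
  have h := enorm_Rop_pow_le hW hH hu n φ
  have hQ := hW.one_le
  have hκ := hW.one_lt
  have h1 : ‖(D.Rop H u ^ (n + 1)) φ‖ₑ ≤
      ENNReal.ofReal (‖u‖ ^ (n + 1) * (Q * (Q + 2 * n + 6))) *
        (ENNReal.ofReal ((κ ^ (n + 1))⁻¹) * ‖φ‖ₑ + ∫⁻ y, ‖φ y‖ₑ ∂D.leb) := by
    refine h.trans ?_
    gcongr
    exact D.eVariationOn_le_enorm φ univ
  have h2 := apply_nonneg D.nu φ
  rw [← ofReal_nu, ← ofReal_norm, ← ofReal_norm, ← ENNReal.ofReal_mul (by positivity),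
    ← ENNReal.ofReal_add (by positivity) h2, ← ENNReal.ofReal_mul (by positivity)] at h1
  exact (ENNReal.ofReal_le_ofReal_iff (by positivity)).1 h1

variable (D) in
theorem exists_weightBound : ∃ κ Q : ℝ, D.WeightBound κ Q := by
  obtain ⟨κ, Q, h1, h2, h3, h4⟩ := D.exists_weight_bound
  exact ⟨κ, Q, h1, h2, h3, h4⟩

theorem exists_uniform_lasotaYorke {κ Q : ℝ} (hW : D.WeightBound κ Q) :
    ∃ C : ℝ, 1 ≤ C ∧ ∀ H : Set ℝ, H.OrdConnected → ∀ u : ℂ, ‖u‖ ≤ 1 → ∀ (n : ℕ) (φ : D.BV),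
      ‖(D.Rop H u ^ n) φ‖ ≤ ‖u‖ ^ n * (C * D.θ ^ n * ‖φ‖ + C * D.nu φ) := by
  have hQ := hW.one_le
  have hκ := hW.one_lt
  obtain ⟨hθ, hθ1⟩ := D.θ_mem
  have hr1 : (D.θ * κ)⁻¹ < 1 := inv_lt_one_of_one_lt₀ hW.one_lt_mul
  have hr0 : 0 ≤ (D.θ * κ)⁻¹ := by positivity
  -- The prefactor grows linearly in the number of steps, whereas `(θκ)^{-m}` decays exponentially.
  -- Some `m` therefore gives `C₀ κ^{-m} ≤ θ^m`, which is a contraction with rate exactly `θ`.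
  have ht := ((tendsto_self_mul_const_pow_of_lt_one hr0 hr1).const_mul (Q * (Q + 6)))
  rw [mul_zero] at ht
  obtain ⟨m, hm, hm1⟩ := ((ht.eventually_lt_const one_pos).and (Filter.eventually_ge_atTop 1)).exists
  obtain ⟨n, rfl⟩ : ∃ n, m = n + 1 := ⟨m - 1, by omega⟩
  set C₀ := Q * (Q + 2 * n + 6) with hC₀
  have hC₀' : C₀ * (κ ^ (n + 1))⁻¹ ≤ D.θ ^ (n + 1) := by
    have h1 : C₀ ≤ Q * (Q + 6) * (n + 1) := by
      rw [hC₀, mul_assoc]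
      gcongr
      nlinarith [(Nat.cast_nonneg n : (0 : ℝ) ≤ n)]
    have h2 : C₀ * ((D.θ * κ)⁻¹) ^ (n + 1) ≤ 1 := by
      refine le_trans ?_ hm.le
      push_cast
      rw [← mul_assoc]
      gcongr
    rw [mul_inv, mul_pow, inv_pow, inv_pow] at h2
    have h3 : 0 < D.θ ^ (n + 1) := by positivity
    calc C₀ * (κ ^ (n + 1))⁻¹ =
          D.θ ^ (n + 1) * (C₀ * ((D.θ ^ (n + 1))⁻¹ * (κ ^ (n + 1))⁻¹)) := by
          field_simp
      _ ≤ D.θ ^ (n + 1) * 1 := by gcongr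
      _ = _ := mul_one _
  -- Crude one-step bound: the weak norm is estimated by the strong one, hence the factor `2`.
  set M := Q * (Q + 6) * 2 with hM
  have hM1 : 1 ≤ M := by nlinarith
  refine ⟨max ((M / D.θ) ^ (n + 1)) (C₀ / (1 - D.θ ^ (n + 1))), ?_, fun H hH u hu k φ => ?_⟩
  · refine le_max_of_le_left (one_le_pow₀ ?_)
    rw [one_le_div hθ]
    linarith
  have hmain := lasotaYorke_iterate (ν := D.nu) (A := D.Rop H u) (t := ‖u‖) (θ := D.θ) (M := M)
    (C := C₀) (m := n + 1) (norm_nonneg _) hθ hθ1 hm1 hM1 (by positivity)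
    (nu_Rop_le hW hH hu) (fun ψ => ?_) (fun ψ => ?_) k φ
  · refine hmain.trans ?_
    have := apply_nonneg D.nu φ
    gcongr
    · exact le_max_left _ _
    · exact le_max_right _ _
  · have h := norm_Rop_pow_le hW hH hu 0 ψ
    have h2 : κ⁻¹ ≤ 1 := inv_le_one_of_one_le₀ hκ.le
    simp only [zero_add, pow_one, Nat.cast_zero, mul_zero, add_zero] at h
    calc _ ≤ _ := h
      _ ≤ ‖u‖ * (Q * (Q + 6)) * (1 * ‖ψ‖ + ‖ψ‖) := by
        gcongr
        exact nu_le_norm ψ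
      _ = _ := by rw [hM]; ring
  · have h := norm_Rop_pow_le hW hH hu n ψ
    have := apply_nonneg D.nu ψ
    calc _ ≤ _ := h
      _ = ‖u‖ ^ (n + 1) * (C₀ * (κ ^ (n + 1))⁻¹ * ‖ψ‖ + C₀ * D.nu ψ) := by rw [hC₀]; ring
      _ ≤ _ := by gcongr

/-- Cutting off at `R ≥ b` selects whole cells, so the image is a subseries of the branch series
even though the cutoff itself may have infinite variation. The branch norms are proportional to the
measures of the cells, which sum to the tail; this is the source of the factor `μ(R ≥ b)`. -/
theorem openT_cutoff {κ Q : ℝ} (hW : D.WeightBound κ Q) {H : Set ℝ} (hH : H.OrdConnected)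
    {h : D.X → ℝ} (hB : D.BV) (hh : ∀ x, hB x = h x) (b : ℕ) :
    ∃ χ : D.BV, (χ : D.X → ℂ) = D.openT H (D.cutoff h b) ∧
      ‖χ‖ ≤ (Q + 6) * Q * ‖hB‖ * D.leb.real {x : D.X | b ≤ D.R x} := by
  choose op hop hopn using exists_wordOp hW hH (u := 1) (by simp) 0
  have hQ := hW.one_le
  set I : Set (Fin 1 → ℕ) := {v | ∃ y ∈ D.cell (v 0), b ≤ D.R y} with hI
  have hIs : ∀ v ∈ I, D.cyl 1 v ⊆ {x : D.X | b ≤ D.R x} := by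
    rintro v ⟨y, hy, hb⟩ x hx
    rw [cyl_one] at hx
    change b ≤ D.R x
    rwa [D.R_const (v 0) x hx y hy]
  have hle : ∀ v, ‖I.indicator op v‖ ≤
      (Q + 6) * Q * I.indicator (fun v => D.leb.real (D.cyl 1 v)) v := by
    intro v
    by_cases hv : v ∈ I
    · rw [indicator_of_mem hv, indicator_of_mem hv]
      simpa using hopn v
    · simp [indicator_of_notMem hv]
  have hsum : Summable fun v => (Q + 6) * Q * I.indicator (fun v => D.leb.real (D.cyl 1 v)) v :=
    ((summable_leb_cyl 1).indicator I).mul_left _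
  have hsn := Summable.of_nonneg_of_le (fun _ => norm_nonneg _) hle hsum
  refine ⟨(∑' v, I.indicator op v) hB, ?_, ?_⟩
  · ext x
    have h1 : HasSum (fun v => I.indicator op v hB x) ((∑' v, I.indicator op v) hB x) :=
      (D.evalL x).hasSum ((ContinuousLinearMap.apply ℂ D.BV hB).hasSum hsn.of_norm.hasSum)
    have h2 := openT_eq_tsum H 1 (D.cutoff h b) x
    simp only [one_pow, one_mul] at h2
    rw [h2, ← h1.tsum_eq]
    refine tsum_congr fun v => ?_
    by_cases hx : x ∈ D.fX '' D.cell (v 0)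
    · obtain ⟨y, hy, rfl⟩ := hx
      rw [wordFun_image _ hy, cutoff]
      by_cases hv : v ∈ I
      · have : b ≤ D.R y := hIs v hv (by rwa [cyl_one])
        rw [indicator_of_mem hv, hop, wordFun_image _ hy, if_pos this, hh]
      · have : ¬ b ≤ D.R y := fun hb => hv ⟨y, hy, hb⟩
        rw [indicator_of_notMem hv, if_neg this, mul_zero]
        rfl
    · rw [wordFun_eq_zero _ hx]
      by_cases hv : v ∈ I
      · rw [indicator_of_mem hv, hop, wordFun_eq_zero _ hx]
      · rw [indicator_of_notMem hv]; rfl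
  · calc _ ≤ ‖∑' v, I.indicator op v‖ * ‖hB‖ := ContinuousLinearMap.le_opNorm _ _
      _ ≤ ((Q + 6) * Q * D.leb.real {x : D.X | b ≤ D.R x}) * ‖hB‖ := by
        gcongr
        refine (norm_tsum_le_tsum_norm hsn).trans ((hsn.tsum_le_tsum hle hsum).trans ?_)
        rw [tsum_mul_left]
        gcongr
        exact tsum_leb_cyl_one_le I hIs
      _ = _ := by ring

end YoungBase

/-! ### Duality, and `1` as a spectral value. -/

namespace YoungBase

variable {D : YoungBase}

theorem ae_mem_iUnion_cell : ∀ᵐ x ∂D.leb, x ∈ ⋃ v : Fin 1 → ℕ, D.cyl 1 v := by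
  rw [ae_iff, leb_apply]
  have h : ((↑) : D.X → ℝ) '' {x | x ∉ ⋃ v : Fin 1 → ℕ, D.cyl 1 v} ⊆ D.X \ ⋃ i, D.P i := by
    rintro _ ⟨x, hx, rfl⟩
    refine ⟨x.2, fun hx' => hx ?_⟩
    obtain ⟨i, hi⟩ := mem_iUnion.1 hx'
    refine mem_iUnion.2 ⟨fun _ => i, ?_⟩
    rw [cyl_one]
    exact hi
  rw [measure_mono_null h D.P_cover, mul_zero]

/-- Nothing is known about `f` off the cells; on each cell it is monotone, and the cells have full
measure. -/
theorem aemeasurable_fX : AEMeasurable D.fX D.leb := by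
  have hc : ∀ v, MeasurableSet (D.cyl 1 v) := fun v => measurableSet_cyl 1 v
  refine (MeasurableEmbedding.subtype_coe D.measurableSet_X).aemeasurable_comp_iff.1 ?_
  rw [← Measure.restrict_eq_self_of_ae_mem (ae_mem_iUnion_cell (D := D)), aemeasurable_iUnion_iff]
  intro v
  rcases D.monotoneOn_or_antitoneOn_cyl 1 v le_rfl with h | h
  · exact aemeasurable_restrict_of_monotoneOn (hc v) fun x hx y hy hxy => h hx hy hxy
  · exact aemeasurable_restrict_of_antitoneOn (hc v) fun x hx y hy hxy => h hx hy hxy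

theorem integral_mul_wordFun (g : D.X → ℂ) (v : Fin 1 → ℕ) (ψ : D.X → ℂ) :
    ∫ x, g x * D.wordFun ∅ 1 0 v ψ x ∂D.leb = ∫ y in D.cyl 1 v, g (D.fX y) * ψ y ∂D.leb := by
  rw [← setIntegral_eq_integral_of_forall_compl_eq_zero (s := D.fX '' D.cell (v 0)) fun x hx => by
    rw [wordFun_eq_zero ψ hx, mul_zero], integral_image_cell, ← cyl_one]
  refine setIntegral_congr_fun (measurableSet_cyl 1 v) fun y hy => ?_
  rw [cyl_one] at hy
  have h := abs_df_mul_wt (H := ∅) (u := 1) hy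
  have hs : D.survive ∅ y = 1 := by simp [survive]
  rw [hs, one_pow, one_mul] at h
  simp only [wordFun_image ψ hy, Complex.real_smul]
  linear_combination g (D.fX y) * ψ y * h

theorem norm_integral_mul_le {g : D.X → ℂ} {C : ℝ} (hC : ∀ x, ‖g x‖ ≤ C)
    (φ : D.BV) : ‖∫ x, g x * φ x ∂D.leb‖ ≤ C * ‖φ‖ := by
  have hm : ∀ x, ‖g x * φ x‖ ≤ C * ‖φ‖ := fun x => by
    rw [norm_mul]
    exact mul_le_mul (hC x) (D.norm_apply_le φ x) (norm_nonneg _) ((norm_nonneg _).trans (hC x))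
  simpa using norm_integral_le_of_norm_le_const (μ := D.leb) (Filter.Eventually.of_forall hm)

theorem integrable_mul_BV {g : D.X → ℂ} (hg : AEStronglyMeasurable g D.leb) {C : ℝ}
    (hC : ∀ x, ‖g x‖ ≤ C) (φ : D.BV) : Integrable (fun x => g x * φ x) D.leb :=
  φ.2.2.bdd_mul hg (Filter.Eventually.of_forall hC)

/-- Transfer operator duality. -/
theorem integral_mul_Rop {κ Q : ℝ} (hW : D.WeightBound κ Q) {g : D.X → ℂ} (hg : Measurable g) {C : ℝ}
    (hC : ∀ x, ‖g x‖ ≤ C) (φ : D.BV) :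
    ∫ x, g x * D.Rop ∅ 1 φ x ∂D.leb = ∫ y, g (D.fX y) * φ y ∂D.leb := by
  choose op hop _ using exists_wordOp hW ordConnected_empty (u := 1) (by simp) 0
  let Λ₀ : D.BV →ₗ[ℂ] ℂ :=
    { toFun := fun φ => ∫ x, g x * φ x ∂D.leb
      map_add' := fun φ ψ => by
        rw [← integral_add (integrable_mul_BV hg.aestronglyMeasurable hC φ)
          (integrable_mul_BV hg.aestronglyMeasurable hC ψ)]
        exact integral_congr_ae (Filter.Eventually.of_forall fun x => mul_add _ _ _)
      map_smul' := fun c φ => by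
        rw [RingHom.id_apply, smul_eq_mul, ← integral_const_mul]
        exact integral_congr_ae (Filter.Eventually.of_forall fun x => mul_left_comm _ _ _) }
  let Λ : D.BV →L[ℂ] ℂ := Λ₀.mkContinuous C (norm_integral_mul_le hC)
  have hs := hasSum_wordOp hW ordConnected_empty (u := 1) (by simp) 0 hop
  rw [show D.Rop ∅ 1 ^ (0 + 1) = D.Rop ∅ 1 from pow_one _] at hs
  have h1 : HasSum (fun v => ∫ x, g x * op v φ x ∂D.leb) (∫ x, g x * D.Rop ∅ 1 φ x ∂D.leb) :=
    Λ.hasSum ((ContinuousLinearMap.apply ℂ D.BV φ).hasSum hs)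
  simp only [hop, integral_mul_wordFun] at h1
  have hi : Integrable (fun y => g (D.fX y) * φ y) D.leb :=
    integrable_mul_BV (hg.comp_aemeasurable aemeasurable_fX).aestronglyMeasurable (fun x => hC _) φ
  have h2 := hasSum_integral_iUnion (measurableSet_cyl (D := D) 1)
    (fun v w h => D.disjoint_cyl h) hi.integrableOn
  rw [Measure.restrict_eq_self_of_ae_mem ae_mem_iUnion_cell] at h2
  exact h1.unique h2

variable (D) in
/-- The constant function one. -/
noncomputable def oneBV : D.BV := ⟨fun _ => 1, by
  refine ⟨?_, integrable_const _⟩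
  have : eVariationOn (fun _ : D.X => (1 : ℂ)) univ = 0 :=
    eVariationOn.constant_on (by rintro _ ⟨a, -, rfl⟩ _ ⟨b, -, rfl⟩; rfl)
  simp [BoundedVariationOn, this]⟩

/-- The transfer operator preserves integrals, so everything in the range of `1 - T` has integral
zero and the constant function `1` is not in it. -/
theorem one_mem_spectrum {κ Q : ℝ} (hW : D.WeightBound κ Q) : (1 : ℂ) ∈ spectrum ℂ (D.Rop ∅ 1) := by
  intro hcon
  have h := smul_sub_resolvent_apply (show (1 : ℂ) ∈ resolventSet ℂ (D.Rop ∅ 1) from hcon) D.oneBV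
  set φ := resolvent (D.Rop ∅ 1) (1 : ℂ) D.oneBV
  have h1 := integral_mul_Rop hW (g := fun _ => 1) measurable_const (C := 1) (by simp) φ
  simp only [one_mul] at h1
  have h2 : ∫ x, (φ x - D.Rop ∅ 1 φ x) ∂D.leb = ∫ _, (1 : ℂ) ∂D.leb := by
    refine integral_congr_ae (Filter.Eventually.of_forall fun x => ?_)
    have := congrArg (fun χ : D.BV => χ x) h
    rw [one_smul] at this
    have h3 : ∀ ψ χ : D.BV, (ψ - χ) x = ψ x - χ x := fun ψ χ => rfl
    have h4 : D.oneBV x = 1 := rfl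
    rw [h4, h3] at this
    exact this
  rw [integral_sub φ.2.2 (D.Rop ∅ 1 φ).2.2, h1, sub_self] at h2
  simp at h2

end YoungBase

/-! ### Finite-rank approximation and isolation of the eigenvalue `1`. -/

namespace YoungBase

variable {D : YoungBase}

/-- Restriction to a fine grid: a monotone map with finite range that is close to the identity, and
a bound for the resulting error in terms of the variation. -/
theorem exists_grid (D : YoungBase) {ε : ℝ} (hε : 0 < ε) : ∃ r : D.X → D.X, Monotone r ∧
    (range r).Finite ∧ (∀ x, dist (r x) x ≤ ε) ∧
    ∀ φ : D.X → ℂ, ∫⁻ x, ‖φ x - φ (r x)‖ₑ ∂D.leb ≤ ENNReal.ofReal ε * eVariationOn φ univ := by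
  -- The mesh is at most `ε`, and the normalised measure of each grid cell is at most `ε` as well.
  set c := ε * min 1 (volume D.X).toReal with hc
  have hv : 0 < (volume D.X).toReal := ENNReal.toReal_pos D.volume_X_ne_zero D.volume_X_ne_top
  have hc0 : 0 < c := by positivity
  have hcε : c ≤ ε := mul_le_of_le_one_right hε.le (min_le_left _ _)
  set g : D.X → ℤ := fun x => ⌊(x : ℝ) / c⌋ with hg
  have hgm : Monotone g := fun x y hxy => Int.floor_le_floor (by gcongr)
  have hclose : ∀ x y, g x = g y → dist x y ≤ c := by
    intro x y h
    have h1 := Int.abs_sub_lt_one_of_floor_eq_floor h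
    rw [← sub_div, abs_div, abs_of_pos hc0, div_lt_one hc0] at h1
    exact h1.le
  have : Nonempty D.X := D.X_nonempty.to_subtype
  choose! s hs using fun (p : ℤ) (hp : ∃ x, g x = p) => hp
  have hgs : ∀ x, g (s (g x)) = g x := fun x => hs (g x) ⟨x, rfl⟩
  obtain ⟨ρ, hρ, hρx⟩ := D.exists_radius
  refine ⟨fun x => s (g x), ?_, ?_, ?_, ?_⟩
  -- Representatives of different grid cells are ordered like the cells, because `s` is a section of
  -- the monotone map `g`.
  · intro x y hxy
    rcases (hgm hxy).eq_or_lt with h | h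
    · exact (congrArg s h).le
    · by_contra hlt
      have := hgm (not_le.1 hlt).le
      rw [hgs, hgs] at this
      exact absurd h (not_lt.2 this)
  · have h1 : (range g).Finite := by
      refine (Set.finite_Icc ⌊-ρ / c⌋ ⌊ρ / c⌋).subset ?_
      rintro _ ⟨x, rfl⟩
      exact ⟨Int.floor_le_floor (by gcongr; exact (hρx x).1),
        Int.floor_le_floor (by gcongr; exact (hρx x).2)⟩
    refine (h1.image s).subset ?_
    rintro _ ⟨x, rfl⟩
    exact ⟨g x, ⟨x, rfl⟩, rfl⟩
  · exact fun x => (hclose _ _ (hgs x)).trans hcε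
  · intro φ
    have hJ : ∀ p, (g ⁻¹' {p}).OrdConnected := fun p => ordConnected_singleton.preimage_mono hgm
    have hd : ∀ p q, p ≠ q → Disjoint (g ⁻¹' {p}) (g ⁻¹' {q}) := fun p q h =>
      Disjoint.preimage g (disjoint_singleton.2 h)
    have hun : ⋃ p, g ⁻¹' {p} = univ := by
      ext x; simp
    have hleb : ∀ p, D.leb (g ⁻¹' {p}) ≤ ENNReal.ofReal ε := by
      intro p
      rw [leb_apply]
      have h1 : volume (((↑) : D.X → ℝ) '' (g ⁻¹' {p})) ≤ ENNReal.ofReal c := by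
        refine (Real.volume_le_diam _).trans ?_
        refine Metric.ediam_le ?_
        rintro _ ⟨x, hx, rfl⟩ _ ⟨y, hy, rfl⟩
        rw [edist_dist]
        exact ENNReal.ofReal_le_ofReal (hclose x y (hx.trans hy.symm))
      calc _ ≤ (volume D.X)⁻¹ * ENNReal.ofReal c := by gcongr
        _ ≤ (volume D.X)⁻¹ * (ENNReal.ofReal ε * volume D.X) := by
            gcongr
            rw [← ENNReal.ofReal_toReal D.volume_X_ne_top, ← ENNReal.ofReal_mul hε.le]
            apply ENNReal.ofReal_le_ofReal
            rw [hc]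
            gcongr
            exact min_le_right _ _
        _ = _ := by
            rw [mul_left_comm, ENNReal.inv_mul_cancel D.volume_X_ne_zero D.volume_X_ne_top, mul_one]
    calc ∫⁻ x, ‖φ x - φ (s (g x))‖ₑ ∂D.leb
        = ∑' p, ∫⁻ x in g ⁻¹' {p}, ‖φ x - φ (s (g x))‖ₑ ∂D.leb := by
          rw [← lintegral_iUnion (fun p => D.measurableSet_of_ordConnected (hJ p))
            (fun p q h => hd p q h), hun, Measure.restrict_univ]
      _ ≤ ∑' p, ENNReal.ofReal ε * eVariationOn φ (g ⁻¹' {p}) := by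
          refine ENNReal.tsum_le_tsum fun p => ?_
          calc _ ≤ ∫⁻ x in g ⁻¹' {p}, eVariationOn φ (g ⁻¹' {p}) ∂D.leb := by
                refine setLIntegral_mono' (D.measurableSet_of_ordConnected (hJ p)) fun x hx => ?_
                rw [← edist_eq_enorm_sub]
                refine eVariationOn.edist_le _ hx ?_
                change g (s (g x)) = p
                rw [hgs]
                exact hx
            _ ≤ _ := by
                rw [setLIntegral_const, mul_comm]
                gcongr
                exact hleb p
      _ ≤ _ := by
          rw [ENNReal.tsum_mul_left]
          gcongr
          exact tsum_eVariationOn_le _ _ hJ hd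

/-- The indicator of an order-connected set, as a function of bounded variation. -/
theorem indicator_mem_bv {J : Set D.X} (hJ : J.OrdConnected) :
    (J.indicator fun _ => (1 : ℂ)) ∈ D.bv :=
  D.mem_bv_of_boundedVariationOn <|
    ne_top_of_le_ne_top (by simp) (eVariationOn_indicator_ordConnected_le hJ univ)

theorem sum_indicator_fibre {r : D.X → D.X} (hfin : (range r).Finite) (φ : D.X → ℂ) (x : D.X) :
    φ (r x) = ∑ p ∈ hfin.toFinset, φ p * (r ⁻¹' {p}).indicator (fun _ => (1 : ℂ)) x := by
  rw [Finset.sum_eq_single_of_mem (r x) (by simp)]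
  · simp
  · intro p _ hp
    have hx : x ∉ r ⁻¹' {p} := fun h => hp (Eq.symm h)
    rw [indicator_of_notMem hx, mul_zero]

theorem comp_mem_bv {r : D.X → D.X} (hr : Monotone r) (hfin : (range r).Finite) (φ : D.X → ℂ) :
    (fun x => φ (r x)) ∈ D.bv := by
  have h : (fun x => φ (r x)) =
      ∑ p ∈ hfin.toFinset, φ p • (r ⁻¹' {p}).indicator (fun _ => (1 : ℂ)) := by
    ext x
    rw [sum_indicator_fibre hfin φ, Finset.sum_apply]
    rfl
  rw [h]
  exact D.bv.sum_mem fun p _ => D.bv.smul_mem _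
    (indicator_mem_bv (ordConnected_singleton.preimage_mono hr))

/-- Let `π φ = φ ∘ r` for a grid map `r`. It has finite rank, norm at most `2`, and is close to the
identity from `B` to `L¹`, so the Lasota–Yorke inequality makes `T^n (1 - π)` small for large `n`.
-/
theorem eventually_mem_resolventSet {κ Q : ℝ} (hW : D.WeightBound κ Q) :
    ∀ᶠ z in 𝓝[≠] (1 : ℂ), z ∈ resolventSet ℂ (D.Rop ∅ 1) := by
  obtain ⟨C, hC, hLY⟩ := exists_uniform_lasotaYorke hW
  have hLY' : ∀ n φ, ‖(D.Rop ∅ 1 ^ n) φ‖ ≤ C * D.θ ^ n * ‖φ‖ + C * D.nu φ := fun n φ => by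
    simpa using hLY ∅ ordConnected_empty 1 (by simp) n φ
  obtain ⟨n, hn, hn1⟩ : ∃ n : ℕ, C * D.θ ^ n ≤ 1 / 12 ∧ 1 ≤ n := by
    have h := (tendsto_pow_atTop_nhds_zero_of_lt_one D.θ_mem.1.le D.θ_mem.2).const_mul C
    rw [mul_zero] at h
    exact ((h.eventually_le_const (by norm_num : (0 : ℝ) < 1 / 12)).and
      (Filter.eventually_ge_atTop 1)).exists
  -- Budget for the norm bound `1/2`: the strong term is at most `(1/12)·3`, since `‖φ - π φ‖ ≤ 3
  -- ‖φ‖`, and the weak term at most `C · 1/(4C)`.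
  obtain ⟨r, hr, hfin, -, hrφ⟩ := exists_grid D (ε := 1 / (4 * C)) (by positivity)
  have hJ : ∀ p, (r ⁻¹' {p}).OrdConnected := fun p => ordConnected_singleton.preimage_mono hr
  let e : D.X → D.BV := fun p => ⟨_, indicator_mem_bv (hJ p)⟩
  refine eventually_mem_resolventSet_of_finite_rank (ι := hfin.toFinset) _ hn1
    (fun p => D.evalL p) (fun p => (D.Rop ∅ 1 ^ n) (e p)) ?_
  refine ContinuousLinearMap.opNorm_le_bound _ (by norm_num) fun φ => ?_
  let πφ : D.BV := ⟨_, comp_mem_bv hr hfin φ⟩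
  have hπ : ∀ x, πφ x = φ (r x) := fun x => rfl
  have h1 : πφ = ∑ p : hfin.toFinset, φ p • e p := by
    have hev : ∀ x, D.evalL x (∑ p : hfin.toFinset, φ p • e p) =
        ∑ p : hfin.toFinset, φ p * e p x := fun x => by
      rw [map_sum]; rfl
    refine D.BV_ext fun x => ?_
    rw [← evalL_apply D x (∑ p : hfin.toFinset, φ p • e p), hev, hπ, sum_indicator_fibre hfin (φ : D.X → ℂ) x,
      ← Finset.sum_coe_sort]
  have h2 : (D.Rop ∅ 1 ^ n - ∑ p : hfin.toFinset,
      (D.evalL p).smulRight ((D.Rop ∅ 1 ^ n) (e p))) φ = (D.Rop ∅ 1 ^ n) (φ - πφ) := by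
    rw [map_sub, h1, map_sum]
    simp [evalL_apply]
  have h3 : D.nu (φ - πφ) ≤ 1 / (4 * C) * ‖φ‖ := by
    have h := hrφ φ
    have h4 : ENNReal.ofReal (D.nu (φ - πφ)) ≤ ENNReal.ofReal (1 / (4 * C)) * ‖φ‖ₑ := by
      rw [ofReal_nu]
      refine h.trans ?_
      gcongr
      exact D.eVariationOn_le_enorm φ univ
    rw [← ofReal_norm, ← ENNReal.ofReal_mul (by positivity)] at h4
    exact (ENNReal.ofReal_le_ofReal_iff (by positivity)).1 h4
  have h5 : ‖πφ‖ ≤ 2 * ‖φ‖ := by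
    have hvar : eVariationOn πφ univ ≤ eVariationOn φ univ :=
      eVariationOn.comp_le_of_monotoneOn (φ : D.X → ℂ) r (hr.monotoneOn _) (mapsTo_univ _ _)
    have h6 : ‖πφ‖ₑ ≤ ENNReal.ofReal 2 * ‖φ‖ₑ := by
      rw [D.enorm_BV πφ]
      calc _ ≤ ‖φ‖ₑ + ‖φ‖ₑ := add_le_add
            (D.lintegral_le_of_enorm_le fun x => by rw [hπ]; exact D.enorm_apply_le φ _)
            (hvar.trans (D.eVariationOn_le_enorm φ univ))
        _ = _ := by rw [← two_mul]; simp
    rw [← ofReal_norm, ← ofReal_norm, ← ENNReal.ofReal_mul (by positivity)] at h6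
    exact (ENNReal.ofReal_le_ofReal_iff (by positivity)).1 h6
  rw [h2]
  have hC0 : C * (1 / (4 * C) * ‖φ‖) = 1 / 4 * ‖φ‖ := by field_simp
  calc _ ≤ C * D.θ ^ n * ‖φ - πφ‖ + C * D.nu (φ - πφ) := hLY' n _
    _ ≤ 1 / 12 * (‖φ‖ + 2 * ‖φ‖) + C * (1 / (4 * C) * ‖φ‖) := by
      gcongr
      exact (norm_sub_le _ _).trans (by linarith)
    _ = _ := by rw [hC0]; ring

theorem exists_admissible {κ Q : ℝ} (hW : D.WeightBound κ Q) : ∃ δ, D.Admissible D.θ δ := by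
  obtain ⟨hθ, hθ1⟩ := D.θ_mem
  have h := eventually_mem_resolventSet hW
  rw [eventually_nhdsWithin_iff, Metric.eventually_nhds_iff] at h
  obtain ⟨ε, hε, hres⟩ := h
  have ht : Filter.Tendsto (fun δ : ℝ => (1 - δ) ^ 2) (𝓝[>] 0) (𝓝 1) := by
    have : Continuous fun δ : ℝ => (1 - δ) ^ 2 := by fun_prop
    simpa using (this.tendsto 0).mono_left nhdsWithin_le_nhds
  obtain ⟨δ, h1, h2, h3⟩ := ((ht.eventually_const_lt hθ1).and
    (Ioo_mem_nhdsGT (show (0 : ℝ) < min 1 ε by positivity))).exists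
  refine ⟨δ, h2, h3.trans_le (min_le_left _ _), h1, ?_⟩
  ext z
  simp only [mem_inter_iff, Metric.mem_closedBall, mem_singleton_iff]
  constructor
  · rintro ⟨hz, hzd⟩
    by_contra hne
    exact hz (hres (hzd.trans_lt (h3.trans_le (min_le_right _ _))) hne)
  · rintro rfl
    exact ⟨one_mem_spectrum hW, by simpa using h2.le⟩

end YoungBase

/-! ### The invariant density has a version of bounded variation. -/

namespace YoungBase

variable {D : YoungBase} {μ : Measure D.X}

theorem IsSRB.le_leb (hμ : D.IsSRB μ) : ∃ K : ℝ≥0, 1 ≤ K ∧ (∀ s, D.leb s ≤ K * μ s) ∧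
    ∀ s, μ s ≤ K * D.leb s := by
  obtain ⟨-, -, K, hK, h1, h2⟩ := hμ
  refine ⟨K, hK, fun s => ?_, fun s => ?_⟩
  · have h := h1 s
    have hK0 : (K : ℝ≥0∞) ≠ 0 := by
      have : K ≠ 0 := by positivity
      exact_mod_cast this
    rw [Measure.smul_apply, ENNReal.smul_def, smul_eq_mul, ENNReal.coe_inv (by positivity)] at h
    rw [mul_comm]
    calc D.leb s = (K : ℝ≥0∞)⁻¹ * D.leb s * K := by
          rw [mul_right_comm, ENNReal.inv_mul_cancel hK0 ENNReal.coe_ne_top, one_mul]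
      _ ≤ _ := by gcongr
  · have h := h2 s
    rwa [Measure.smul_apply, ENNReal.smul_def, smul_eq_mul] at h

theorem IsSRB.absolutelyContinuous (hμ : D.IsSRB μ) : μ ≪ D.leb := by
  obtain ⟨K, -, -, h⟩ := hμ.le_leb
  intro s hs
  have := h s
  rw [hs, mul_zero] at this
  exact le_antisymm this bot_le

theorem IsSRB.map_fX (hμ : D.IsSRB μ) : μ.map D.fX = μ := by
  ext s hs
  rw [Measure.map_apply_of_aemeasurable (aemeasurable_fX.mono_ac hμ.absolutelyContinuous) hs,
    hμ.2.1 s hs]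

theorem IsSRB.ae_rnDeriv_mem (hμ : D.IsSRB μ) : ∃ K : ℝ, 1 ≤ K ∧ ∀ᵐ x ∂D.leb,
    (μ.rnDeriv D.leb x).toReal ∈ Icc K⁻¹ K ∧
      ENNReal.ofReal (μ.rnDeriv D.leb x).toReal = μ.rnDeriv D.leb x := by
  have := hμ.1
  obtain ⟨K, hK, h1, h2⟩ := hμ.le_leb
  have hwd := Measure.withDensity_rnDeriv_eq μ D.leb hμ.absolutelyContinuous
  have hm := Measure.measurable_rnDeriv μ D.leb
  have hset : ∀ s, MeasurableSet s → ∫⁻ x in s, μ.rnDeriv D.leb x ∂D.leb = μ s := fun s hs => by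
    rw [← withDensity_apply _ hs, hwd]
  have hle : ∀ᵐ x ∂D.leb, μ.rnDeriv D.leb x ≤ K := by
    refine ae_le_of_forall_setLIntegral_le_of_sigmaFinite hm fun s hs _ => ?_
    rw [hset s hs, setLIntegral_const]
    exact h2 s
  have hge : ∀ᵐ x ∂D.leb, (K : ℝ≥0∞)⁻¹ ≤ μ.rnDeriv D.leb x := by
    refine ae_le_of_forall_setLIntegral_le_of_sigmaFinite measurable_const fun s hs _ => ?_
    rw [hset s hs, setLIntegral_const]
    have hK0 : (K : ℝ≥0∞) ≠ 0 := by
      have : K ≠ 0 := by positivity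
      exact_mod_cast this
    calc (K : ℝ≥0∞)⁻¹ * D.leb s ≤ (K : ℝ≥0∞)⁻¹ * (K * μ s) := by gcongr; exact h1 s
      _ = _ := by rw [← mul_assoc, ENNReal.inv_mul_cancel hK0 ENNReal.coe_ne_top, one_mul]
  refine ⟨K, hK, ?_⟩
  filter_upwards [hle, hge] with x hx1 hx2
  have hne : μ.rnDeriv D.leb x ≠ ⊤ := ne_top_of_le_ne_top ENNReal.coe_ne_top hx1
  refine ⟨⟨?_, ?_⟩, ENNReal.ofReal_toReal hne⟩
  · have := ENNReal.toReal_mono hne hx2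
    rwa [ENNReal.toReal_inv, ENNReal.coe_toReal] at this
  · have := ENNReal.toReal_mono ENNReal.coe_ne_top hx1
    rwa [ENNReal.coe_toReal] at this

variable (μ) in
/-- The density of `μ`, up to null sets. -/
noncomputable def dens (x : D.X) : ℂ := ((μ.rnDeriv D.leb x).toReal : ℂ)

theorem measurable_dens : Measurable (dens μ) :=
  Complex.measurable_ofReal.comp (Measure.measurable_rnDeriv μ D.leb).ennreal_toReal

theorem IsSRB.integrable_dens (hμ : D.IsSRB μ) : Integrable (dens μ) D.leb := by
  have := hμ.1
  exact Measure.integrable_toReal_rnDeriv.ofReal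

theorem IsSRB.integral_mul_dens (hμ : D.IsSRB μ) (g : D.X → ℂ) :
    ∫ x, g x * dens μ x ∂D.leb = ∫ x, g x ∂μ := by
  have := hμ.1
  rw [← integral_rnDeriv_smul hμ.absolutelyContinuous]
  refine integral_congr_ae (Filter.Eventually.of_forall fun x => ?_)
  simp only [dens, Complex.real_smul, mul_comm]

/-- This is the `L¹` contraction of `T` at the fixed point given by the density, proved by duality
because the density is not yet known to lie in `B`. -/
theorem IsSRB.integral_Rop_sub_dens_le (hμ : D.IsSRB μ) {κ Q : ℝ} (hW : D.WeightBound κ Q) (φ : D.BV) :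
    ∫ x, ‖D.Rop ∅ 1 φ x - dens μ x‖ ∂D.leb ≤ ∫ x, ‖φ x - dens μ x‖ ∂D.leb := by
  have := hμ.1
  set q := fun x => D.Rop ∅ 1 φ x - dens μ x with hq
  have hqm : Measurable q := (D.measurable_BV _).sub measurable_dens
  -- The conjugate sign of `q`, so that `g q = |q|`; at zeros of `q` the quotient is `0`, which is
  -- harmless.
  set g := fun x => (starRingEnd ℂ) (q x) / ((‖q x‖ : ℝ) : ℂ) with hg
  have hgm : Measurable g :=
    (Complex.continuous_conj.measurable.comp hqm).div (Complex.measurable_ofReal.comp hqm.norm)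
  have hg1 : ∀ x, ‖g x‖ ≤ 1 := fun x => by
    rw [hg, norm_div, Complex.norm_real, norm_norm, RCLike.norm_conj]
    exact div_self_le_one _
  have hgq : ∀ x, g x * q x = ((‖q x‖ : ℝ) : ℂ) := fun x => by
    rw [hg]
    simp only
    rw [div_mul_eq_mul_div, mul_comm, Complex.mul_conj, Complex.normSq_eq_norm_sq]
    push_cast
    rcases eq_or_ne ((‖q x‖ : ℝ) : ℂ) 0 with h | h
    · simp [h]
    · field_simp
  -- Invariance of `μ` does for the density what the duality of `T` does for `φ`.
  have hinv : ∫ x, g x * dens μ x ∂D.leb = ∫ x, g (D.fX x) * dens μ x ∂D.leb := by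
    have h1 := hμ.integral_mul_dens g
    have h2 := hμ.integral_mul_dens (g ∘ D.fX)
    have h3 : ∫ x, g x ∂μ = ∫ x, g (D.fX x) ∂μ := by
      conv_lhs => rw [← hμ.map_fX]
      exact integral_map (aemeasurable_fX.mono_ac hμ.absolutelyContinuous)
        hgm.aestronglyMeasurable
    rw [h1, h3]
    exact h2.symm
  have hgf : AEStronglyMeasurable (fun x => g (D.fX x)) D.leb :=
    (hgm.comp_aemeasurable aemeasurable_fX).aestronglyMeasurable
  have hid := hμ.integrable_dens
  have e1 : ∫ x, g x * q x ∂D.leb = ∫ x, g (D.fX x) * (φ x - dens μ x) ∂D.leb := by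
    simp only [hq, mul_sub]
    rw [integral_sub (integrable_mul_BV hgm.aestronglyMeasurable hg1 _)
      (hid.bdd_mul hgm.aestronglyMeasurable (Filter.Eventually.of_forall hg1)),
      integral_mul_Rop hW hgm hg1, hinv,
      ← integral_sub (integrable_mul_BV hgf (fun x => hg1 _) _)
      (hid.bdd_mul hgf (Filter.Eventually.of_forall fun x => hg1 _))]
  have e2 : ((∫ x, ‖q x‖ ∂D.leb : ℝ) : ℂ) = ∫ x, g x * q x ∂D.leb := by
    rw [← integral_complex_ofReal]
    exact integral_congr_ae (Filter.Eventually.of_forall fun x => (hgq x).symm)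
  have e3 : ‖((∫ x, ‖q x‖ ∂D.leb : ℝ) : ℂ)‖ = ∫ x, ‖q x‖ ∂D.leb := by
    rw [Complex.norm_real, Real.norm_of_nonneg (integral_nonneg fun _ => norm_nonneg _)]
  rw [← e3, e2, e1]
  refine (norm_integral_le_integral_norm _).trans ?_
  refine integral_mono_of_nonneg (Filter.Eventually.of_forall fun _ => norm_nonneg _)
    (φ.2.2.sub hid).norm (Filter.Eventually.of_forall fun x => ?_)
  simp only [norm_mul]
  exact mul_le_of_le_one_left (norm_nonneg _) (hg1 _)

theorem IsSRB.integral_Rop_pow_sub_dens_le (hμ : D.IsSRB μ) {κ Q : ℝ} (hW : D.WeightBound κ Q)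
    (n : ℕ) (φ : D.BV) :
    ∫ x, ‖(D.Rop ∅ 1 ^ n) φ x - dens μ x‖ ∂D.leb ≤ ∫ x, ‖φ x - dens μ x‖ ∂D.leb := by
  induction n with
  | zero => exact le_rfl
  | succ n ih =>
    rw [pow_succ', mul_apply_eq_comp]
    exact (hμ.integral_Rop_sub_dens_le hW _).trans ih

/-- Continuous functions are dense in `L¹`, and composing one with finer and finer grid maps gives
step functions converging to it. -/
theorem exists_BV_approx {f : D.X → ℂ} (hf : Integrable f D.leb) {ε : ℝ} (hε : 0 < ε) :
    ∃ φ : D.BV, ∫ x, ‖φ x - f x‖ ∂D.leb ≤ ε := by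
  obtain ⟨g, hg, hgi⟩ := hf.exists_boundedContinuous_integral_sub_le (half_pos hε)
  choose r hr hfin hdist _ using fun n : ℕ => exists_grid D (ε := 1 / ((n : ℝ) + 1)) (by positivity)
  let φ : ℕ → D.BV := fun n => ⟨_, comp_mem_bv (hr n) (hfin n) g⟩
  have hφ : ∀ n x, φ n x = g (r n x) := fun n x => rfl
  have hrt : ∀ x, Filter.Tendsto (fun n => r n x) Filter.atTop (𝓝 x) := fun x =>
    tendsto_iff_dist_tendsto_zero.2 <| squeeze_zero (fun _ => dist_nonneg) (fun n => hdist n x)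
      tendsto_one_div_add_atTop_nhds_zero_nat
  have ht : Filter.Tendsto (fun n => ∫ x, ‖φ n x - g x‖ ∂D.leb) Filter.atTop (𝓝 0) := by
    have h := tendsto_integral_of_dominated_convergence (μ := D.leb)
      (F := fun n x => ‖φ n x - g x‖) (f := fun _ => 0) (fun _ => ‖g‖ + ‖g‖)
      (fun n => ((φ n).2.2.sub hgi).norm.aestronglyMeasurable) (integrable_const _)
      (fun n => Filter.Eventually.of_forall fun x => ?_) (Filter.Eventually.of_forall fun x => ?_)
    · simpa using h
    · rw [norm_norm]
      exact (norm_sub_le _ _).trans (add_le_add (g.norm_coe_le_norm _) (g.norm_coe_le_norm _))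
    · have := (((g.continuous.tendsto x).comp (hrt x)).sub_const (g x)).norm
      simpa using this
  obtain ⟨n, hn⟩ := (ht.eventually_le_const (half_pos hε)).exists
  refine ⟨φ n, ?_⟩
  have h1 : Integrable (fun x => φ n x - g x) D.leb := (φ n).2.2.sub hgi
  have h2 : Integrable (fun x => f x - g x) D.leb := hf.sub hgi
  calc ∫ x, ‖φ n x - f x‖ ∂D.leb ≤ ∫ x, (‖φ n x - g x‖ + ‖f x - g x‖) ∂D.leb := by
        refine integral_mono ((φ n).2.2.sub hf).norm (h1.norm.add h2.norm) fun x => ?_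
        rw [← norm_sub_rev (g x) (f x)]
        exact norm_sub_le_norm_sub_add_norm_sub _ _ _
    _ = (∫ x, ‖φ n x - g x‖ ∂D.leb) + ∫ x, ‖f x - g x‖ ∂D.leb := integral_add h1.norm h2.norm
    _ ≤ ε := by linarith

theorem IsSRB.exists_bounded_approx (hμ : D.IsSRB μ) {κ Q : ℝ} (hW : D.WeightBound κ Q) :
    ∃ B : ℝ, ∃ ψ : ℕ → D.BV, (∀ k, ‖ψ k‖ ≤ B) ∧
      ∀ᵐ x ∂D.leb, Filter.Tendsto (fun k => ψ k x) Filter.atTop (𝓝 (dens μ x)) := by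
  obtain ⟨C, hC, hLY⟩ := exists_uniform_lasotaYorke hW
  have hLY' : ∀ n φ, ‖(D.Rop ∅ 1 ^ n) φ‖ ≤ C * D.θ ^ n * ‖φ‖ + C * D.nu φ := fun n φ => by
    simpa using hLY ∅ ordConnected_empty 1 (by simp) n φ
  have hid := hμ.integrable_dens
  choose φ hφ using fun k : ℕ => exists_BV_approx hid (ε := 1 / ((k : ℝ) + 1)) (by positivity)
  -- The approximations may have unbounded variation. Enough iterates remove the strong norm in the
  -- Lasota–Yorke inequality, while the `L¹` distance to the density does not increase.
  have hn : ∀ k, ∃ n : ℕ, C * D.θ ^ n * ‖φ k‖ ≤ 1 := fun k => by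
    have h := ((tendsto_pow_atTop_nhds_zero_of_lt_one D.θ_mem.1.le D.θ_mem.2).const_mul C).mul_const
      ‖φ k‖
    rw [mul_zero, zero_mul] at h
    exact (h.eventually_le_const one_pos).exists
  choose n hn using hn
  set ψ := fun k => (D.Rop ∅ 1 ^ n k) (φ k) with hψ
  have hψd : ∀ k, ∫ x, ‖ψ k x - dens μ x‖ ∂D.leb ≤ 1 / ((k : ℝ) + 1) := fun k =>
    (hμ.integral_Rop_pow_sub_dens_le hW _ _).trans (hφ k)
  have hψB : ∀ k, ‖ψ k‖ ≤ 1 + C * (1 + ∫ x, ‖dens μ x‖ ∂D.leb) := fun k => by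
    refine (hLY' _ _).trans (add_le_add (hn k) ?_)
    gcongr
    have h1 : D.nu (φ k) ≤ ∫ x, (‖φ k x - dens μ x‖ + ‖dens μ x‖) ∂D.leb := by
      refine integral_mono (φ k).2.2.norm (((φ k).2.2.sub hid).norm.add hid.norm) fun x => ?_
      have := norm_add_le (φ k x - dens μ x) (dens μ x)
      rwa [sub_add_cancel] at this
    have h2 : Integrable (fun x => φ k x - dens μ x) D.leb := (φ k).2.2.sub hid
    refine (h1.trans_eq (integral_add h2.norm hid.norm)).trans ?_
    refine (add_le_add ((hφ k).trans ?_) le_rfl)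
    rw [div_le_one (by positivity)]
    simp
  have ht : Filter.Tendsto (fun k => eLpNorm ((ψ k : D.X → ℂ) - dens μ) 1 D.leb) Filter.atTop (𝓝 0) := by
    have h1 : ∀ k, eLpNorm ((ψ k : D.X → ℂ) - dens μ) 1 D.leb ≤
        ENNReal.ofReal (1 / ((k : ℝ) + 1)) := fun k => by
      rw [eLpNorm_one_eq_lintegral_enorm,
        ← ofReal_integral_norm_eq_lintegral_enorm ((ψ k).2.2.sub hid)]
      exact ENNReal.ofReal_le_ofReal (hψd k)
    have h2 : Filter.Tendsto (fun k : ℕ => ENNReal.ofReal (1 / ((k : ℝ) + 1))) Filter.atTop (𝓝 0) := by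
      simpa using ENNReal.tendsto_ofReal tendsto_one_div_add_atTop_nhds_zero_nat
    exact tendsto_of_tendsto_of_tendsto_of_le_of_le tendsto_const_nhds h2 (fun _ => bot_le) h1
  obtain ⟨ns, -, hns⟩ := (tendstoInMeasure_of_tendsto_eLpNorm one_ne_zero
    (fun k => (ψ k).2.2.1) hid.1 ht).exists_seq_tendsto_ae
  exact ⟨_, fun k => ψ (ns k), fun k => hψB _, hns⟩

theorem IsSRB.exists_density (hμ : D.IsSRB μ) {κ Q : ℝ} (hW : D.WeightBound κ Q) :
    ∃ h : D.X → ℝ, D.IsDensity μ h := by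
  have := hμ.1
  obtain ⟨B, ψ, hψB, hψ⟩ := hμ.exists_bounded_approx hW
  obtain ⟨K, hK, hKd⟩ := hμ.ae_rnDeriv_mem
  -- Convergence is known only almost everywhere, but variation is sensitive to every point. Along
  -- an ultrafilter the bounded values converge everywhere, and variation is lower semicontinuous
  -- under this pointwise limit.
  let U : Ultrafilter ℕ := Filter.hyperfilter ℕ
  have hU : (U : Filter ℕ) ≤ Filter.atTop := Nat.hyperfilter_le_atTop
  have hlim : ∀ x, ∃ c : ℂ, Filter.Tendsto (fun k => ψ k x) U (𝓝 c) := by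
    intro x
    have hmem : ∀ k, ψ k x ∈ Metric.closedBall (0 : ℂ) B := fun k => by
      rw [mem_closedBall_zero_iff]
      exact (D.norm_apply_le _ _).trans (hψB k)
    obtain ⟨c, -, hc⟩ := (isCompact_closedBall (0 : ℂ) B).ultrafilter_le_nhds
      (U.map fun k => ψ k x) (by
        rw [Filter.le_principal_iff]
        exact Filter.mem_map.2 (Filter.univ_mem' hmem))
    exact ⟨c, hc⟩
  choose g hg using hlim
  have hgd : ∀ᵐ x ∂D.leb, g x = dens μ x := by
    filter_upwards [hψ] with x hx
    exact tendsto_nhds_unique (hg x) (hx.mono_left hU)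
  have hgv : eVariationOn g univ ≤ ENNReal.ofReal B := by
    by_contra hlt
    push Not at hlt
    obtain ⟨k, hk⟩ := (eVariationOn.lowerSemicontinuous_aux (p := (U : Filter ℕ))
      (F := fun k => (ψ k : D.X → ℂ)) (s := univ) (fun x _ => hg x) hlt).exists
    refine absurd hk (not_lt.2 ((D.eVariationOn_le_enorm (ψ k) univ).trans ?_))
    rw [← ofReal_norm]
    exact ENNReal.ofReal_le_ofReal (hψB k)
  -- Truncation to `[K⁻¹, K]` is `1`-Lipschitz, hence preserves bounded variation. It changes the
  -- limit only on a null set, and gives the bounds at every point.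
  set c : ℂ → ℝ := fun z => max K⁻¹ (min K z.re) with hc
  have hcL : LipschitzWith 1 c := by
    refine LipschitzWith.of_dist_le_mul fun z w => ?_
    rw [NNReal.coe_one, one_mul, Real.dist_eq, dist_eq_norm]
    refine (abs_max_sub_max_le_max _ _ _ _).trans ?_
    rw [sub_self, abs_zero, max_eq_right (abs_nonneg _)]
    refine (abs_min_sub_min_le_max _ _ _ _).trans ?_
    rw [sub_self, abs_zero, max_eq_right (abs_nonneg _), ← Complex.sub_re]
    exact Complex.abs_re_le_norm _
  have hKi : K⁻¹ ≤ K := (inv_le_one_of_one_le₀ hK).trans hK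
  refine ⟨fun x => c (g x), ?_, ⟨K, hK, fun x => ⟨le_max_left _ _, max_le hKi (min_le_left _ _)⟩⟩, ?_⟩
  · refine D.mem_bv_of_boundedVariationOn ?_
    rw [BoundedVariationOn, eVariationOn_ofReal_comp]
    exact hcL.comp_boundedVariationOn (ne_top_of_le_ne_top ENNReal.ofReal_ne_top hgv)
  · rw [← Measure.withDensity_rnDeriv_eq μ D.leb hμ.absolutelyContinuous]
    refine withDensity_congr_ae ?_
    filter_upwards [hgd, hKd] with x hx1 hx2
    rw [← hx2.2, hx1, hc]
    simp only [dens, Complex.ofReal_re]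
    rw [min_eq_right hx2.1.2, max_eq_right hx2.1.1]

end YoungBase

/-! ### Stability of the projections under a small hole. -/

namespace YoungBase

variable {D : YoungBase} {μ : Measure D.X}

/-- The factor `1_{Hᶜ} ∘ f` is constant on fibres and comes out of `T`: opening the hole is
multiplication of `T ψ` by `1_{Hᶜ}`. Hence open and closed images differ only on `H`. -/
theorem openT_apply (H : Set ℝ) (ψ : D.X → ℂ) (x : D.X) [Decidable ((x : ℝ) ∈ H)] :
    D.openT H ψ x = if (x : ℝ) ∈ H then 0 else D.T ψ x := by
  have hs : ∀ y : D.fibre x, D.survive H y.1 = if (x : ℝ) ∈ H then 0 else 1 := fun y => by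
    unfold survive
    rw [y.2.2]
    split_ifs <;> rfl
  unfold openT T
  simp only [hs]
  split_ifs <;> simp

theorem openT_empty (ψ : D.X → ℂ) : D.openT ∅ ψ = D.T ψ := by
  classical
  ext x
  rw [openT_apply, if_neg (notMem_empty _)]

theorem toBV_eq {χ : D.BV} {ψ : D.X → ℂ} (h : (χ : D.X → ℂ) = ψ) : D.toBV ψ = χ := by
  have hm : ψ ∈ D.bv := h ▸ χ.2
  have e : D.toBV ψ = (⟨ψ, hm⟩ : D.BV) := dif_pos hm
  exact e.trans (Subtype.ext h.symm)

theorem Rop_one_apply {κ Q : ℝ} (hW : D.WeightBound κ Q) {H : Set ℝ} (hH : H.OrdConnected)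
    (φ : D.BV) : (D.Rop H 1 φ : D.X → ℂ) = D.openT H φ := by
  rw [isRop_Rop hW hH (by simp) φ]
  simp

/-- The weak norm of the part of a function that is cut off by a hole. -/
theorem nu_sub_le_of_openT {H : Set ℝ} (hH : H.OrdConnected) {χ χ₀ : D.BV} {ψ : D.X → ℂ}
    (h : (χ : D.X → ℂ) = D.openT H ψ) (h₀ : (χ₀ : D.X → ℂ) = D.openT ∅ ψ) :
    D.nu (χ - χ₀) ≤ D.leb.real {x : D.X | (x : ℝ) ∈ H} * ‖χ₀‖ := by
  classical
  set S := {x : D.X | (x : ℝ) ∈ H}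
  have hS : MeasurableSet S :=
    D.measurableSet_of_ordConnected ⟨fun _ hx _ hy _ hz => hH.out hx hy hz⟩
  have h1 : ∀ x, ‖(χ - χ₀ : D.BV) x‖ ≤ S.indicator (fun _ => ‖χ₀‖) x := by
    intro x
    have e : (χ - χ₀ : D.BV) x = χ x - χ₀ x := rfl
    have e0 := congrFun h₀ x
    rw [openT_empty] at e0
    rw [e, h, openT_apply, ← e0]
    by_cases hx : (x : ℝ) ∈ H
    · rw [if_pos hx, indicator_of_mem (show x ∈ S from hx), zero_sub, norm_neg]
      exact D.norm_apply_le χ₀ x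
    · rw [if_neg hx, sub_self, norm_zero, indicator_of_notMem (show x ∉ S from hx)]
  calc D.nu (χ - χ₀) ≤ ∫ x, S.indicator (fun _ => ‖χ₀‖) x ∂D.leb :=
        integral_mono (χ - χ₀).2.2.norm ((integrable_const _).indicator hS) h1
    _ = _ := by rw [integral_indicator_const _ hS, smul_eq_mul]

/-- Integration over a set, as a functional. -/
noncomputable def setIntegralL (D : YoungBase) (s : Set D.X) : D.BV →L[ℂ] ℂ :=
  LinearMap.mkContinuous
    { toFun := fun φ : D.BV => ∫ x in s, φ x ∂D.leb
      map_add' := fun φ ψ => integral_add φ.2.2.restrict ψ.2.2.restrict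
      map_smul' := fun c φ => integral_const_mul c _ }
    (D.leb.real s) fun φ => by
      have h := norm_integral_le_of_norm_le_const (μ := D.leb.restrict s)
        (Filter.Eventually.of_forall fun x => D.norm_apply_le φ x)
      rw [measureReal_restrict_apply_univ, mul_comm] at h
      exact h

theorem setIntegralL_apply (s : Set D.X) (φ : D.BV) :
    D.setIntegralL s φ = ∫ x in s, φ x ∂D.leb := rfl

theorem norm_setIntegralL_le (s : Set D.X) (φ : D.BV) :
    ‖D.setIntegralL s φ‖ ≤ D.leb.real s * ‖φ‖ :=
  (ContinuousLinearMap.le_opNorm _ _).trans <| by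
    gcongr
    exact LinearMap.mkContinuous_norm_le _ measureReal_nonneg _

theorem norm_setIntegralL_le_nu (s : Set D.X) (φ : D.BV) : ‖D.setIntegralL s φ‖ ≤ D.nu φ :=
  (norm_integral_le_integral_norm _).trans
    (setIntegral_le_integral φ.2.2.norm (Filter.Eventually.of_forall fun _ => norm_nonneg _))

theorem projError_eq (H : Set ℝ) (δ : ℝ) (h : D.X → ℝ) (a b : ℕ) : D.projError H δ h a b =
    ‖D.setIntegralL {x : D.X | a < D.R x}
      (D.projExt H δ (D.cutoff h b) - D.projExt ∅ δ (D.cutoff h b))‖ := rfl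

theorem exists_uniformLY {κ Q : ℝ} (hW : D.WeightBound κ Q) :
    ∃ C : ℝ, 1 ≤ C ∧ ∀ H : Set ℝ, H.OrdConnected → UniformLY D.nu C D.θ (D.Rop H 1) := by
  obtain ⟨C, hC, hLY⟩ := exists_uniform_lasotaYorke hW
  refine ⟨C, hC, fun H hH => ⟨fun φ => ?_, fun n φ => ?_⟩⟩
  · simpa using nu_Rop_le hW hH (u := 1) (by simp) φ
  · simpa using hLY H hH 1 (by simp) n φ

theorem IsSRB.leb_real_le (hμ : D.IsSRB μ) : ∃ K : ℝ, 1 ≤ K ∧ ∀ s, D.leb.real s ≤ K * μ.real s := by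
  have := hμ.1
  obtain ⟨K, hK, h, -⟩ := hμ.le_leb
  refine ⟨K, hK, fun s => ?_⟩
  have h1 := ENNReal.toReal_mono (ENNReal.mul_ne_top ENNReal.coe_ne_top (measure_ne_top μ s)) (h s)
  rwa [ENNReal.toReal_mul, ENNReal.coe_toReal] at h1

theorem projExt_eq_proj {κ Q : ℝ} (hW : D.WeightBound κ Q) {H : Set ℝ} (hH : H.OrdConnected) {δ : ℝ}
    (hδ : 0 < δ) (hδ1 : δ < 1) (hs : Metric.sphere (1 : ℂ) δ ⊆ resolventSet ℂ (D.Rop H 1))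
    (φ : D.BV) : D.projExt H δ φ = D.proj H δ φ := by
  unfold projExt proj
  rw [toBV_eq (Rop_one_apply hW hH φ), smul_apply,
    circleIntegral_resolvent_apply hδ hδ1 hs]

/-- Stability of the spectral projections under small holes, in terms of the effect of the hole on
the `N`-th iterates. -/
theorem IsSRB.exists_stability (hμ : D.IsSRB μ) {κ Q : ℝ} (hW : D.WeightBound κ Q) {h : D.X → ℝ}
    (hh : D.IsDensity μ h) {δ : ℝ} (hadm : D.Admissible D.θ δ) :
    ∃ σ > 0, (∀ H : Set ℝ, H.OrdConnected → D.meas μ H < σ →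
      Metric.sphere (1 : ℂ) δ ⊆ resolventSet ℂ (D.Rop H 1)) ∧
    ∃ C > 0, ∀ H : Set ℝ, H.OrdConnected → D.meas μ H < σ → ∀ (N a b : ℕ) (c : ℝ), 0 ≤ c →
      (∀ χ, ‖D.setIntegralL {x : D.X | a < D.R x} ((D.Rop H 1 ^ N) χ - (D.Rop ∅ 1 ^ N) χ)‖ ≤
        c * ‖χ‖) →
      D.projError H δ h a b ≤ C * ((1 - δ)⁻¹ ^ (N + 1) * c * D.tailGE μ b +
        (1 - δ)⁻¹ ^ (2 * N + 1) * (D.tailGT μ a * D.tailGE μ b * (D.θ ^ N + D.meas μ H))) := by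
  have := hμ.1
  obtain ⟨hδ, hδ1, hθδ, hsp⟩ := hadm
  obtain ⟨hθ, hθ1⟩ := D.θ_mem
  obtain ⟨C, hC, hLY⟩ := exists_uniformLY hW
  obtain ⟨Kμ, hKμ, hleb⟩ := hμ.leb_real_le
  have hρ : 0 < 1 - δ := by linarith
  -- Admissibility gives `θ < (1 - δ)²`, which is at most `1 - δ`; the circle thus stays outside the
  -- disc of radius `θ`.
  have hθρ : D.θ < 1 - δ := by nlinarith
  have hs₀ : Metric.sphere (1 : ℂ) δ ⊆ resolventSet ℂ (D.Rop ∅ 1) := by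
    intro z hz
    by_contra hcon
    have hz1 : z ∈ ({1} : Set ℂ) := hsp ▸ ⟨hcon, Metric.sphere_subset_closedBall hz⟩
    rw [mem_singleton_iff] at hz1
    rw [hz1, Metric.mem_sphere, dist_self] at hz
    exact hδ.ne hz
  obtain ⟨M₀, hM₀⟩ := (isCompact_sphere (1 : ℂ) δ).exists_bound_of_continuousOn
    ((continuousOn_resolvent (D.Rop ∅ 1)).mono hs₀)
  set M := max M₀ 0
  have hM0 : 0 ≤ M := le_max_right _ _
  have hM : ∀ z ∈ Metric.sphere (1 : ℂ) δ, ∀ φ, ‖resolvent (D.Rop ∅ 1) z φ‖ ≤ M * ‖φ‖ :=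
    fun z hz φ => (ContinuousLinearMap.le_opNorm _ _).trans <| by
      gcongr
      exact (hM₀ z hz).trans (le_max_left _ _)
  obtain ⟨η₀, hη₀, K, hK0, hlow⟩ := exists_uniform_lower_bound (ν := D.nu) nu_le_norm hC hθ hρ
    (by linarith : 1 - δ < 1) hθρ hM0
  have hm0 : ∀ H, 0 ≤ D.meas μ H := fun H => measureReal_nonneg
  -- The perturbation lives on `H` and is bounded there by `‖Tφ‖ ≤ 2C ‖φ‖`; `Kμ` converts Lebesgue
  -- measure into `μ`.
  have hν : ∀ H : Set ℝ, H.OrdConnected → ∀ φ : D.BV, D.nu (D.Rop H 1 φ - D.Rop ∅ 1 φ) ≤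
      2 * C * Kμ * D.meas μ H * ‖φ‖ := fun H hH φ => by
    have h1 := nu_sub_le_of_openT hH (Rop_one_apply hW hH φ)
      (Rop_one_apply hW ordConnected_empty φ)
    have h2 := (hLY ∅ ordConnected_empty).norm_pow_le nu_le_norm (by linarith) hθ.le hθ1.le 1 φ
    rw [pow_one] at h2
    have hmH := hm0 H
    calc _ ≤ _ := h1
      _ ≤ Kμ * D.meas μ H * (2 * C * ‖φ‖) := by
        gcongr
        exact hleb _
      _ = _ := by ring
  have hσ : ∀ H, D.meas μ H < η₀ / (2 * C * Kμ) → 2 * C * Kμ * D.meas μ H ≤ η₀ := fun H hH => by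
    rw [lt_div_iff₀ (by positivity)] at hH
    linarith
  have hlowH : ∀ H : Set ℝ, H.OrdConnected → D.meas μ H < η₀ / (2 * C * Kμ) →
      ∀ z ∈ Metric.sphere (1 : ℂ) δ, ∀ φ, ‖φ‖ ≤ K * ‖z • φ - D.Rop H 1 φ‖ := by
    intro H hH hHσ z hz
    refine hlow _ _ (hLY ∅ ordConnected_empty) (hLY H hH) (fun φ => (hν H hH φ).trans ?_) z (hs₀ hz)
      (one_sub_le_norm_of_mem_sphere hz) (hM z hz)
    gcongr
    exact hσ H hHσ
  have hres : ∀ H : Set ℝ, H.OrdConnected → D.meas μ H < η₀ / (2 * C * Kμ) →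
      Metric.sphere (1 : ℂ) δ ⊆ resolventSet ℂ (D.Rop H 1) := fun H hH hHσ =>
    sphere_subset_resolventSet hδ hK0
      (fun n φ => (hLY H hH).norm_pow_le nu_le_norm (by linarith) hθ.le hθ1.le n φ) (hlowH H hH hHσ)
  refine ⟨η₀ / (2 * C * Kμ), by positivity, hres, ?_⟩
  let hB : D.BV := ⟨_, hh.1⟩
  have hQ := hW.one_le
  set B := (Q + 6) * Q * ‖hB‖ * Kμ with hBdef
  have hB0 : 0 ≤ B := by positivity
  set L := C * (M + (1 / δ + M * C)) * (4 * C * K + K + 3) with hL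
  have hL0 : 0 ≤ L := by positivity
  -- None of these constants involves `N`, `a`, `b` or the hole; the added `1` only secures
  -- positivity.
  refine ⟨K * B + Kμ * L * B * (2 * C * Kμ) + 1, by positivity, fun H hH hHσ N a b c hc hκ => ?_⟩
  obtain ⟨χ, hχ, hχn⟩ := openT_cutoff hW hH hB (fun _ => rfl) b
  obtain ⟨χ₀, hχ₀, hχ₀n⟩ := openT_cutoff hW ordConnected_empty hB (fun _ => rfl) b
  have hGE : (Q + 6) * Q * ‖hB‖ * D.leb.real {x : D.X | b ≤ D.R x} ≤ B * D.tailGE μ b := by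
    calc _ ≤ (Q + 6) * Q * ‖hB‖ * (Kμ * D.tailGE μ b) := by gcongr; exact hleb _
      _ = _ := by rw [hBdef]; ring
  have hGE0 : 0 ≤ D.tailGE μ b := measureReal_nonneg
  have hGT0 : 0 ≤ D.tailGT μ a := measureReal_nonneg
  have hmH := hm0 H
  have hmain := norm_functional_proj_sub_le (ν := D.nu) nu_le_norm (C := C) (θ := D.θ) (δ := δ) (M := M)
    (K := K) (η := 2 * C * Kμ * D.meas μ H) (τ := Kμ * D.tailGT μ a) (b := B * D.tailGE μ b) (κ := c)
    hC hθ hδ hδ1 hθρ hM0 hK0.le (by positivity) (by positivity) (by positivity) hc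
    (hLY ∅ ordConnected_empty) (hLY H hH) (hν H hH) hs₀ (hres H hH hHσ) hM
    (fun z hz => norm_resolvent_apply_le (hres H hH hHσ hz) (hlowH H hH hHσ z hz))
    (hχn.trans hGE) (hχ₀n.trans hGE) ?_ (Λ := D.setIntegralL {x : D.X | a < D.R x})
    (fun ψ => (norm_setIntegralL_le _ ψ).trans (by gcongr; exact hleb _)) (N := N) hκ
  · rw [projError_eq]
    unfold projExt
    rw [toBV_eq hχ, toBV_eq hχ₀]
    refine hmain.trans ?_
    have hq : 1 ≤ (1 - δ)⁻¹ := (one_le_inv₀ hρ).2 (by linarith)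
    have hCK : 1 ≤ 2 * C * Kμ := by nlinarith
    set q := (1 - δ)⁻¹
    have hθN : 0 ≤ D.θ ^ N := by positivity
    have e1 : D.θ ^ N + 2 * C * Kμ * D.meas μ H ≤ 2 * C * Kμ * (D.θ ^ N + D.meas μ H) := by
      nlinarith
    have e2 : q ^ (2 * N + 1) = q ^ (N + 1) * q ^ N := by rw [← pow_add]; congr 1; ring
    calc _ = K * B * (q ^ (N + 1) * c * D.tailGE μ b) + Kμ * L * B * (q ^ (2 * N + 1) *
          (D.tailGT μ a * D.tailGE μ b * (D.θ ^ N + 2 * C * Kμ * D.meas μ H))) := by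
          rw [e2, hL]; ring
      _ ≤ K * B * (q ^ (N + 1) * c * D.tailGE μ b) + Kμ * L * B * (q ^ (2 * N + 1) *
          (D.tailGT μ a * D.tailGE μ b * (2 * C * Kμ * (D.θ ^ N + D.meas μ H)))) := by
          gcongr
      _ = K * B * (q ^ (N + 1) * c * D.tailGE μ b) + Kμ * L * B * (2 * C * Kμ) *
          (q ^ (2 * N + 1) * (D.tailGT μ a * D.tailGE μ b * (D.θ ^ N + D.meas μ H))) := by ring
      _ ≤ (K * B + Kμ * L * B * (2 * C * Kμ) + 1) * (q ^ (N + 1) * c * D.tailGE μ b) +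
          (K * B + Kμ * L * B * (2 * C * Kμ) + 1) *
          (q ^ (2 * N + 1) * (D.tailGT μ a * D.tailGE μ b * (D.θ ^ N + D.meas μ H))) := by
          have p1 : 0 ≤ K * B := by positivity
          have p2 : 0 ≤ Kμ * L * B * (2 * C * Kμ) := by positivity
          gcongr <;> linarith
      _ = _ := by ring
  · refine (nu_sub_le_of_openT hH hχ hχ₀).trans ?_
    have hCK : 1 ≤ 2 * C := by linarith
    calc _ ≤ Kμ * D.meas μ H * (B * D.tailGE μ b) := by
          gcongr
          · exact hleb _
          · exact hχ₀n.trans hGE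
      _ ≤ 2 * C * (Kμ * D.meas μ H * (B * D.tailGE μ b)) :=
          le_mul_of_one_le_left (by positivity) hCK
      _ = _ := by ring

end YoungBase

/-! ### Interpolation and elementary inequalities. -/

section RealInequalities

theorem min_le_rpow_mul_rpow {x y s : ℝ} (hx : 0 ≤ x) (hy : 0 ≤ y) (hs : 0 ≤ s) (hs1 : s ≤ 1) :
    min x y ≤ x ^ s * y ^ (1 - s) := by
  have hm : 0 ≤ min x y := le_min hx hy
  calc min x y = min x y ^ (s + (1 - s)) := by rw [add_sub_cancel, Real.rpow_one]
    _ = min x y ^ s * min x y ^ (1 - s) := Real.rpow_add_of_nonneg hm hs (by linarith)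
    _ ≤ _ := by
      gcongr
      · exact min_le_left _ _
      · exact min_le_right _ _

/-- Interpolating each minimum geometrically leaves the positive power `θ^{i(1-s)}`, so the sum over
`i` is bounded independently of `N`. -/
theorem sum_min_mul_pow_le {x y θ s : ℝ} (hx : 0 ≤ x) (hy : 0 ≤ y) (hθ : 0 < θ) (hθ1 : θ < 1)
    (hs : 0 ≤ s) (hs1 : s < 1) (N : ℕ) :
    ∑ i ∈ Finset.range N, min x (y * θ ^ i) ≤ x ^ s * y ^ (1 - s) * (1 - θ ^ (1 - s))⁻¹ := by
  have h0 : 0 ≤ θ ^ (1 - s) := by positivity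
  have h1 : θ ^ (1 - s) < 1 := Real.rpow_lt_one hθ.le hθ1 (by linarith)
  have hterm : ∀ i : ℕ, min x (y * θ ^ i) ≤ x ^ s * y ^ (1 - s) * (θ ^ (1 - s)) ^ i := fun i => by
    refine (min_le_rpow_mul_rpow hx (by positivity) hs hs1.le).trans_eq ?_
    rw [Real.mul_rpow hy (by positivity), mul_assoc, ← Real.rpow_natCast, ← Real.rpow_mul hθ.le,
      mul_comm (i : ℝ), Real.rpow_mul hθ.le, Real.rpow_natCast]
  calc _ ≤ ∑ i ∈ Finset.range N, x ^ s * y ^ (1 - s) * (θ ^ (1 - s)) ^ i :=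
        Finset.sum_le_sum fun i _ => hterm i
    _ ≤ _ := by
        rw [← Finset.mul_sum]
        gcongr
        rw [← tsum_geometric_of_lt_one h0 h1]
        exact (summable_geometric_of_lt_one h0 h1).sum_le_tsum _ fun i _ => by positivity

/-- Bernoulli's inequality and `1 + δ ≤ (1 - δ)⁻¹`. It serves to trade the number of iterates for
one more factor `(1 - δ)^{-N}`. -/
theorem natCast_le_inv_pow {δ : ℝ} (hδ : 0 < δ) (hδ1 : δ < 1) (N : ℕ) :
    (N : ℝ) ≤ δ⁻¹ * (1 - δ)⁻¹ ^ N := by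
  have h1 : 1 + δ ≤ (1 - δ)⁻¹ := by
    rw [← one_div, le_div_iff₀ (by linarith)]
    nlinarith
  have h2 := one_add_mul_le_pow (by linarith : -2 ≤ δ) N
  have h3 : (1 + δ) ^ N ≤ (1 - δ)⁻¹ ^ N := by gcongr
  rw [← div_eq_inv_mul, le_div_iff₀ hδ]
  linarith

end RealInequalities

/-! ### Telescoping the difference of powers. -/

section Telescoping

variable {E : Type*} [NormedAddCommGroup E] [NormedSpace ℂ E]

/-- The closed operator is placed on the outside, so that the supports of the summands can be
followed as forward images of the hole. -/
theorem pow_apply_sub_pow_apply (A A₀ : E →L[ℂ] E) (N : ℕ) (χ : E) : (A ^ N) χ - (A₀ ^ N) χ =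
    ∑ i ∈ Finset.range N, (A₀ ^ i) (A ((A ^ (N - 1 - i)) χ) - A₀ ((A ^ (N - 1 - i)) χ)) := by
  induction N with
  | zero => simp
  | succ n ih =>
    have h : ∀ i ∈ Finset.range n,
        (A₀ ^ (i + 1)) (A ((A ^ (n + 1 - 1 - (i + 1))) χ) - A₀ ((A ^ (n + 1 - 1 - (i + 1))) χ)) =
        A₀ ((A₀ ^ i) (A ((A ^ (n - 1 - i)) χ) - A₀ ((A ^ (n - 1 - i)) χ))) := fun i _ => by
      rw [show n + 1 - 1 - (i + 1) = n - 1 - i by omega, pow_succ', mul_apply_eq_comp]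
    rw [Finset.sum_range_succ', Finset.sum_congr rfl h, ← map_sum, ← ih, pow_succ', pow_succ',
      mul_apply_eq_comp, mul_apply_eq_comp, map_sub]
    simp

end Telescoping

/-! ### The effect of the hole on the iterates. -/

namespace YoungBase

variable {D : YoungBase} {μ : Measure D.X}

theorem T_eq_zero {ψ : D.X → ℂ} {S : Set D.X} (hψ : ∀ y ∉ S, ψ y = 0) {x : D.X}
    (hx : x ∉ D.fX '' S) : D.T ψ x = 0 := by
  unfold T
  rw [← tsum_zero (β := D.fibre x)]
  refine tsum_congr fun y => ?_
  rw [hψ y.1 fun hy => hx ⟨y.1, hy, y.2.2⟩, zero_div]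

/-- The transfer operator moves supports forward: a value at `x` uses only values at preimages of
`x`. -/
theorem Rop_pow_eq_zero {κ Q : ℝ} (hW : D.WeightBound κ Q) {ψ : D.BV} {S : Set D.X}
    (hψ : ∀ y ∉ S, ψ y = 0) (n : ℕ) {x : D.X} (hx : x ∉ D.fX^[n] '' S) :
    (D.Rop ∅ 1 ^ n) ψ x = 0 := by
  induction n generalizing x with
  | zero =>
    refine hψ x ?_
    simpa using hx
  | succ n ih =>
    rw [pow_succ', mul_apply_eq_comp, Rop_one_apply hW ordConnected_empty, openT_empty]
    refine T_eq_zero (fun y hy => ih hy) ?_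
    rwa [Function.iterate_succ', image_comp] at hx

theorem Rop_sub_eq_zero {κ Q : ℝ} (hW : D.WeightBound κ Q) {H : Set ℝ} (hH : H.OrdConnected)
    (φ : D.BV) {x : D.X} (hx : (x : ℝ) ∉ H) : (D.Rop H 1 φ - D.Rop ∅ 1 φ : D.BV) x = 0 := by
  classical
  have e : (D.Rop H 1 φ - D.Rop ∅ 1 φ : D.BV) x = D.Rop H 1 φ x - D.Rop ∅ 1 φ x := rfl
  rw [e, Rop_one_apply hW hH, Rop_one_apply hW ordConnected_empty, openT_empty, openT_apply,
    if_neg hx, sub_self]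

theorem sepTime_ge_of_diamθ_le {H : Set ℝ} {z₀ : ℝ} (hz₀ : z₀ ∈ H) {N : ℕ}
    (hd : D.diamθ H ≤ D.θ ^ N) {y : ℝ} (hy : y ∈ H) (hne : y ≠ z₀) : N ≤ D.sepTime y z₀ := by
  obtain ⟨hθ, hθ1⟩ := D.θ_mem
  -- The diameter is a real `sSup`, which bounds the distances only once the set is known to be
  -- bounded above.
  have hbdd : BddAbove {r | ∃ x ∈ H, ∃ y ∈ H, r = D.dθ x y} := by
    refine ⟨1, ?_⟩
    rintro _ ⟨x, -, y, -, rfl⟩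
    unfold dθ
    split_ifs
    · exact zero_le_one
    · exact pow_le_one₀ hθ.le hθ1.le
  have h1 : D.dθ y z₀ ≤ D.diamθ H := le_csSup hbdd ⟨y, hy, z₀, hz₀, rfl⟩
  rw [dθ, if_neg hne] at h1
  exact (pow_le_pow_iff_right_of_lt_one₀ hθ hθ1).1 (h1.trans hd)

/-- A hole that is small in the separation metric follows the orbit of its centre, and the return
times along this piece of orbit are bounded. -/
theorem R_iterate_eq {H : Set ℝ} {z₀ : ℝ} (hz₀ : z₀ ∈ H) {N : ℕ} (hd : D.diamθ H ≤ D.θ ^ N) {y : ℝ}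
    (hy : y ∈ H) {i : ℕ} (hi : i < N) : D.R (D.f^[i] y) = D.R (D.f^[i] z₀) := by
  rcases eq_or_ne y z₀ with rfl | hne
  · rfl
  have h1 := hi.trans_le (sepTime_ge_of_diamθ_le hz₀ hd hy hne)
  have h2 := Nat.notMem_of_lt_sInf h1
  simp only [mem_ofPred_eq, not_not] at h2
  obtain ⟨j, hj1, hj2⟩ := h2
  exact D.R_const j _ hj1 _ hj2

/-- A small hole does not affect the `N`-th iterate on the part of the base with large return
time. -/
theorem setIntegralL_pow_sub_eq_zero {κ Q : ℝ} (hW : D.WeightBound κ Q) {H : Set ℝ} {z₀ : ℝ}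
    (hH : D.IsHole z₀ H) {N a : ℕ} (hd : D.diamθ H ≤ D.θ ^ N)
    (ha : ∀ i < N, D.R (D.f^[i] z₀) ≤ a) (χ : D.BV) :
    D.setIntegralL {x : D.X | a < D.R x} ((D.Rop H 1 ^ N) χ - (D.Rop ∅ 1 ^ N) χ) = 0 := by
  rw [pow_apply_sub_pow_apply, map_sum]
  refine Finset.sum_eq_zero fun i hi => ?_
  rw [setIntegralL_apply]
  refine setIntegral_eq_zero_of_forall_eq_zero fun x hx => ?_
  refine Rop_pow_eq_zero hW (S := {y : D.X | (y : ℝ) ∈ H})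
    (fun y hy => Rop_sub_eq_zero hW hH.2.2 _ hy) i ?_
  rintro ⟨y, hy, rfl⟩
  have h1 := R_iterate_eq hH.1 hd hy (Finset.mem_range.1 hi)
  have h2 := ha i (Finset.mem_range.1 hi)
  have h3 : a < D.R (D.fX^[i] y) := hx
  rw [coe_iterate_fX, h1] at h3
  omega

/-- The effect of a hole on the `N`-th iterate, in general. -/
theorem IsSRB.exists_pow_sub_bound (hμ : D.IsSRB μ) {κ Q : ℝ} (hW : D.WeightBound κ Q) {s : ℝ}
    (hs : 0 ≤ s) (hs1 : s < 1) : ∃ C > 0, ∀ H : Set ℝ, H.OrdConnected → ∀ (N a : ℕ) (χ : D.BV),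
      ‖D.setIntegralL {x : D.X | a < D.R x} ((D.Rop H 1 ^ N) χ - (D.Rop ∅ 1 ^ N) χ)‖ ≤
        C * (D.tailGT μ a ^ (1 - s) * D.meas μ H ^ s + N * (D.tailGT μ a * D.meas μ H)) * ‖χ‖ := by
  have := hμ.1
  obtain ⟨hθ, hθ1⟩ := D.θ_mem
  obtain ⟨C, hC, hLY⟩ := exists_uniformLY hW
  obtain ⟨Kμ, hKμ, hleb⟩ := hμ.leb_real_le
  set G := (1 - D.θ ^ (1 - s))⁻¹ with hG
  have hG0 : 0 < G := inv_pos.2 (sub_pos.2 (Real.rpow_lt_one hθ.le hθ1 (by linarith)))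
  refine ⟨8 * C ^ 3 * (Kμ * G + Kμ * Kμ), by positivity, fun H hH N a χ => ?_⟩
  set m := Kμ * D.meas μ H with hm
  set τ := Kμ * D.tailGT μ a with hτ
  have hm00 : 0 ≤ D.meas μ H := measureReal_nonneg
  have hτ00 : 0 ≤ D.tailGT μ a := measureReal_nonneg
  have hm0 : 0 ≤ m := by positivity
  have hτ0 : 0 ≤ τ := by positivity
  have hpow : ∀ H : Set ℝ, H.OrdConnected → ∀ n φ, ‖(D.Rop H 1 ^ n) φ‖ ≤ 2 * C * ‖φ‖ :=
    fun H hH n φ => (hLY H hH).norm_pow_le nu_le_norm (by linarith) hθ.le hθ1.le n φ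
  have hone : ∀ H : Set ℝ, H.OrdConnected → ∀ φ, ‖D.Rop H 1 φ‖ ≤ 2 * C * ‖φ‖ := fun H hH φ => by
    simpa using hpow H hH 1 φ
  have hterm : ∀ i ∈ Finset.range N, ‖D.setIntegralL {x : D.X | a < D.R x} ((D.Rop ∅ 1 ^ i)
      (D.Rop H 1 ((D.Rop H 1 ^ (N - 1 - i)) χ) - D.Rop ∅ 1 ((D.Rop H 1 ^ (N - 1 - i)) χ)))‖ ≤
      8 * C ^ 3 * ‖χ‖ * (min m (τ * D.θ ^ i) + τ * m) := by
    intro i _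
    set φ := (D.Rop H 1 ^ (N - 1 - i)) χ with hφ
    set ψ := D.Rop H 1 φ - D.Rop ∅ 1 φ with hψ
    have hφn : ‖φ‖ ≤ 2 * C * ‖χ‖ := hpow H hH _ χ
    have hψn : ‖ψ‖ ≤ 8 * C ^ 2 * ‖χ‖ := by
      calc ‖ψ‖ ≤ 2 * C * ‖φ‖ + 2 * C * ‖φ‖ := (norm_sub_le _ _).trans
            (add_le_add (hone H hH φ) (hone ∅ ordConnected_empty φ))
        _ ≤ 2 * C * (2 * C * ‖χ‖) + 2 * C * (2 * C * ‖χ‖) := by gcongr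
        _ = _ := by ring
    have hψν : D.nu ψ ≤ m * (8 * C ^ 2 * ‖χ‖) := by
      calc D.nu ψ ≤ D.leb.real {x : D.X | (x : ℝ) ∈ H} * ‖D.Rop ∅ 1 φ‖ :=
            nu_sub_le_of_openT hH (Rop_one_apply hW hH φ) (Rop_one_apply hW ordConnected_empty φ)
        _ ≤ m * (2 * C * (2 * C * ‖χ‖)) := by
            gcongr
            · exact hleb _
            · exact (hone ∅ ordConnected_empty φ).trans (by gcongr)
        _ ≤ m * (8 * C ^ 2 * ‖χ‖) := by
            refine mul_le_mul_of_nonneg_left ?_ hm0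
            have : 0 ≤ C ^ 2 * ‖χ‖ := by positivity
            nlinarith
    set Z := 8 * C ^ 2 * ‖χ‖ with hZ
    have hZ0 : 0 ≤ Z := by positivity
    -- First bound: ignore the restriction to `{R > a}` and use `L¹` contraction. The result is
    -- proportional to the measure of the hole.
    have b1 : ‖D.setIntegralL {x : D.X | a < D.R x} ((D.Rop ∅ 1 ^ i) ψ)‖ ≤ C * Z * m := by
      calc _ ≤ D.nu ((D.Rop ∅ 1 ^ i) ψ) := norm_setIntegralL_le_nu _ _
        _ ≤ D.nu ψ := (hLY ∅ ordConnected_empty).weak_pow i ψ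
        _ ≤ 1 * (m * Z) := by rw [one_mul]; exact hψν
        _ ≤ C * (m * Z) := by gcongr
        _ = _ := by ring
    -- Second bound: supremum times the measure of `{R > a}`, with the Lasota–Yorke inequality for
    -- `i` steps controlling the supremum.
    have b2 : ‖D.setIntegralL {x : D.X | a < D.R x} ((D.Rop ∅ 1 ^ i) ψ)‖ ≤
        C * Z * (τ * D.θ ^ i + τ * m) := by
      calc _ ≤ D.leb.real {x : D.X | a < D.R x} * ‖(D.Rop ∅ 1 ^ i) ψ‖ := norm_setIntegralL_le _ _
        _ ≤ τ * (C * D.θ ^ i * Z + C * (m * Z)) := by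
            gcongr
            · exact hleb _
            · exact ((hLY ∅ ordConnected_empty).strong i ψ).trans (by gcongr)
        _ = _ := by ring
    have e : 8 * C ^ 3 * ‖χ‖ = C * Z := by rw [hZ]; ring
    rw [e]
    have hCZ : 0 ≤ C * Z := by positivity
    have hτm : 0 ≤ τ * m := by positivity
    rcases le_total m (τ * D.θ ^ i) with h | h
    · rw [min_eq_left h]
      exact b1.trans (by gcongr; linarith)
    · rw [min_eq_right h]
      exact b2
  rw [pow_apply_sub_pow_apply, map_sum]
  have hmin := sum_min_mul_pow_le hm0 hτ0 hθ hθ1 hs hs1 N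
  have hms : m ^ s * τ ^ (1 - s) ≤ Kμ * (D.tailGT μ a ^ (1 - s) * D.meas μ H ^ s) := by
    rw [hm, hτ, Real.mul_rpow (by positivity) hm00, Real.mul_rpow (by positivity) hτ00]
    have hK : Kμ ^ s * Kμ ^ (1 - s) = Kμ := by
      rw [← Real.rpow_add (by positivity), add_sub_cancel, Real.rpow_one]
    refine le_of_eq ?_
    linear_combination (D.meas μ H ^ s * D.tailGT μ a ^ (1 - s)) * hK
  set X := D.tailGT μ a ^ (1 - s) * D.meas μ H ^ s with hX
  have hX0 : 0 ≤ X := by positivity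
  set Y := (N : ℝ) * (D.tailGT μ a * D.meas μ H) with hY
  have hY0 : 0 ≤ Y := by positivity
  calc _ ≤ ∑ i ∈ Finset.range N, 8 * C ^ 3 * ‖χ‖ * (min m (τ * D.θ ^ i) + τ * m) :=
        (norm_sum_le _ _).trans (Finset.sum_le_sum hterm)
    _ = 8 * C ^ 3 * ‖χ‖ * (∑ i ∈ Finset.range N, min m (τ * D.θ ^ i) + N * (τ * m)) := by
        rw [← Finset.mul_sum, Finset.sum_add_distrib, Finset.sum_const, Finset.card_range,
          nsmul_eq_mul]
    _ ≤ 8 * C ^ 3 * ‖χ‖ * (Kμ * X * G + Kμ * Kμ * Y) := by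
        gcongr ?_ * (?_ + ?_)
        · exact hmin.trans (by gcongr)
        · exact le_of_eq (by rw [hY, hm, hτ]; ring)
    _ ≤ 8 * C ^ 3 * ‖χ‖ * ((Kμ * G + Kμ * Kμ) * (X + Y)) := by
        gcongr
        have h1 : 0 ≤ Kμ * G * Y := by positivity
        have h2 : 0 ≤ Kμ * Kμ * X := by positivity
        nlinarith
    _ = _ := by ring

end YoungBase

/-! ### Assembly of the two estimates. -/

theorem mainTheorem5 (D : YoungBase) (μ : Measure D.X) (hμ : D.IsSRB μ)
    (z₀ : ℝ) (hz₀ : z₀ ∈ D.X) (hz₀S : z₀ ∉ D.singular) :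
    -- the transfer operators `φ ↦ T(u^R 1_{Hᶜ}∘f φ)` are bounded operators on `B`
    (∀ H : Set ℝ, H.OrdConnected → ∀ u : ℂ, ‖u‖ ≤ 1 → D.IsRop H u (D.Rop H u)) ∧
    ∃ h : D.X → ℝ, D.IsDensity μ h ∧
    (∀ H : Set ℝ, H.OrdConnected → ∀ b : ℕ, D.openT H (D.cutoff h b) ∈ D.bv) ∧
    ∃ θb : ℝ, 0 < θb ∧ θb < 1 ∧ D.LasotaYorke μ z₀ θb ∧ (∃ δ, D.Admissible θb δ) ∧
    ∀ δ, D.Admissible θb δ →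
    ∃ σ > 0,
      -- the projections (and their extensions) are well defined
      (∀ H : Set ℝ, (H = ∅ ∨ D.IsHole z₀ H ∧ 0 < D.meas μ H ∧ D.meas μ H < σ) →
        Metric.sphere (1 : ℂ) δ ⊆ resolventSet ℂ (D.Rop H 1) ∧
        ∀ φ : D.BV, D.projExt H δ φ = D.proj H δ φ) ∧
      ∃ C > 0,
        -- the estimate for `a` large compared with `N`
        (∀ N : ℕ, 1 ≤ N → ∃ aN : ℕ, 0 < aN ∧
          ∀ H : Set ℝ, D.IsHole z₀ H → 0 < D.meas μ H → D.meas μ H < σ → D.diamθ H ≤ D.θ ^ N →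
          ∀ a : ℕ, aN < a → ∀ b : ℕ, 1 ≤ b →
            D.projError H δ h a b ≤ C *
              (D.tailGT μ a / (1 - δ) ^ (N + 1) *
                  (θb ^ N * D.tailGE μ b + D.meas μ H * D.tailGE μ b) +
                D.tailGT μ a * (θb ^ N / (1 - δ) ^ (2 * N + 1)) * D.tailGE μ b +
                D.tailGT μ a / (1 - δ) ^ (2 * N + 3) * D.meas μ H * D.tailGE μ b)) ∧
        -- the estimate for all `a`
        (∀ N : ℕ, 1 ≤ N →
          ∀ H : Set ℝ, D.IsHole z₀ H → 0 < D.meas μ H → D.meas μ H < σ →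
          ∀ a b : ℕ, 1 ≤ b →
            D.projError H δ h a b ≤ C *
              (1 / (1 - δ) ^ (N + 3) *
                  D.tailGT μ a ^ (2 * (D.k : ℝ) / (2 * (D.k : ℝ) + D.β)) *
                  D.meas μ H ^ (D.β / (2 * (D.k : ℝ) + D.β)) * D.tailGE μ b +
                D.tailGT μ a / (1 - δ) ^ (N + 1) *
                  (θb ^ N * D.tailGE μ b + D.meas μ H * D.tailGE μ b) +
                D.tailGT μ a * (θb ^ N / (1 - δ) ^ (2 * N + 1)) * D.tailGE μ b +
                D.tailGT μ a / (1 - δ) ^ (2 * N + 3) * D.meas μ H * D.tailGE μ b)) := by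
  obtain ⟨κ, Q, hW⟩ := D.exists_weightBound
  have := hμ.1
  obtain ⟨hθ, hθ1⟩ := D.θ_mem
  obtain ⟨h, hh⟩ := hμ.exists_density hW
  refine ⟨fun H hH u hu => YoungBase.isRop_Rop hW hH hu, h, hh, fun H hH b => ?_, D.θ, hθ, hθ1, ?_,
    YoungBase.exists_admissible hW, fun δ hadm => ?_⟩
  · obtain ⟨χ, hχ, -⟩ := YoungBase.openT_cutoff hW hH (⟨_, hh.1⟩ : D.BV) (fun _ => rfl) b
    rw [← hχ]
    exact χ.2
  · obtain ⟨C, hC, hLY⟩ := YoungBase.exists_uniform_lasotaYorke hW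
    -- The inequality was proved for interval holes of every size, so the threshold `1` is
    -- arbitrary.
    refine ⟨C, by linarith, 1, one_pos, fun H hH u hu n _ φ => ?_⟩
    have hHo : H.OrdConnected := by
      rcases hH with rfl | hH
      · exact ordConnected_empty
      · exact hH.1.2.2
    refine (hLY H hHo u hu n φ).trans_eq ?_
    rw [YoungBase.nu_apply]
    ring
  obtain ⟨σ, hσ, hres, C, hC, hstab⟩ := hμ.exists_stability hW hh hadm
  obtain ⟨hδ, hδ1, -, -⟩ := hadm
  have h1δ : 0 < 1 - δ := by linarith
  have h1δ' : 1 - δ ≤ 1 := by linarith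
  obtain ⟨hβ0, hβ1⟩ := D.β_mem
  have hk : (1 : ℝ) ≤ D.k := by exact_mod_cast D.one_le_k
  have hden : 0 < 2 * (D.k : ℝ) + D.β := by positivity
  set s := D.β / (2 * (D.k : ℝ) + D.β) with hs
  have hs0 : 0 ≤ s := by positivity
  have hs1 : s < 1 := by rw [hs, div_lt_one hden]; linarith
  -- The two exponents of the statement add up to `1`, as the interpolation requires.
  have hs' : 2 * (D.k : ℝ) / (2 * (D.k : ℝ) + D.β) = 1 - s := by rw [hs]; field_simp; ring
  obtain ⟨C', hC', hpow⟩ := hμ.exists_pow_sub_bound hW hs0 hs1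
  have hGE : ∀ b, 0 ≤ D.tailGE μ b := fun _ => measureReal_nonneg
  have hGT : ∀ a, 0 ≤ D.tailGT μ a := fun _ => measureReal_nonneg
  have hm : ∀ H, 0 ≤ D.meas μ H := fun _ => measureReal_nonneg
  have hinv : ∀ n : ℕ, (1 - δ)⁻¹ ^ n = 1 / (1 - δ) ^ n := fun n => by rw [inv_pow, one_div]
  have hmono : ∀ m n : ℕ, m ≤ n → 1 / (1 - δ) ^ m ≤ 1 / (1 - δ) ^ n := fun m n hmn => by
    have := pow_le_pow_of_le_one h1δ.le h1δ' hmn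
    gcongr
  have hmain : ∀ (H : Set ℝ) (N a b : ℕ), (1 - δ)⁻¹ ^ (2 * N + 1) *
      (D.tailGT μ a * D.tailGE μ b * (D.θ ^ N + D.meas μ H)) ≤
      D.tailGT μ a / (1 - δ) ^ (N + 1) * (D.θ ^ N * D.tailGE μ b + D.meas μ H * D.tailGE μ b) +
        D.tailGT μ a * (D.θ ^ N / (1 - δ) ^ (2 * N + 1)) * D.tailGE μ b +
        D.tailGT μ a / (1 - δ) ^ (2 * N + 3) * D.meas μ H * D.tailGE μ b := by
    intro H N a b
    have h1 := hmono (2 * N + 1) (2 * N + 3) (by omega)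
    have hm := hm H
    have hGE := hGE b
    have hGT := hGT a
    have h2 : 0 ≤ D.tailGT μ a / (1 - δ) ^ (N + 1) *
      (D.θ ^ N * D.tailGE μ b + D.meas μ H * D.tailGE μ b) := by positivity
    have h3 : 0 ≤ D.tailGT μ a * D.tailGE μ b * D.meas μ H := by positivity
    have h4 := mul_le_mul_of_nonneg_right h1 h3
    rw [hinv]
    calc _ = D.tailGT μ a * (D.θ ^ N / (1 - δ) ^ (2 * N + 1)) * D.tailGE μ b +
          1 / (1 - δ) ^ (2 * N + 1) * (D.tailGT μ a * D.tailGE μ b * D.meas μ H) := by ring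
      _ ≤ D.tailGT μ a * (D.θ ^ N / (1 - δ) ^ (2 * N + 1)) * D.tailGE μ b +
          1 / (1 - δ) ^ (2 * N + 3) * (D.tailGT μ a * D.tailGE μ b * D.meas μ H) := by gcongr
      _ = D.tailGT μ a * (D.θ ^ N / (1 - δ) ^ (2 * N + 1)) * D.tailGE μ b +
          D.tailGT μ a / (1 - δ) ^ (2 * N + 3) * D.meas μ H * D.tailGE μ b := by ring
      _ ≤ _ := by linarith
  -- The summands pay for the interpolated term, for the term linear in `N`, and for the resolvent
  -- terms.
  refine ⟨σ, hσ, fun H hH => ?_, C * (C' + C' * δ⁻¹ + 1), by positivity, fun N _ => ?_,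
    fun N _ H hH _ hHσ a b _ => ?_⟩
  · obtain ⟨hHo, hHσ⟩ : H.OrdConnected ∧ D.meas μ H < σ := by
      rcases hH with rfl | hH
      · exact ⟨ordConnected_empty, by simpa [YoungBase.meas] using hσ⟩
      · exact ⟨hH.1.2.2, hH.2.2⟩
    exact ⟨hres H hHo hHσ, YoungBase.projExt_eq_proj hW hHo hδ hδ1 (hres H hHo hHσ)⟩
  -- The sum dominates every return time along the first `N` points of the orbit of `z₀` and depends
  -- on no hole; the `1` makes it positive.
  · refine ⟨1 + ∑ i ∈ Finset.range N, D.R (D.f^[i] z₀), by positivity,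
      fun H hH _ hHσ hd a ha b _ => ?_⟩
    have hzero := YoungBase.setIntegralL_pow_sub_eq_zero (a := a) hW hH hd fun i hi => by
      have := Finset.single_le_sum (f := fun i => D.R (D.f^[i] z₀)) (fun _ _ => Nat.zero_le _)
        (Finset.mem_range.2 hi)
      omega
    have h1 := hstab H hH.2.2 hHσ N a b 0 le_rfl fun χ => by rw [hzero χ]; simp
    rw [mul_zero, zero_mul, zero_add] at h1
    refine h1.trans ?_
    have h2 := hmain H N a b
    have hm := hm H
    have hGE := hGE b
    have hGT := hGT a
    gcongr ?_ * ?_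
    refine le_mul_of_one_le_right hC.le ?_
    have : 0 ≤ C' + C' * δ⁻¹ := by positivity
    linarith
  · have hmH := hm H
    have hGEb := hGE b
    have hGTa := hGT a
    have h1 := hstab H hH.2.2 hHσ N a b (C' * (D.tailGT μ a ^ (1 - s) * D.meas μ H ^ s +
      N * (D.tailGT μ a * D.meas μ H))) (by positivity) (hpow H hH.2.2 N a)
    rw [hs']
    refine h1.trans ?_
    rw [mul_assoc C]
    gcongr
    set X := D.tailGT μ a ^ (1 - s) * D.meas μ H ^ s * D.tailGE μ b with hX
    set Y := D.tailGT μ a * D.meas μ H * D.tailGE μ b with hY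
    have hX0 : 0 ≤ X := by positivity
    have hY0 : 0 ≤ Y := by positivity
    have e1 : (1 - δ)⁻¹ ^ (N + 1) * X ≤ 1 / (1 - δ) ^ (N + 3) * X := by
      rw [hinv]
      exact mul_le_mul_of_nonneg_right (hmono _ _ (by omega)) hX0
    -- The factor `N` from the telescoping sum is absorbed by `(1 - δ)^{-N}`, so this term merges
    -- with the last one of `E_N`.
    have e2 : (1 - δ)⁻¹ ^ (N + 1) * (N * Y) ≤ δ⁻¹ * (1 / (1 - δ) ^ (2 * N + 3) * Y) := by
      calc _ ≤ (1 - δ)⁻¹ ^ (N + 1) * (δ⁻¹ * (1 - δ)⁻¹ ^ N * Y) := by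
            gcongr
            exact natCast_le_inv_pow hδ hδ1 N
        _ = δ⁻¹ * ((1 - δ)⁻¹ ^ (2 * N + 1) * Y) := by ring
        _ ≤ _ := by
            rw [hinv]
            gcongr ?_ * (?_ * ?_)
            exact hmono _ _ (by omega)
    set W := D.tailGT μ a / (1 - δ) ^ (N + 1) *
      (D.θ ^ N * D.tailGE μ b + D.meas μ H * D.tailGE μ b) with hWd
    set V := D.tailGT μ a * (D.θ ^ N / (1 - δ) ^ (2 * N + 1)) * D.tailGE μ b with hV
    have e3 : D.tailGT μ a / (1 - δ) ^ (2 * N + 3) * D.meas μ H * D.tailGE μ b =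
      1 / (1 - δ) ^ (2 * N + 3) * Y := by rw [hY]; ring
    have e4 : 1 / (1 - δ) ^ (N + 3) * D.tailGT μ a ^ (1 - s) * D.meas μ H ^ s * D.tailGE μ b =
      1 / (1 - δ) ^ (N + 3) * X := by rw [hX]; ring
    have h2 := hmain H N a b
    rw [← hWd, ← hV, e3] at h2
    rw [e3, e4]
    have hW0 : 0 ≤ W := by positivity
    have hV0 : 0 ≤ V := by positivity
    set X' := 1 / (1 - δ) ^ (N + 3) * X
    set Y' := 1 / (1 - δ) ^ (2 * N + 3) * Y
    have hX0' : 0 ≤ X' := by positivity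
    have hY0' : 0 ≤ Y' := by positivity
    have hδi : 0 ≤ C' * δ⁻¹ := by positivity
    calc _ = C' * ((1 - δ)⁻¹ ^ (N + 1) * X) + C' * ((1 - δ)⁻¹ ^ (N + 1) * (N * Y)) +
          (1 - δ)⁻¹ ^ (2 * N + 1) *
            (D.tailGT μ a * D.tailGE μ b * (D.θ ^ N + D.meas μ H)) := by rw [hX, hY]; ring
      _ ≤ C' * X' + C' * (δ⁻¹ * Y') + (W + V + Y') := by gcongr
      _ = C' * X' + C' * δ⁻¹ * Y' + 1 * (W + V + Y') := by ring
      _ ≤ (C' + C' * δ⁻¹ + 1) * (X' + W + V + Y') := by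
          have p1 : 0 ≤ C' * δ⁻¹ * (X' + W + V) := by positivity
          have p2 : 0 ≤ C' * (W + V + Y') := by positivity
          nlinarith
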